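/- Let $A\in\mathbb{R}^{n\times n}$, $B\in\mathbb{R}^{n\times q}$, $C\in\mathbb{R}^{m\times n}$, $D\in\mathbb{R}^{m\times q}$, and let $X=X^\top=\begin{bmatrix}X^{11}&X^{12}\\X^{21}&X^{22}\end{bmatrix}\in\mathbb{R}^{(q+m)\times(q+m)}$ with $X^{11}\in\mathbb{R}^{q\times q}$ and $X^{22}\in\mathbb{R}^{m\times m}$. Consider the linear time-invariant system $\dot x=Ax+Bu$, $y=Cx+Du$, and let $\mathcal{X}\subset\mathbb{R}^n$ be a nonempty set of equilibrium states, i.e. for every $x^*\in\mathcal{X}$ there is $u^*\in\mathbb{R}^q$ with $Ax^*+Bu^*=0$; put $y^*=Cx^*+Du^*$. The system is called $X$-EID (equilibrium-independent dissipative with respect to $X$) if there is a continuously differentiable function $V:\mathbb{R}^n\times\mathcal{X}\to\mathbb{R}$ such that, for every $x^*\in\mathcal{X}$ and every $u^*$ with $Ax^*+Bu^*=0$, one has $V(x^*,x^*)=0$, $V(x,x^*)>0$ for all $x\ne x^*$, and $$\nabla_xV(x,x^*)\,(Ax+Bu)\le\begin{bmatrix}u-u^*\\y-y^*\end{bmatrix}^\top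 X\begin{bmatrix}u-u^*\\y-y^*\end{bmatrix}\qquad\text{with } y=Cx+Du,$$ for all $x\in\mathbb{R}^n$, $u\in\mathbb{R}^q$. Then the system is $X$-EID if and only if there exists a symmetric positive definite $P\in\mathbb{R}^{n\times n}$ such that the symmetric matrix $$\begin{bmatrix}-\mathcal{H}(PA)+C^\top X^{22}C & -PB+C^\top X^{21}+C^\top X^{22}D\\ \star & X^{11}+\mathcal{H}(X^{12}D)+D^\top X^{22}D\end{bmatrix}$$ is positive semidefinite, where $\mathcal{H}(M)=M+M^\top$ and $\star$ denotes the transpose of the upper right block. -/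

import Mathlib

open Matrix

/-- `𝒳` is a nonempty set of equilibrium states of `ẋ = f(x, u)`. -/
def IsEquilibriumSet {n q : ℕ} (f : (Fin n → ℝ) → (Fin q → ℝ) → (Fin n → ℝ))
    (𝒳 : Set (Fin n → ℝ)) : Prop :=
  𝒳.Nonempty ∧ ∀ xs ∈ 𝒳, ∃ us, f xs us = 0

/-- Equilibrium-independent dissipativity of `ẋ = f(x, u)`, `y = h(x, u)` over the set `𝒳` of
equilibrium states, under the supply rate `s`. The storage function `V` is only constrained on
`ℝⁿ × 𝒳`; `us` is the equilibrium input belonging to `xs`, and `h xs us` the equilibrium output. -/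
def IsEID {n q m : ℕ} (f : (Fin n → ℝ) → (Fin q → ℝ) → (Fin n → ℝ))
    (h : (Fin n → ℝ) → (Fin q → ℝ) → (Fin m → ℝ)) (𝒳 : Set (Fin n → ℝ))
    (s : (Fin q → ℝ) → (Fin m → ℝ) → ℝ) : Prop :=
  ∃ V : (Fin n → ℝ) → (Fin n → ℝ) → ℝ,
    ContDiffOn ℝ 1 (Function.uncurry V) (Set.univ ×ˢ 𝒳) ∧
    ∀ xs ∈ 𝒳,
      (∀ x, x ≠ xs → 0 < V x xs) ∧
      V xs xs = 0 ∧
      ∀ us, f xs us = 0 → ∀ x u,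
        fderiv ℝ (fun z => V z xs) x (f x u) ≤ s (u - us) (h x u - h xs us)

/-- The quadratic supply rate `(u, y) ↦ [u; y]ᵀ X [u; y]`. -/
def quadSupply {q m : ℕ} (X : Matrix (Fin q ⊕ Fin m) (Fin q ⊕ Fin m) ℝ)
    (u : Fin q → ℝ) (y : Fin m → ℝ) : ℝ :=
  Sum.elim u y ⬝ᵥ (X *ᵥ Sum.elim u y)

/-- `X`-EID: equilibrium-independent dissipativity under the quadratic supply rate of `X`. -/
def IsXEID {n q m : ℕ} (f : (Fin n → ℝ) → (Fin q → ℝ) → (Fin n → ℝ))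
    (h : (Fin n → ℝ) → (Fin q → ℝ) → (Fin m → ℝ)) (𝒳 : Set (Fin n → ℝ))
    (X : Matrix (Fin q ⊕ Fin m) (Fin q ⊕ Fin m) ℝ) : Prop :=
  IsEID f h 𝒳 (quadSupply X)

/-- The map `(x, u) ↦ M x + N u`, used for both the dynamics and the output of an LTI system. -/
def ltiMap {n q k : ℕ} (M : Matrix (Fin k) (Fin n) ℝ) (N : Matrix (Fin k) (Fin q) ℝ)
    (x : Fin n → ℝ) (u : Fin q → ℝ) : Fin k → ℝ :=
  M *ᵥ x + N *ᵥ u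

/-- `ℋ(M) = M + Mᵀ`. -/
def symPart {k : ℕ} (M : Matrix (Fin k) (Fin k) ℝ) : Matrix (Fin k) (Fin k) ℝ :=
  M + Mᵀ

/-- The off-diagonal block `-P B + Cᵀ X²¹ + Cᵀ X²² D` of the LMI. -/
def lmiOffDiag {n q m : ℕ} (B : Matrix (Fin n) (Fin q) ℝ)
    (C : Matrix (Fin m) (Fin n) ℝ) (D : Matrix (Fin m) (Fin q) ℝ)
    (X : Matrix (Fin q ⊕ Fin m) (Fin q ⊕ Fin m) ℝ) (P : Matrix (Fin n) (Fin n) ℝ) :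
    Matrix (Fin n) (Fin q) ℝ :=
  -(P * B) + Cᵀ * X.toBlocks₂₁ + Cᵀ * X.toBlocks₂₂ * D

/-- The block matrix of the LMI. -/
def lmiMatrix {n q m : ℕ} (A : Matrix (Fin n) (Fin n) ℝ) (B : Matrix (Fin n) (Fin q) ℝ)
    (C : Matrix (Fin m) (Fin n) ℝ) (D : Matrix (Fin m) (Fin q) ℝ)
    (X : Matrix (Fin q ⊕ Fin m) (Fin q ⊕ Fin m) ℝ) (P : Matrix (Fin n) (Fin n) ℝ) :
    Matrix (Fin n ⊕ Fin q) (Fin n ⊕ Fin q) ℝ :=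
  fromBlocks
    (-symPart (P * A) + Cᵀ * X.toBlocks₂₂ * C) (lmiOffDiag B C D X P)
    (lmiOffDiag B C D X P)ᵀ (X.toBlocks₁₁ + symPart (X.toBlocks₁₂ * D) + Dᵀ * X.toBlocks₂₂ * D)

/-! Sufficiency is the classical computation: the LMI says exactly that the quadratic function `(x -
x*)ᵀ P (x - x*)` satisfies the dissipation inequality (`lmiMatrix_posSemidef_iff`, `isXEID_of_lmi`).

Necessity needs only one equilibrium, moved to the origin. The storage `V` is merely continuously
differentiable, so it has no Hessian to serve as `P`, and no controllability is assumed, so the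
usual frequency-domain lemma does not apply either. Replacing `V` by `V (Re x) + V (Im x)` gives a
complex system `ẋ = M (x, u)` with a Hermitian supply rate `S`. A positive definite `P` is wanted
for which `dissipation M S P`, that is `S` minus the derivative of `P`, is positive semidefinite.

Cheap inputs, those `v ≠ 0` with `S (v, v) = 0`, are removed first. The dissipation inequality is
affine in their amplitude, so `V` is exactly quadratic along `M (0, v)` (`IsStorage.add_cheap`);
that coordinate, or the input itself if it has no effect, is split off by induction on the
dimension. Afterwards `S` is positive on inputs (`RegularSupply`).

Two facts are then extracted from `V`. By Rolle on the circle `θ ↦ V (e^{iθ} x)`, the supply of an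
approximate oscillation `M f ≈ iω f.1` is almost nonnegative (`IsStorage.frequencyBound`). Moreover,
for every quadratic storage `P`, `V` is bounded by `P` plus a correction `K` on the states reached
from the origin in infinite time, by an antistable flow together with a slow drift along lossless
oscillations; hence that sum is positive there (`IsStorage.storagePositive`).

The first fact yields a quadratic storage without sign (`exists_storage_of_frequencyBound`), and the
second improves it to a positive definite one (`exists_posDef_storage`). Both proceed by the same
induction on the state dimension.

If every nonzero oscillation has positive supply, a separation argument leaves either a strict
storage or a finite family of trajectories with nonpositive total supply and nondecreasing second
moment. The family is impossible (`tr_supply_pos`): once pure inputs and oscillations are stripped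
off, it is driven by an antistable generator. For constant second moment that generator would also
be skew, which is absurd; otherwise the Lyapunov equation makes the total supply positive.

If some nonzero oscillation is lossless, a rotating frame turns it into an equilibrium. Either some
equilibrium state lies outside the range of `M`, and a conserved functional splits off a direction
(`exists_extension_of_split`); or all equilibrium states lie in the range. In that case the identity
`P e.1 (M f) = S e f` at lossless equilibria `e` forces every storage on their states, the system is
compressed to the orthogonal complement, and storages of the compressed system extend back
(`LosslessSplitting.exists_extension`). -/

set_option linter.unusedSectionVars false

/-! ### Hermitian forms and sesquilinear pairings. -/

/-- A Hermitian form, conjugate linear in the first argument. -/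
structure HermForm (V : Type*) [AddCommGroup V] [Module ℂ V] where
  toFun : V → V → ℂ
  add_right' : ∀ x y z, toFun x (y + z) = toFun x y + toFun x z
  smul_right' : ∀ x (c : ℂ) y, toFun x (c • y) = c * toFun x y
  conj_symm' : ∀ x y, star (toFun y x) = toFun x y

/-- A sesquilinear pairing, conjugate linear in the first argument. -/
structure SesqForm (W V : Type*) [AddCommGroup W] [Module ℂ W] [AddCommGroup V] [Module ℂ V] where
  toFun : W → V → ℂ
  add_right' : ∀ x y z, toFun x (y + z) = toFun x y + toFun x z
  smul_right' : ∀ x (c : ℂ) y, toFun x (c • y) = c * toFun x y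
  add_left' : ∀ x y z, toFun (x + y) z = toFun x z + toFun y z
  smul_left' : ∀ (c : ℂ) x y, toFun (c • x) y = star c * toFun x y

namespace HermForm

section Algebra

variable {V W : Type*} [AddCommGroup V] [Module ℂ V] [AddCommGroup W] [Module ℂ W]

instance : CoeFun (HermForm V) fun _ => V → V → ℂ := ⟨toFun⟩

lemma add_right (Q : HermForm V) (x y z : V) : Q x (y + z) = Q x y + Q x z := Q.add_right' x y z

lemma smul_right (Q : HermForm V) (x : V) (c : ℂ) (y : V) : Q x (c • y) = c * Q x y :=
  Q.smul_right' x c y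

lemma conj_symm (Q : HermForm V) (x y : V) : star (Q y x) = Q x y := Q.conj_symm' x y

lemma add_left (Q : HermForm V) (x y z : V) : Q (x + y) z = Q x z + Q y z := by
  rw [← Q.conj_symm, Q.add_right, star_add, Q.conj_symm, Q.conj_symm]

lemma smul_left (Q : HermForm V) (c : ℂ) (x y : V) : Q (c • x) y = star c * Q x y := by
  rw [← Q.conj_symm, Q.smul_right, star_mul', Q.conj_symm]

@[simp] lemma zero_right (Q : HermForm V) (x : V) : Q x 0 = 0 := by
  have := Q.smul_right x 0 0
  simpa using this

@[simp] lemma zero_left (Q : HermForm V) (x : V) : Q 0 x = 0 := by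
  rw [← Q.conj_symm]; simp

lemma neg_right (Q : HermForm V) (x y : V) : Q x (-y) = -Q x y := by
  rw [← neg_one_smul ℂ, Q.smul_right]; ring

lemma neg_left (Q : HermForm V) (x y : V) : Q (-x) y = -Q x y := by
  rw [← Q.conj_symm, Q.neg_right, star_neg, Q.conj_symm]

lemma sub_right (Q : HermForm V) (x y z : V) : Q x (y - z) = Q x y - Q x z := by
  rw [sub_eq_add_neg, Q.add_right, Q.neg_right]; ring

lemma sub_left (Q : HermForm V) (x y z : V) : Q (x - y) z = Q x z - Q y z := by
  rw [sub_eq_add_neg, Q.add_left, Q.neg_left]; ring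

lemma re_symm (Q : HermForm V) (x y : V) : (Q y x).re = (Q x y).re := by
  rw [← Q.conj_symm x y]; simp

@[simp] lemma im_self (Q : HermForm V) (x : V) : (Q x x).im = 0 := by
  have := congrArg Complex.im (Q.conj_symm x x)
  simp at this
  linarith

lemma self_eq (Q : HermForm V) (x : V) : Q x x = ((Q x x).re : ℂ) := by
  apply Complex.ext <;> simp

lemma quad_add (Q : HermForm V) (x y : V) :
    (Q (x + y) (x + y)).re = (Q x x).re + 2 * (Q x y).re + (Q y y).re := by
  rw [Q.add_left, Q.add_right, Q.add_right]
  simp only [Complex.add_re]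
  rw [Q.re_symm x y]; ring

lemma quad_smul (Q : HermForm V) (c : ℂ) (x : V) :
    (Q (c • x) (c • x)).re = ‖c‖ ^ 2 * (Q x x).re := by
  rw [Q.smul_left, Q.smul_right, Q.self_eq x, ← Complex.normSq_eq_norm_sq, Complex.normSq_apply]
  simp; ring

/-- Pull-back along a linear map. -/
def comp (Q : HermForm V) (T : W →ₗ[ℂ] V) : HermForm W where
  toFun x y := Q (T x) (T y)
  add_right' x y z := by rw [map_add, Q.add_right]
  smul_right' x c y := by rw [map_smul, Q.smul_right]
  conj_symm' x y := Q.conj_symm _ _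

@[simp] lemma comp_apply (Q : HermForm V) (T : W →ₗ[ℂ] V) (x y : W) :
    Q.comp T x y = Q (T x) (T y) := rfl

instance : Add (HermForm V) where
  add P Q :=
    { toFun := fun x y => P x y + Q x y
      add_right' := fun x y z => by rw [P.add_right, Q.add_right]; ring
      smul_right' := fun x c y => by rw [P.smul_right, Q.smul_right]; ring
      conj_symm' := fun x y => by rw [star_add, P.conj_symm, Q.conj_symm] }

@[simp] lemma add_apply (P Q : HermForm V) (x y : V) : (P + Q) x y = P x y + Q x y := rfl

instance : SMul ℝ (HermForm V) where
  smul r Q :=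
    { toFun := fun x y => (r : ℂ) * Q x y
      add_right' := fun x y z => by rw [Q.add_right]; ring
      smul_right' := fun x c y => by rw [Q.smul_right]; ring
      conj_symm' := fun x y => by
        rw [star_mul', Q.conj_symm]; simp }

@[simp] lemma smul_apply (r : ℝ) (Q : HermForm V) (x y : V) : (r • Q) x y = (r : ℂ) * Q x y := rfl

/-- A Hermitian form as a sesquilinear pairing, composed with linear maps on both sides. -/
def toSesq {V₁ V₂ : Type*} [AddCommGroup V₁] [Module ℂ V₁] [AddCommGroup V₂] [Module ℂ V₂]
    (Q : HermForm V) (S : V₁ →ₗ[ℂ] V) (T : V₂ →ₗ[ℂ] V) : SesqForm V₁ V₂ where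
  toFun x y := Q (S x) (T y)
  add_right' x y z := by rw [map_add, Q.add_right]
  smul_right' x c y := by rw [map_smul, Q.smul_right]
  add_left' x y z := by rw [map_add, Q.add_left]
  smul_left' x c y := by rw [map_smul, Q.smul_left]

/-- Positive semidefiniteness. -/
def PosSemidef (Q : HermForm V) : Prop := ∀ x, 0 ≤ (Q x x).re

/-- Positive definiteness. -/
def PosDef (Q : HermForm V) : Prop := ∀ x, x ≠ 0 → 0 < (Q x x).re

lemma PosDef.posSemidef {Q : HermForm V} (h : Q.PosDef) : Q.PosSemidef := fun x => by
  by_cases hx : x = 0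
  · simp [hx]
  · exact (h x hx).le

/-- A null vector of a semidefinite form is orthogonal to everything. -/
lemma apply_eq_zero_of_quad {Q : HermForm V} {p : V → Prop} (hadd : ∀ x y, p x → p y → p (x + y))
    (hsmul : ∀ (c : ℂ) x, p x → p (c • x)) (h : ∀ x, p x → 0 ≤ (Q x x).re) {x : V} (hx : p x)
    (h0 : (Q x x).re = 0) {y : V} (hy : p y) : Q x y = 0 := by
  have key : ∀ z, p z → (Q x z).re = 0 := fun z hz => by
    have h1 : ∀ t : ℝ, 0 ≤ 2 * t * (Q x z).re + (Q z z).re := fun t => by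
      have := h _ (hadd _ _ (hsmul (t : ℂ) _ hx) hz)
      rw [Q.quad_add, Q.quad_smul, h0, Q.smul_left] at this
      simp at this
      linarith
    by_contra hne
    have := h1 (-((Q z z).re + 1) / (2 * (Q x z).re))
    -- The chosen `t` turns the affine lower bound into `-1`.
    field_simp at this
    linarith
  apply Complex.ext (key y hy)
  have := key _ (hsmul Complex.I _ hy)
  rw [Q.smul_right] at this
  simpa using this

lemma PosSemidef.apply_eq_zero {Q : HermForm V} (h : Q.PosSemidef) {x : V}
    (h0 : (Q x x).re = 0) (y : V) : Q x y = 0 :=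
  apply_eq_zero_of_quad (p := fun _ => True) (fun _ _ _ _ => trivial) (fun _ _ _ => trivial)
    (fun x _ => h x) trivial h0 trivial

/-- The null space of a positive semidefinite form. -/
def PosSemidef.null {Q : HermForm V} (h : Q.PosSemidef) : Submodule ℂ V where
  carrier := {x | (Q x x).re = 0}
  zero_mem' := by simp
  add_mem' {x y} hx hy := by
    simp only [Set.mem_ofPred_eq] at *
    rw [Q.quad_add, hx, hy, h.apply_eq_zero hx]; simp
  smul_mem' c x hx := by
    simp only [Set.mem_ofPred_eq] at *
    rw [Q.quad_smul, hx, mul_zero]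

lemma PosSemidef.mem_null {Q : HermForm V} (h : Q.PosSemidef) {x : V} :
    x ∈ h.null ↔ (Q x x).re = 0 := Iff.rfl

end Algebra

end HermForm

namespace SesqForm

variable {V W : Type*} [AddCommGroup V] [Module ℂ V] [AddCommGroup W] [Module ℂ W]

instance : CoeFun (SesqForm W V) fun _ => W → V → ℂ := ⟨toFun⟩

lemma add_right (b : SesqForm W V) (x : W) (y z : V) : b x (y + z) = b x y + b x z :=
  b.add_right' x y z

lemma smul_right (b : SesqForm W V) (x : W) (c : ℂ) (y : V) : b x (c • y) = c * b x y :=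
  b.smul_right' x c y

lemma add_left (b : SesqForm W V) (x y : W) (z : V) : b (x + y) z = b x z + b y z :=
  b.add_left' x y z

lemma smul_left (b : SesqForm W V) (c : ℂ) (x : W) (y : V) : b (c • x) y = star c * b x y :=
  b.smul_left' c x y

/-- The functional in the second argument. -/
def toDual (b : SesqForm W V) (w : W) : Module.Dual ℂ V where
  toFun := b w
  map_add' := b.add_right w
  map_smul' c x := b.smul_right w c x

@[simp] lemma toDual_apply (b : SesqForm W V) (w : W) (v : V) : b.toDual w v = b w v := rfl

lemma zero_right (b : SesqForm W V) (w : W) : b w 0 = 0 := (b.toDual w).map_zero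

lemma sub_right (b : SesqForm W V) (w : W) (x y : V) : b w (x - y) = b w x - b w y :=
  (b.toDual w).map_sub x y

/-- Composition with linear maps on both sides. -/
def comp {V₁ W₁ : Type*} [AddCommGroup V₁] [Module ℂ V₁] [AddCommGroup W₁] [Module ℂ W₁]
    (b : SesqForm W V) (S : W₁ →ₗ[ℂ] W) (T : V₁ →ₗ[ℂ] V) : SesqForm W₁ V₁ where
  toFun x y := b (S x) (T y)
  add_right' x y z := by rw [map_add, b.add_right]
  smul_right' x c y := by rw [map_smul, b.smul_right]
  add_left' x y z := by rw [map_add, b.add_left]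
  smul_left' x c y := by rw [map_smul, b.smul_left]

@[simp] lemma comp_apply {V₁ W₁ : Type*} [AddCommGroup V₁] [Module ℂ V₁] [AddCommGroup W₁]
    [Module ℂ W₁] (b : SesqForm W V) (S : W₁ →ₗ[ℂ] W) (T : V₁ →ₗ[ℂ] V) (x : W₁) (y : V₁) :
    b.comp S T x y = b (S x) (T y) := rfl

instance : Sub (SesqForm W V) where
  sub a b :=
    { toFun := fun x y => a x y - b x y
      add_right' := fun x y z => by rw [a.add_right, b.add_right]; ring
      smul_right' := fun x c y => by rw [a.smul_right, b.smul_right]; ring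
      add_left' := fun x y z => by rw [a.add_left, b.add_left]; ring
      smul_left' := fun c x y => by rw [a.smul_left, b.smul_left]; ring }

@[simp] lemma sub_apply (a b : SesqForm W V) (x : W) (y : V) : (a - b) x y = a x y - b x y := rfl

instance : SMul ℝ (SesqForm W V) where
  smul r a :=
    { toFun := fun x y => (r : ℂ) * a x y
      add_right' := fun x y z => by rw [a.add_right]; ring
      smul_right' := fun x c y => by rw [a.smul_right]; ring
      add_left' := fun x y z => by rw [a.add_left]; ring
      smul_left' := fun c x y => by rw [a.smul_left]; ring }

@[simp] lemma smul_apply (r : ℝ) (a : SesqForm W V) (x : W) (y : V) :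
    (r • a) x y = (r : ℂ) * a x y := rfl

/-- The Hermitian form `b x y + conj (b y x)`. -/
def herm (b : SesqForm V V) : HermForm V where
  toFun x y := b x y + star (b y x)
  add_right' x y z := by rw [b.add_right, b.add_left, star_add]; ring
  smul_right' x c y := by rw [b.smul_right, b.smul_left, star_mul', star_star]; ring
  conj_symm' x y := by rw [star_add, star_star]; ring

@[simp] lemma herm_apply (b : SesqForm V V) (x y : V) : b.herm x y = b x y + star (b y x) := rfl

end SesqForm

@[simp] lemma HermForm.toSesq_apply {V V₁ V₂ : Type*} [AddCommGroup V] [Module ℂ V]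
    [AddCommGroup V₁] [Module ℂ V₁] [AddCommGroup V₂] [Module ℂ V₂]
    (Q : HermForm V) (S : V₁ →ₗ[ℂ] V) (T : V₂ →ₗ[ℂ] V) (x : V₁) (y : V₂) :
    Q.toSesq S T x y = Q (S x) (T y) := rfl

namespace HermForm

variable {V : Type*} [NormedAddCommGroup V] [InnerProductSpace ℂ V]

/-- The inner product as a Hermitian form. -/
noncomputable def ofInner (V : Type*) [NormedAddCommGroup V] [InnerProductSpace ℂ V] : HermForm V where
  toFun x y := inner ℂ x y
  add_right' := inner_add_right
  smul_right' x c y := inner_smul_right x y c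
  conj_symm' x y := inner_conj_symm x y

@[simp] lemma ofInner_apply (x y : V) : ofInner V x y = inner ℂ x y := rfl

lemma ofInner_quad (x : V) : (ofInner V x x).re = ‖x‖ ^ 2 := by
  rw [ofInner_apply, inner_self_eq_norm_sq_to_K]
  norm_cast

end HermForm

/-! ### Bounds and Riesz representation in finite dimension. -/

namespace HermForm

variable {V W : Type*} [NormedAddCommGroup V] [NormedSpace ℂ V] [FiniteDimensional ℂ V]
  [NormedAddCommGroup W] [NormedSpace ℂ W] [FiniteDimensional ℂ W]

/-- Conjugate linearity in the first slot makes currying linear only over `ℝ`, so the operator norm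
is taken there. -/
lemma exists_bound (Q : HermForm V) : ∃ C : ℝ, 0 ≤ C ∧ ∀ x y, ‖Q x y‖ ≤ C * ‖x‖ * ‖y‖ := by
  let T : V →ₗ[ℝ] (V →L[ℂ] ℂ) :=
    { toFun := fun x => LinearMap.toContinuousLinearMap
        { toFun := Q x, map_add' := Q.add_right x, map_smul' := fun c y => Q.smul_right x c y }
      map_add' := fun x y => by ext z; simp [Q.add_left]
      map_smul' := fun r x => by
        ext z
        simp only [LinearMap.coe_toContinuousLinearMap', LinearMap.coe_mk, AddHom.coe_mk,
          RingHom.id_apply, _root_.smul_apply]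
        have := Q.smul_left (r : ℂ) x z
        simpa using this }
  have : FiniteDimensional ℝ V := FiniteDimensional.complexToReal V
  let T' := LinearMap.toContinuousLinearMap T
  refine ⟨‖T'‖, T'.opNorm_nonneg, fun x y => ?_⟩
  calc ‖Q x y‖ = ‖T' x y‖ := rfl
    _ ≤ ‖T' x‖ * ‖y‖ := (T' x).le_opNorm y
    _ ≤ ‖T'‖ * ‖x‖ * ‖y‖ := by gcongr; exact T'.le_opNorm x

lemma continuous_quad (Q : HermForm V) : Continuous fun x => (Q x x).re := by
  obtain ⟨C, hC, h⟩ := Q.exists_bound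
  rw [continuous_iff_continuousAt]
  intro x
  rw [ContinuousAt, tendsto_iff_norm_sub_tendsto_zero]
  have h2 : Filter.Tendsto (fun y => 2 * (C * ‖x‖ * ‖y - x‖) + C * ‖y - x‖ * ‖y - x‖)
      (nhds x) (nhds 0) := by
    have : Continuous fun y => 2 * (C * ‖x‖ * ‖y - x‖) + C * ‖y - x‖ * ‖y - x‖ := by fun_prop
    have := this.tendsto x
    simpa using this
  refine squeeze_zero (fun _ => norm_nonneg _) (fun y => ?_) h2
  have e : y = x + (y - x) := by abel
  have : (Q y y).re - (Q x x).re = 2 * (Q x (y - x)).re + (Q (y - x) (y - x)).re := by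
    conv_lhs => rw [e, Q.quad_add]
    ring
  rw [this]
  refine (norm_add_le _ _).trans (add_le_add ?_ ?_)
  · rw [norm_mul]
    have := (Complex.abs_re_le_norm (Q x (y - x))).trans (h x (y - x))
    simp only [Real.norm_ofNat, Real.norm_eq_abs]
    linarith
  · exact (Complex.abs_re_le_norm _).trans (h _ _)

lemma PosDef.exists_lower_bound {Q : HermForm V} (hQ : Q.PosDef) :
    ∃ c : ℝ, 0 < c ∧ ∀ x, c * ‖x‖ ^ 2 ≤ (Q x x).re := by
  have : ProperSpace V := FiniteDimensional.proper ℂ V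
  by_cases hne : (Metric.sphere (0 : V) 1).Nonempty
  · obtain ⟨x₀, hx₀, hmin⟩ := (isCompact_sphere (0 : V) 1).exists_isMinOn hne
      Q.continuous_quad.continuousOn
    have hx₀' : x₀ ≠ 0 := by
      rintro rfl
      simp at hx₀
    refine ⟨_, hQ x₀ hx₀', fun x => ?_⟩
    by_cases hx : x = 0
    · simp [hx]
    have hn : ‖x‖ ≠ 0 := norm_ne_zero_iff.2 hx
    have h1 := hmin (a := ((‖x‖⁻¹ : ℝ) : ℂ) • x) (by
      simp [norm_smul, hn])
    simp only [Set.mem_ofPred_eq] at h1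
    rw [Q.quad_smul] at h1
    simp only [Complex.norm_real, norm_inv, norm_norm] at h1
    calc (Q x₀ x₀).re * ‖x‖ ^ 2 ≤ ((‖x‖⁻¹) ^ 2 * (Q x x).re) * ‖x‖ ^ 2 := by gcongr
      _ = (Q x x).re := by field_simp
  · refine ⟨1, one_pos, fun x => ?_⟩
    have : x = 0 := by
      by_contra hx
      apply hne
      exact ⟨((‖x‖⁻¹ : ℝ) : ℂ) • x, by simp [norm_smul, norm_ne_zero_iff.2 hx]⟩
    simp [this]

/-- Riesz representation for a positive definite form. -/
lemma PosDef.exists_rep {Q : HermForm V} (hQ : Q.PosDef) (φ : Module.Dual ℂ V) :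
    ∃ v, ∀ x, Q v x = φ x := by
  let T : V →ₗ[ℝ] Module.Dual ℂ V :=
    { toFun := fun x =>
        { toFun := Q x, map_add' := Q.add_right x, map_smul' := fun c y => Q.smul_right x c y }
      map_add' := fun x y => by ext z; simp [Q.add_left]
      map_smul' := fun r x => by
        ext z
        have := Q.smul_left (r : ℂ) x z
        simpa using this }
  have : FiniteDimensional ℝ V := FiniteDimensional.complexToReal V
  have : FiniteDimensional ℝ (Module.Dual ℂ V) := FiniteDimensional.complexToReal _
  have hinj : Function.Injective T := by
    rw [← LinearMap.ker_eq_bot, LinearMap.ker_eq_bot']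
    intro x hx
    by_contra hne
    have h1 := hQ x hne
    have h2 : Q x x = 0 := by
      have := LinearMap.congr_fun hx x
      simpa [T] using this
    rw [h2] at h1
    simp at h1
  -- The currying map is only real linear, so dimensions are compared over `ℝ`.
  have hsurj := (LinearMap.injective_iff_surjective_of_finrank_eq_finrank (f := T) (by
    rw [← Module.finrank_mul_finrank ℝ ℂ V, ← Module.finrank_mul_finrank ℝ ℂ (Module.Dual ℂ V),
      Subspace.dual_finrank_eq])).1 hinj
  obtain ⟨v, hv⟩ := hsurj φ
  exact ⟨v, fun x => by rw [← hv]; rfl⟩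

/-- Sesquilinear Riesz representation for a positive definite form. -/
lemma PosDef.exists_linear_rep {W : Type*} [AddCommGroup W] [Module ℂ W] {Q : HermForm V}
    (hQ : Q.PosDef) (b : SesqForm W V) : ∃ T : W →ₗ[ℂ] V, ∀ w x, Q (T w) x = b w x := by
  choose R hR using fun w => hQ.exists_rep (b.toDual w)
  have huniq : ∀ v v', (∀ x, Q v x = Q v' x) → v = v' := fun v v' h => by
    by_contra hne
    have := hQ (v - v') (sub_ne_zero.2 hne)
    rw [Q.sub_left, h, sub_self] at this
    simp at this
  refine ⟨⟨⟨R, fun w w' => huniq _ _ fun x => ?_⟩, fun c w => huniq _ _ fun x => ?_⟩, ?_⟩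
  · rw [Q.add_left, hR, hR, hR]; simp [b.add_left]
  · simp only [RingHom.id_apply]
    rw [Q.smul_left, hR, hR]; simp [b.smul_left]
  · exact fun w x => hR w x

end HermForm

namespace HermForm

variable {V W : Type*} [NormedAddCommGroup V] [NormedSpace ℂ V] [FiniteDimensional ℂ V]
  [NormedAddCommGroup W] [InnerProductSpace ℂ W] [FiniteDimensional ℂ W]

/-- There is a positive definite form on every finite-dimensional space. -/
lemma exists_posDef (V : Type*) [NormedAddCommGroup V] [NormedSpace ℂ V] [FiniteDimensional ℂ V] :
    ∃ Q : HermForm V, Q.PosDef := by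
  let e := (Module.finBasis ℂ V).equivFun.trans (WithLp.linearEquiv 2 ℂ (Fin _ → ℂ)).symm
  refine ⟨(ofInner (EuclideanSpace ℂ (Fin _))).comp e.toLinearMap, fun x hx => ?_⟩
  rw [comp_apply, ofInner_quad]
  have : e x ≠ 0 := by simpa using hx
  have : 0 < ‖e x‖ := norm_pos_iff.2 this
  positivity

/-- Representation of a pairing that vanishes on the null space of a semidefinite form. -/
lemma PosSemidef.exists_linear_rep {W : Type*} [AddCommGroup W] [Module ℂ W] {Q : HermForm V}
    (hQ : Q.PosSemidef) (b : SesqForm W V) (hb : ∀ w x, (Q x x).re = 0 → b w x = 0) :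
    ∃ T : W →ₗ[ℂ] V, ∀ w x, Q (T w) x = b w x := by
  obtain ⟨N, hN⟩ := exists_posDef V
  obtain ⟨K', hK'⟩ := hQ.null.exists_isCompl
  let p : V →ₗ[ℂ] V := hQ.null.subtype ∘ₗ hQ.null.projectionOnto K' hK'
  have hp : ∀ x, (Q (p x) (p x)).re = 0 := fun x => (hQ.null.projectionOnto K' hK' x).2
  have hpK : ∀ x, (Q x x).re = 0 → p x = x := fun x hx => by
    have := Submodule.projectionOnto_apply_left hK' ⟨x, hx⟩
    simp only [p, LinearMap.comp_apply]
    exact congrArg Subtype.val this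
  -- Adding `N` on the null space makes the form definite. As `b` vanishes on the null space, the
  -- representing vectors have no component there, and `Q` alone represents `b`.
  have hQ' : (Q + N.comp p).PosDef := fun x hx => by
    simp only [add_apply, comp_apply, Complex.add_re]
    by_cases h0 : (Q x x).re = 0
    · have := hN (p x) (by rwa [hpK x h0])
      linarith
    · have h1 := lt_of_le_of_ne (hQ x) (Ne.symm h0)
      have := hN.posSemidef (p x)
      linarith
  obtain ⟨T, hT⟩ := hQ'.exists_linear_rep b
  refine ⟨T, fun w x => ?_⟩
  have h1 : p (T w) = 0 := by
    by_contra hne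
    have h2 := hN _ hne
    have h3 := hT w (p (T w))
    rw [hb _ _ (hp _), add_apply, comp_apply, hpK (p (T w)) (hp _),
      ← Q.conj_symm, hQ.apply_eq_zero (hp _)] at h3
    simp at h3
    rw [h3] at h2
    simp at h2
  have := hT w x
  rwa [add_apply, comp_apply, h1, zero_left, add_zero] at this

/-- A block form is nonnegative once the second diagonal block is large. -/
lemma PosSemidef.exists_block_nonneg {Q : HermForm V}
    (hQ : Q.PosSemidef) (b : SesqForm W V) (hb : ∀ w x, (Q x x).re = 0 → b w x = 0) :
    ∃ k : ℝ, 0 ≤ k ∧ ∀ w x, 0 ≤ (Q x x).re + 2 * (b w x).re + k * ‖w‖ ^ 2 := by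
  obtain ⟨T, hT⟩ := hQ.exists_linear_rep b hb
  obtain ⟨C, hC, hbound⟩ := (Q.comp T).exists_bound
  refine ⟨C, hC, fun w x => ?_⟩
  -- Completing the square: `Q` is nonnegative at `T w + x`, and its value at `T w` is at most `C
  -- ‖w‖ ^ 2`.
  have h1 := hQ (T w + x)
  rw [Q.quad_add, hT w x] at h1
  have h2 := (Complex.re_le_norm _).trans (hbound w w)
  rw [comp_apply] at h2
  rw [sq, ← mul_assoc]
  linarith

end HermForm

/-! ### Dissipation forms, and splitting off a conserved direction. -/

section System

variable {X U : Type*} [NormedAddCommGroup X] [InnerProductSpace ℂ X]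
  [NormedAddCommGroup U] [InnerProductSpace ℂ U]

/-- The dissipation surplus of the quadratic storage `P` along `ẋ = M (x, u)` under the
supply rate `S`. -/
def dissipation (M : X × U →ₗ[ℂ] X) (S : HermForm (X × U)) (P : HermForm X) :
    HermForm (X × U) where
  toFun f g := S f g - (P f.1 (M g) + P (M f) g.1)
  add_right' x y z := by
    simp only [map_add, Prod.fst_add, S.add_right, P.add_right]; ring
  smul_right' x c y := by
    simp only [map_smul, Prod.smul_fst, S.smul_right, P.smul_right]; ring
  conj_symm' x y := by
    rw [star_sub, star_add, S.conj_symm, P.conj_symm, P.conj_symm]; ring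

lemma dissipation_apply (M : X × U →ₗ[ℂ] X) (S : HermForm (X × U)) (P : HermForm X)
    (f g : X × U) : dissipation M S P f g = S f g - (P f.1 (M g) + P (M f) g.1) := rfl

lemma dissipation_quad (M : X × U →ₗ[ℂ] X) (S : HermForm (X × U)) (P : HermForm X)
    (f : X × U) : (dissipation M S P f f).re = (S f f).re - 2 * (P f.1 (M f)).re := by
  rw [dissipation_apply, Complex.sub_re, Complex.add_re, P.re_symm f.1 (M f)]; ring

/-- The embedding of the trajectories of a subsystem with states in `Y`. -/
def inclTraj (U : Type*) [NormedAddCommGroup U] [InnerProductSpace ℂ U] (Y : Submodule ℂ X) :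
    Y × U →ₗ[ℂ] X × U := Y.subtype.prodMap LinearMap.id

@[simp] lemma inclTraj_apply (Y : Submodule ℂ X) (f : Y × U) :
    inclTraj U Y f = ((f.1 : X), f.2) := rfl

/-- The system compressed to `Y` along `p`. -/
def compress (M : X × U →ₗ[ℂ] X) (Y : Submodule ℂ X) (p : X →ₗ[ℂ] Y) : Y × U →ₗ[ℂ] Y :=
  p ∘ₗ M ∘ₗ inclTraj U Y

@[simp] lemma compress_apply (M : X × U →ₗ[ℂ] X) (Y : Submodule ℂ X) (p : X →ₗ[ℂ] Y) (f : Y × U) :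
    compress M Y p f = p (M ((f.1 : X), f.2)) := rfl

/-- A linear map has a linear right inverse on its range. -/
lemma exists_pseudoInverse {V W : Type*} [AddCommGroup V] [Module ℂ V] [AddCommGroup W]
    [Module ℂ W] (M : V →ₗ[ℂ] W) : ∃ J : W →ₗ[ℂ] V, ∀ f, M (J (M f)) = M f := by
  obtain ⟨J₀, hJ₀⟩ := M.rangeRestrict.exists_rightInverse_of_surjective M.range_rangeRestrict
  obtain ⟨J, hJ⟩ := LinearMap.exists_extend J₀
  refine ⟨J, fun f => ?_⟩
  have h1 : J (M f) = J₀ (M.rangeRestrict f) := LinearMap.congr_fun hJ (M.rangeRestrict f)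
  have h2 := congrArg Subtype.val (LinearMap.congr_fun hJ₀ (M.rangeRestrict f))
  rw [h1]
  simpa using h2

/-- The pairing `conj (η x) * p y`. -/
def SesqForm.ofDual {V W : Type*} [AddCommGroup V] [Module ℂ V] [AddCommGroup W] [Module ℂ W]
    (η : W →ₗ[ℂ] ℂ) (p : V →ₗ[ℂ] ℂ) : SesqForm W V where
  toFun x y := star (η x) * p y
  add_right' x y z := by rw [map_add]; ring
  smul_right' x c y := by rw [map_smul, smul_eq_mul]; ring
  add_left' x y z := by rw [map_add, star_add]; ring
  smul_left' c x y := by rw [map_smul, smul_eq_mul, star_mul']; ring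

lemma SesqForm.ofDual_apply {V W : Type*} [AddCommGroup V] [Module ℂ V] [AddCommGroup W]
    [Module ℂ W] (η : W →ₗ[ℂ] ℂ) (p : V →ₗ[ℂ] ℂ) (x : W) (y : V) :
    SesqForm.ofDual η p x y = star (η x) * p y := rfl

/-- A Hermitian form applied to a fixed first argument. -/
def HermForm.toDual {V : Type*} [AddCommGroup V] [Module ℂ V] (Q : HermForm V) (x : V) :
    V →ₗ[ℂ] ℂ where
  toFun := Q x
  map_add' := Q.add_right x
  map_smul' c y := Q.smul_right x c y

lemma HermForm.toDual_apply {V : Type*} [AddCommGroup V] [Module ℂ V] (Q : HermForm V) (x y : V) :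
    Q.toDual x y = Q x y := rfl

variable [FiniteDimensional ℂ X] [FiniteDimensional ℂ U]

/-- An equilibrium whose state is not annihilated by an invariant functional `η` can be split
off. -/
lemma exists_normalized_equilibrium (M : X × U →ₗ[ℂ] X) (S : HermForm (X × U)) (η : X →ₗ[ℂ] ℂ)
    {e : X × U} (he : M e = 0) (hηe : η e.1 = 1) (hS : ∀ g, M g = 0 → 0 ≤ (S g g).re) :
    ∃ e', M e' = 0 ∧ η e'.1 = 1 ∧ ∀ g, M g = 0 → η g.1 = 0 → S e' g = 0 := by
  let E' : Submodule ℂ (X × U) := LinearMap.ker M ⊓ LinearMap.ker (η ∘ₗ LinearMap.fst ℂ X U)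
  have hE' : ∀ g : E', M g = 0 ∧ η (g : X × U).1 = 0 := fun g => ⟨g.2.1, g.2.2⟩
  have hpsd : (S.comp E'.subtype).PosSemidef := fun g => hS _ (hE' g).1
  -- `T 1` plays the role of the `S`-orthogonal projection of `e` to `E'`. It exists although `S`
  -- may degenerate on `E'`, because null vectors of `S` among the equilibria are orthogonal to the
  -- equilibrium `e`.
  obtain ⟨T, hT⟩ := hpsd.exists_linear_rep
    (SesqForm.ofDual (LinearMap.id (R := ℂ) (M := ℂ)) (S.toDual e ∘ₗ E'.subtype)) (by
      intro w g hg
      have := HermForm.apply_eq_zero_of_quad (Q := S) (p := fun f => M f = 0)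
        (fun x y hx hy => by rw [map_add, hx, hy, add_zero])
        (fun c x hx => by rw [map_smul, hx, smul_zero]) hS (hE' g).1 hg he
      rw [SesqForm.ofDual_apply, LinearMap.comp_apply, HermForm.toDual_apply, ← S.conj_symm]
      simp [this])
  refine ⟨e - T 1, ?_, ?_, fun g hg hg' => ?_⟩
  · rw [map_sub, he, (hE' _).1, sub_zero]
  · rw [Prod.fst_sub, map_sub, hηe, (hE' _).2, sub_zero]
  · have := hT 1 ⟨g, hg, hg'⟩
    rw [SesqForm.ofDual_apply] at this
    simp only [HermForm.comp_apply, LinearMap.id_apply, star_one, one_mul, LinearMap.comp_apply,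
      HermForm.toDual_apply, Submodule.subtype_apply] at this
    rw [S.sub_left, ← this, sub_self]

/-- Since `η ∘ M = 0`, the number `l = η f.1` is conserved, and `f = l • e + g` with `g` a
trajectory of the compressed system. The cross term `S e g` vanishes on equilibria, hence equals `φ
(M g)` for a functional `φ`; the storage term `2 Re (conj η · φ)` has exactly this derivative. A
multiple of `|η|²` costs no dissipation and can be taken large enough for definiteness. -/
lemma exists_extension_of_split (M : X × U →ₗ[ℂ] X) (S : HermForm (X × U)) (η : X →ₗ[ℂ] ℂ)
    (hη : ∀ f, η (M f) = 0) {e : X × U} (he : M e = 0) (hηe : η e.1 = 1)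
    (hS : ∀ g, M g = 0 → 0 ≤ (S g g).re)
    (heS : ∀ g, M g = 0 → η g.1 = 0 → S e g = 0)
    (p : X →ₗ[ℂ] LinearMap.ker η) (hp : ∀ x, (p x : X) = x - η x • e.1)
    (P' : HermForm (LinearMap.ker η))
    (hP' : (dissipation (compress M _ p) (S.comp (inclTraj U _)) P').PosSemidef) :
    ∃ P : HermForm X, (dissipation M S P).PosSemidef ∧ (P'.PosDef → P.PosDef) := by
  obtain ⟨J, hJ⟩ := exists_pseudoInverse M
  let ψ : X × U →ₗ[ℂ] ℂ := S.toDual e ∘ₗ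
    (LinearMap.id - (LinearMap.toSpanSingleton ℂ (X × U) e) ∘ₗ η ∘ₗ LinearMap.fst ℂ X U)
  have hψ : ∀ f, ψ f = S e (f - η f.1 • e) := fun f => rfl
  have hψker : ∀ f, M f = 0 → ψ f = 0 := fun f hf => by
    rw [hψ]
    apply heS
    · rw [map_sub, map_smul, hf, he]; simp
    · simp [hηe]
  let φ : X →ₗ[ℂ] ℂ := ψ ∘ₗ J
  have hφ : ∀ f, φ (M f) = S e (f - η f.1 • e) := fun f => by
    have h1 := hψker (J (M f) - f) (by rw [map_sub, hJ, sub_self])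
    rw [map_sub, sub_eq_zero] at h1
    rw [← hψ, ← h1]; rfl
  let b : SesqForm ℂ (LinearMap.ker η) :=
    SesqForm.ofDual LinearMap.id (φ ∘ₗ (LinearMap.ker η).subtype)
  obtain ⟨k, hk⟩ : ∃ k : ℝ, P'.PosDef →
      ∀ w x, 0 ≤ (P' x x).re + 2 * (b w x).re + k * ‖w‖ ^ 2 := by
    by_cases h : P'.PosDef
    · obtain ⟨k, -, hk⟩ := h.posSemidef.exists_block_nonneg b (fun w x hx => by
        have : x = 0 := by
          by_contra hne
          exact absurd hx (h x hne).ne'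
        rw [this]; exact b.zero_right w)
      exact ⟨k, fun _ => hk⟩
    · exact ⟨0, fun h' => absurd h' h⟩
  -- `k` dominates the pairing with `ker η`, `2 * ‖φ e.1‖` the value of `φ` on the split-off
  -- direction, and `1` leaves strict positivity.
  let c : ℝ := k + 1 + 2 * ‖φ e.1‖
  let P : HermForm X := P'.comp p + (SesqForm.ofDual η φ).herm + c • (HermForm.ofInner ℂ).comp η
  have hPapp : ∀ x y, P x y = P' (p x) (p y) + (star (η x) * φ y + star (star (η y) * φ x))
      + (c : ℂ) * inner ℂ (η x) (η y) := fun x y => rfl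
  refine ⟨P, fun f => ?_, fun hdef x hx => ?_⟩
  · set l := η f.1 with hl
    set g : LinearMap.ker η × U := (p f.1, f.2 - l • e.2) with hg
    have hgv : inclTraj U _ g = f - l • e := by
      ext1
      · simp [hg, hp, hl]
      · simp [hg]
    have hf : f = l • e + inclTraj U _ g := by rw [hgv]; abel
    have hMf : M (inclTraj U _ g) = M f := by rw [hgv, map_sub, map_smul, he, smul_zero, sub_zero]
    have hpM : compress M _ p g = p (M f) := by rw [← hMf]; rfl
    have h1 := hP' g
    rw [dissipation_quad, hpM] at h1
    rw [dissipation_quad, hPapp, hη, hφ, ← hgv]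
    have h2 : (S f f).re = ‖l‖ ^ 2 * (S e e).re + 2 * (star l * S e (inclTraj U _ g)).re
        + (S (inclTraj U _ g) (inclTraj U _ g)).re := by
      conv_lhs => rw [hf, S.quad_add, S.quad_smul, S.smul_left]
    rw [h2]
    have h3 := mul_nonneg (sq_nonneg ‖l‖) (hS e he)
    simp only [HermForm.comp_apply] at h1
    have h4 : (g.1 : LinearMap.ker η) = p f.1 := rfl
    rw [h4] at h1
    simp only [star_zero, zero_mul, inner_zero_right, mul_zero, add_zero, Complex.add_re,
      ← hl]
    linarith
  · rw [hPapp]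
    set l := η x with hl
    have hx' : x = (p x : X) + l • e.1 := by rw [hp]; abel
    have hφx : φ x = φ (p x : X) + l * φ e.1 := by
      conv_lhs => rw [hx', map_add, map_smul, smul_eq_mul]
    have h1 := hk hdef l (p x)
    have hb : b l (p x) = star l * φ (p x : X) := rfl
    have h5 : inner ℂ l l = ((‖l‖ ^ 2 : ℝ) : ℂ) := by
      rw [inner_self_eq_norm_sq_to_K]; norm_cast
    have h6 : (star l * φ x).re = (b l (p x)).re + ‖l‖ ^ 2 * (φ e.1).re := by
      rw [hφx, hb, mul_add, Complex.add_re, ← mul_assoc, ← Complex.normSq_eq_norm_sq]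
      have : star l * l = ((Complex.normSq l : ℝ) : ℂ) := by
        rw [mul_comm]; exact Complex.mul_conj l
      rw [this, Complex.re_ofReal_mul]
    have h7 : (star (star l * φ x)).re = (star l * φ x).re := by simp
    rw [Complex.add_re, Complex.add_re, Complex.add_re, h7, h6, h5]
    rw [← Complex.ofReal_mul, Complex.ofReal_re]
    have h8 : -‖φ e.1‖ ≤ (φ e.1).re := (abs_le.1 (Complex.abs_re_le_norm _)).1
    by_cases hl0 : l = 0
    · have hpx : p x ≠ 0 := fun h => hx (by rw [hx', h, hl0]; simp)
      have := hdef _ hpx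
      have hb0 : (b l (p x)).re = 0 := by rw [hb, hl0]; simp
      rw [hb0, hl0]
      simpa using this
    · have : 0 < ‖l‖ ^ 2 := by positivity
      have h9 := mul_le_mul_of_nonneg_left h8 this.le
      simp only [c]
      nlinarith

end System

/-- Polarization with `x + y` and `x + i y`. -/
lemma SesqForm.conj_symm_of_im {V : Type*} [AddCommGroup V] [Module ℂ V] (b : SesqForm V V)
    (h : ∀ x, (b x x).im = 0) (x y : V) : star (b y x) = b x y := by
  have key : ∀ x y, (b x y).im + (b y x).im = 0 := fun x y => by
    have := h (x + y)
    rw [b.add_left, b.add_right, b.add_right] at this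
    simp only [Complex.add_im, h x, h y] at this
    linarith
  have h1 := key x y
  have h2 := key x (Complex.I • y)
  rw [b.smul_right, b.smul_left] at h2
  simp at h2
  apply Complex.ext
  · simp; linarith
  · simp; linarith

/-! ### Compression along lossless equilibria, and extension of storages. -/

section Reduction

variable {X U : Type*} [NormedAddCommGroup X] [InnerProductSpace ℂ X] [FiniteDimensional ℂ X]
  [NormedAddCommGroup U] [InnerProductSpace ℂ U] [FiniteDimensional ℂ U]

/-- Lossless equilibria: stationary trajectories without supply. -/
def IsLossless (M : X × U →ₗ[ℂ] X) (S : HermForm (X × U)) (e : X × U) : Prop :=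
  M e = 0 ∧ (S e e).re = 0

/-- The data that split the range of `M` into the states of lossless equilibria (through `σ`) and
a complement `Y` (through `p`), orthogonal for every storage function. -/
structure LosslessSplitting (M : X × U →ₗ[ℂ] X) (S : HermForm (X × U)) where
  J : X →ₗ[ℂ] X × U
  σ : X →ₗ[ℂ] X × U
  Y : Submodule ℂ X
  p : X →ₗ[ℂ] Y
  nonneg : ∀ g, M g = 0 → 0 ≤ (S g g).re
  mem_range : ∀ g, M g = 0 → ∃ f, M f = g.1
  hJ : ∀ f, M (J (M f)) = M f
  hσ : ∀ x, IsLossless M S (σ x)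
  hσS : ∀ e f, IsLossless M S e → S e f = S e (J (σ (M f)).1)
  hσe : ∀ e, IsLossless M S e → σ e.1 = e
  real : ∀ e, IsLossless M S e → (S e (J e.1)).im = 0
  pos : ∀ e, IsLossless M S e → e ≠ 0 → 0 < (S e (J e.1)).re
  hY : ∀ y ∈ Y, (∃ f, M f = y) ∧ σ y = 0
  hp : ∀ f, (p (M f) : X) = M f - (σ (M f)).1

namespace LosslessSplitting

variable {M : X × U →ₗ[ℂ] X} {S : HermForm (X × U)} (D : LosslessSplitting M S)

/-- The compressed system. -/
def red : D.Y × U →ₗ[ℂ] D.Y := compress M D.Y D.p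

/-- The supply rate of the compressed system. -/
def redS : HermForm (D.Y × U) := S.comp (inclTraj U D.Y)

/-- The storage on lossless states, forced by the supply rate. -/
def gram : HermForm X where
  toFun n n' := S (D.σ n) (D.J (D.σ n').1)
  add_right' x y z := by simp only [map_add, Prod.fst_add, S.add_right]
  smul_right' x c y := by simp only [map_smul, Prod.smul_fst, S.smul_right]
  conj_symm' x y := SesqForm.conj_symm_of_im
    (S.toSesq D.σ (D.J ∘ₗ LinearMap.fst ℂ X U ∘ₗ D.σ)) (fun x => D.real _ (D.hσ x)) x y

lemma gram_apply (n n' : X) : D.gram n n' = S (D.σ n) (D.J (D.σ n').1) := rfl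

lemma gram_quad_nonneg (n : X) : 0 ≤ (D.gram n n).re := by
  by_cases h : D.σ n = 0
  · simp [gram_apply, h]
  · exact (D.pos _ (D.hσ n) h).le

/-- The projection of trajectories to the compressed system. -/
def trajProj : X × U →ₗ[ℂ] D.Y × U :=
  (D.p ∘ₗ LinearMap.fst ℂ X U).prod
    (LinearMap.snd ℂ X U - LinearMap.snd ℂ X U ∘ₗ D.σ ∘ₗ LinearMap.fst ℂ X U)

lemma trajProj_apply (f : X × U) : D.trajProj f = (D.p f.1, f.2 - (D.σ f.1).2) := rfl

lemma coe_p {n : X} (hn : ∃ f, M f = n) : (D.p n : X) = n - (D.σ n).1 := by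
  obtain ⟨f, rfl⟩ := hn
  exact D.hp f

lemma eq_add_trajProj {f : X × U} (hf : ∃ g, M g = f.1) :
    f = D.σ f.1 + inclTraj U D.Y (D.trajProj f) := by
  ext1
  · simp [trajProj_apply, D.coe_p hf]
  · simp [trajProj_apply]

lemma map_trajProj {f : X × U} (hf : ∃ g, M g = f.1) : M (inclTraj U D.Y (D.trajProj f)) = M f := by
  conv_rhs => rw [D.eq_add_trajProj hf, map_add, (D.hσ _).1, zero_add]

lemma red_trajProj {f : X × U} (hf : ∃ g, M g = f.1) : D.red (D.trajProj f) = D.p (M f) := by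
  rw [← D.map_trajProj hf]; rfl

/-- The storage on the range of `M` built from one of the compressed system. -/
def assembled (Q : HermForm D.Y) : HermForm X := D.gram + Q.comp D.p

lemma assembled_apply (Q : HermForm D.Y) (x y : X) :
    D.assembled Q x y = D.gram x y + Q (D.p x) (D.p y) := rfl

/-- Split `f` into the lossless equilibrium `σ f.1` and a trajectory of the compressed system. The
lossless part has no supply of its own, and its cross term with the rest is `gram f.1 (M f)`, which
is what the derivative of `gram` absorbs. -/
lemma dissipation_assembled (Q : HermForm D.Y) {f : X × U} (hf : ∃ g, M g = f.1) :
    (dissipation D.red D.redS Q (D.trajProj f) (D.trajProj f)).re =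
      (dissipation M S (D.assembled Q) f f).re := by
  rw [dissipation_quad, dissipation_quad, assembled_apply, D.red_trajProj hf]
  have h1 : (S f f).re = 2 * (D.gram f.1 (M f)).re
      + (D.redS (D.trajProj f) (D.trajProj f)).re := by
    conv_lhs => rw [D.eq_add_trajProj hf, S.quad_add, (D.hσ _).2, D.hσS _ _ (D.hσ _),
      D.map_trajProj hf]
    rw [gram_apply, zero_add]; rfl
  rw [h1, Complex.add_re]
  have : (D.trajProj f).1 = D.p f.1 := rfl
  rw [this]; ring

/-- This is the identity that any storage must satisfy at a lossless equilibrium; it makes the cross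
terms in `exists_extension` vanish there. -/
lemma assembled_lossless (Q : HermForm D.Y) {e : X × U} (he : IsLossless M S e) (f : X × U) :
    D.assembled Q e.1 (M f) = S e f := by
  have h0 : D.p e.1 = 0 := by
    apply Subtype.ext
    rw [D.coe_p (D.mem_range e he.1), D.hσe e he]; simp
  rw [assembled_apply, h0, HermForm.zero_left, add_zero, gram_apply, D.hσe e he, ← D.hσS e f he]

lemma assembled_pos {Q : HermForm D.Y} (hQ : Q.PosDef) {n : X} (hn : ∃ f, M f = n) (h0 : n ≠ 0) :
    0 < (D.assembled Q n n).re := by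
  rw [assembled_apply, Complex.add_re]
  by_cases hp : D.p n = 0
  · have h1 : D.σ n ≠ 0 := fun h => h0 (by
      have := D.coe_p hn
      rw [hp, h] at this
      simpa using this.symm)
    have := D.pos _ (D.hσ n) h1
    rw [hp, HermForm.zero_left, gram_apply]
    simpa using this
  · have h1 := hQ _ hp
    have h2 := D.gram_quad_nonneg n
    linarith

/-- Decoupling the zero-dissipation trajectories `K` from the equilibria and from the states
outside the range of `M`. -/
lemma exists_decoupling (hM : ∀ g, M g = 0 → ∃ f, M f = g.1) (K : Submodule ℂ (X × U)) (R : Submodule ℂ X)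
    (hK : ∀ f ∈ K, ∃ g, M g = f.1) (hR : ∀ w ∈ R, (∃ g, M g = w) → w = 0) :
    ∃ Θ : X × U →ₗ[ℂ] X × U, (∀ e, M e = 0 → Θ e = 0) ∧ (∀ w ∈ R, Θ (w, 0) = 0) ∧
      ∀ f ∈ K, M (f - Θ f) = 0 ∧ f - Θ f ∈ K := by
  obtain ⟨C, hC⟩ := (K ⊓ LinearMap.ker M).exists_isCompl
  let Q₀ : Submodule ℂ (X × U) := LinearMap.ker M ⊔ R.map (LinearMap.inl ℂ X U)
  -- States of `K` and of `ker M` lie in the range of `M`, so the summand from `R` vanishes, and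
  -- what remains lies in both `K ⊓ ker M` and its complement `C`.
  have hdisj : Disjoint Q₀ (K ⊓ C) := by
    rw [Submodule.disjoint_def]
    rintro f hf ⟨hfK, hfC⟩
    obtain ⟨e, he, w', hw', rfl⟩ := Submodule.mem_sup.1 hf
    obtain ⟨w, hw, rfl⟩ := hw'
    have hw0 : w = 0 := by
      apply hR w hw
      obtain ⟨g₁, hg₁⟩ := hK _ hfK
      obtain ⟨g₂, hg₂⟩ := hM e he
      refine ⟨g₁ - g₂, ?_⟩
      rw [map_sub, hg₁, hg₂]
      simp
    subst hw0
    simp only [map_zero, add_zero] at hfK hfC ⊢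
    have := Submodule.disjoint_def.1 hC.disjoint e ⟨hfK, he⟩ hfC
    exact this
  obtain ⟨Q, hQ₀, hQ⟩ := hdisj.exists_isCompl
  -- On `K` this is the projection along `K ⊓ ker M`, so `f - Θ f` is the stationary component of
  -- `f`; enlarging the kernel to `Q` makes `Θ` vanish on all equilibria and on `R`.
  let Θ := (K ⊓ C).projection Q hQ.symm
  refine ⟨Θ, fun e he => ?_, fun w hw => ?_, fun f hf => ?_⟩
  · exact (Submodule.projection_apply_eq_zero_iff hQ.symm).2
      (hQ₀ (Submodule.mem_sup_left (LinearMap.mem_ker.2 he)))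
  · exact (Submodule.projection_apply_eq_zero_iff hQ.symm).2
      (hQ₀ (Submodule.mem_sup_right ⟨w, hw, rfl⟩))
  · have h1 : f ∈ (K ⊓ LinearMap.ker M) ⊔ C := by rw [hC.sup_eq_top]; trivial
    obtain ⟨a, ha, c, hc, hac⟩ := Submodule.mem_sup.1 h1
    have hcK : c ∈ K := by
      have : c = f - a := by rw [← hac]; abel
      rw [this]
      exact K.sub_mem hf ha.1
    have h2 : Θ c = c := Submodule.projection_apply_of_mem_left hQ.symm ⟨hcK, hc⟩
    have h3 : Θ a = 0 := (Submodule.projection_apply_eq_zero_iff hQ.symm).2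
      (hQ₀ (Submodule.mem_sup_left ha.2))
    have h4 : f - Θ f = a := by rw [← hac, map_add, h2, h3]; abel
    rw [h4]
    exact ⟨ha.2, ha.1⟩

/-- On the range of `M` the storage is `gram` plus the compressed one. The component `w = ρ x` in a
complement `C` is conserved, so `f = (w, 0) + g` with the state of `g` in the range. What has to be
controlled is the cross term `c w g`, which need not vanish on the zero-dissipation trajectories
`K`. Its part `c w (Θ g)` depends on `M f` alone and is produced by a storage term; the part `c w (g
- Θ g)` vanishes on `K`, because `g - Θ g` is then a lossless equilibrium, and is absorbed by a
multiple of `‖w‖ ^ 2`. -/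
theorem exists_extension (Q : HermForm D.Y) (hQ : (dissipation D.red D.redS Q).PosSemidef) :
    ∃ P : HermForm X, (dissipation M S P).PosSemidef ∧ (Q.PosDef → P.PosDef) := by
  obtain ⟨C, hC⟩ := (LinearMap.range M).exists_isCompl
  let π : X →ₗ[ℂ] X := (LinearMap.range M).projection C hC
  let ρ : X →ₗ[ℂ] X := LinearMap.id - π
  have hπ : ∀ x, ∃ f, M f = π x := fun x => Submodule.projection_apply_mem hC x
  have hπM : ∀ x, (∃ f, M f = x) → π x = x := fun x hx =>
    Submodule.projection_apply_of_mem_left hC hx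
  have hρM : ∀ x, (∃ f, M f = x) → ρ x = 0 := fun x hx => by
    simp [ρ, hπM x hx]
  have hρC : ∀ x, ρ x ∈ C := fun x => Submodule.sub_projection_mem hC x
  have hCρ : ∀ w ∈ C, (∃ g, M g = w) → w = 0 := fun w hw hg =>
    Submodule.disjoint_def.1 hC.disjoint w hg hw
  have hsplit : ∀ x, π x + ρ x = x := fun x => by simp [ρ]
  let PN := D.assembled Q
  -- the storage surplus on trajectories with states in the range of `M`
  let tp : X × U →ₗ[ℂ] X × U := π.prodMap LinearMap.id
  have htp : ∀ f, ∃ g, M g = (tp f).1 := fun f => hπ f.1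
  let LN : HermForm (X × U) := (dissipation D.red D.redS Q).comp D.trajProj
  have hLN : LN.PosSemidef := fun f => hQ _
  have hLN' : ∀ f, (∃ g, M g = f.1) → (LN f f).re = (dissipation M S PN f f).re :=
    fun f hf => D.dissipation_assembled Q hf
  let K : Submodule ℂ (X × U) := hLN.null ⊓ (LinearMap.range M).comap (LinearMap.fst ℂ X U)
  obtain ⟨Θ, hΘM, hΘw, hΘK⟩ := exists_decoupling D.mem_range K C (fun f hf => hf.2) hCρ
  let c : SesqForm X (X × U) := S.toSesq (LinearMap.inl ℂ X U) LinearMap.id -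
    PN.toSesq (M ∘ₗ LinearMap.inl ℂ X U) (LinearMap.fst ℂ X U)
  have hc : ∀ w g, c w g = S (w, 0) g - PN (M (w, 0)) g.1 := fun w g => rfl
  have hc0 : ∀ w e, IsLossless M S e → c w e = 0 := fun w e he => by
    rw [hc, ← S.conj_symm, ← PN.conj_symm, D.assembled_lossless Q he, sub_self]
  let b : SesqForm X (X × U) := c.comp LinearMap.id tp - c.comp LinearMap.id (Θ ∘ₗ tp)
  have hb : ∀ w f, b w f = c w (tp f - Θ (tp f)) := fun w f => (c.sub_right w _ _).symm
  obtain ⟨k, hk0, hk⟩ := HermForm.PosSemidef.exists_block_nonneg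
    (Q := LN.comp tp) (fun f => hLN _) b (by
      intro w f hf
      have hfK : tp f ∈ K := ⟨hf, htp f⟩
      obtain ⟨h1, h2⟩ := hΘK _ hfK
      rw [hb]
      apply hc0 w _ ⟨h1, ?_⟩
      have h3 := hLN.mem_null.1 h2.1
      have h4 : ∃ g, M g = (tp f - Θ (tp f)).1 := h2.2
      rw [hLN' _ h4, dissipation_quad, h1] at h3
      simpa using h3)
  obtain ⟨C₀, hC₀, hC₀'⟩ := (S.comp (LinearMap.inl ℂ X U)).exists_bound
  let k₁ : ℝ := k + C₀
  -- The first summand reproduces `c w (Θ g)` from `M f`. The second creates dissipation in `w`: `J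
  -- (M f) - f` is an equilibrium, whose state lies in the range of `M`, so `ρ (J (M f)).1 = w` and
  -- the conserved component can be read off from `M f`. In `k₁`, the constant `k` serves the cross
  -- term and `C₀` the supply of `(w, 0)`.
  let q : SesqForm X X := c.comp LinearMap.id (Θ ∘ₗ D.J) -
    (k₁ • (HermForm.ofInner X).toSesq LinearMap.id (ρ ∘ₗ LinearMap.fst ℂ X U ∘ₗ D.J))
  have hq : ∀ w n, q w n = c w (Θ (D.J n)) - (k₁ : ℂ) * inner ℂ w (ρ (D.J n).1) := fun w n => rfl
  obtain ⟨k₂, hk₂⟩ : ∃ k₂ : ℝ, Q.PosDef →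
      ∀ w x, 0 ≤ (PN (π x) (π x)).re + 2 * (q w (π x)).re + k₂ * ‖w‖ ^ 2 := by
    by_cases hQd : Q.PosDef
    · have hPN : (PN.comp π).PosSemidef := fun x => by
        rw [HermForm.comp_apply]
        by_cases h0 : π x = 0
        · simp [h0]
        · exact (D.assembled_pos hQd (hπ x) h0).le
      obtain ⟨k₂, -, hk₂⟩ := hPN.exists_block_nonneg (q.comp LinearMap.id π) (fun w x hx => by
        have h0 : π x = 0 := by
          by_contra h0
          exact absurd hx (D.assembled_pos hQd (hπ x) h0).ne'
        rw [SesqForm.comp_apply, h0, SesqForm.zero_right])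
      exact ⟨k₂, fun _ => hk₂⟩
    · exact ⟨0, fun h => absurd h hQd⟩
  -- Because `ρ ∘ M = 0`, the last summand does not affect the dissipation; it serves definiteness
  -- only.
  let P : HermForm X := PN.comp π + (q.comp ρ π).herm + (k₂ + 1) • (HermForm.ofInner X).comp ρ
  have hP : ∀ x y, P x y = PN (π x) (π y) + (q (ρ x) (π y) + star (q (ρ y) (π x))) +
      ((k₂ + 1 : ℝ) : ℂ) * inner ℂ (ρ x) (ρ y) := fun x y => rfl
  refine ⟨P, fun f => ?_, fun hQd x hx => ?_⟩
  · set w := ρ f.1 with hw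
    set g := tp f with hg
    have hf : f = (w, 0) + g := by
      ext1
      · simp only [hg, hw, tp, Prod.fst_add]
        rw [add_comm]; exact (hsplit f.1).symm
      · simp [hg, tp]
    have hgg : tp g = g := by
      ext1
      · exact hπM _ (hπ f.1)
      · rfl
    have hMf : ∃ h, M h = M f := ⟨f, rfl⟩
    have h0 : D.J (M f) - f ∈ LinearMap.ker M := by
      rw [LinearMap.mem_ker, map_sub, D.hJ, sub_self]
    have h1 : Θ (D.J (M f)) = Θ g := by
      have h2 := hΘM _ h0
      rw [map_sub, sub_eq_zero] at h2
      rw [h2]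
      conv_lhs => rw [hf, map_add, hΘw w (hρC _), zero_add]
    have h2 : ρ (D.J (M f)).1 = w := by
      have h3 := hρM _ (D.mem_range _ h0)
      rw [Prod.fst_sub, map_sub, sub_eq_zero] at h3
      rw [h3]
    have h3 : P f.1 (M f) = PN g.1 (M f) + (c w (Θ g) - (k₁ : ℂ) * inner ℂ w w) := by
      rw [hP, hπM _ hMf, hρM _ hMf, ← hw, hq, h1, h2, inner_zero_right]
      have h4 : q 0 (π f.1) = 0 := by
        have := q.smul_left 0 0 (π f.1)
        simpa using this
      rw [h4]
      simp [g, tp]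
    have h4 : PN g.1 (M f) = PN g.1 (M (w, 0)) + PN g.1 (M g) := by
      conv_lhs => rw [hf, map_add, PN.add_right]
    have h5 : (S f f).re = (S (w, 0) (w, 0)).re + 2 * (S (w, 0) g).re + (S g g).re := by
      conv_lhs => rw [hf, S.quad_add]
    have h6 := hk w g
    rw [hb, hgg, c.sub_right, HermForm.comp_apply, hgg, hLN' g (htp f), dissipation_quad,
      Complex.sub_re, hc w g, Complex.sub_re] at h6
    have h7 : (inner ℂ w w : ℂ) = ((‖w‖ ^ 2 : ℝ) : ℂ) := by
      rw [inner_self_eq_norm_sq_to_K]; norm_cast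
    have h8 : -(C₀ * ‖w‖ ^ 2) ≤ (S (w, 0) (w, 0)).re := by
      have := (abs_le.1 ((Complex.abs_re_le_norm _).trans (hC₀' w w))).1
      rw [sq, ← mul_assoc]
      exact this
    rw [dissipation_quad, h3, h4, h5, Complex.add_re, Complex.sub_re, Complex.add_re, h7,
      ← Complex.ofReal_mul, Complex.ofReal_re, PN.re_symm (M (w, 0)) g.1]
    have h9 : (k₁ * ‖w‖ ^ 2) = k * ‖w‖ ^ 2 + C₀ * ‖w‖ ^ 2 := by simp only [k₁]; ring
    have h10 : 0 ≤ C₀ * ‖w‖ ^ 2 := by positivity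
    have h11 : 0 ≤ k * ‖w‖ ^ 2 := by positivity
    linarith
  · rw [hP]
    have h7 : (inner ℂ (ρ x) (ρ x) : ℂ) = ((‖ρ x‖ ^ 2 : ℝ) : ℂ) := by
      rw [inner_self_eq_norm_sq_to_K]; norm_cast
    have h1 := hk₂ hQd (ρ x) x
    have h2 : (star (q (ρ x) (π x))).re = (q (ρ x) (π x)).re := by simp
    rw [Complex.add_re, Complex.add_re, Complex.add_re, h2, h7, ← Complex.ofReal_mul,
      Complex.ofReal_re]
    by_cases h0 : ρ x = 0
    · have hx' : π x ≠ 0 := fun h => hx (by rw [← hsplit x, h, h0, add_zero])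
      have h3 := D.assembled_pos hQd (hπ x) hx'
      have h4 : q 0 (π x) = 0 := by
        have := q.smul_left 0 0 (π x)
        simpa using this
      rw [h0, h4]
      simpa using h3
    · have : 0 < ‖ρ x‖ ^ 2 := by positivity
      linarith

end LosslessSplitting

end Reduction

/-! ### Existence of the splitting, rotating frames and the frequency bound. -/

section Reduction

variable {X U : Type*} [NormedAddCommGroup X] [InnerProductSpace ℂ X] [FiniteDimensional ℂ X]
  [NormedAddCommGroup U] [InnerProductSpace ℂ U] [FiniteDimensional ℂ U]

lemma IsLossless.apply_eq_zero {M : X × U →ₗ[ℂ] X} {S : HermForm (X × U)}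
    (hS : ∀ g, M g = 0 → 0 ≤ (S g g).re) {e : X × U} (he : IsLossless M S e) {g : X × U}
    (hg : M g = 0) : S e g = 0 :=
  HermForm.apply_eq_zero_of_quad (p := fun f => M f = 0)
    (fun x y hx hy => by rw [map_add, hx, hy, add_zero])
    (fun c x hx => by rw [map_smul, hx, smul_zero]) hS he.1 he.2 hg

/-- The lossless equilibria form a subspace. -/
def losslessSpace {M : X × U →ₗ[ℂ] X} {S : HermForm (X × U)}
    (hS : ∀ g, M g = 0 → 0 ≤ (S g g).re) : Submodule ℂ (X × U) where
  carrier := {e | IsLossless M S e}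
  zero_mem' := by constructor <;> simp
  add_mem' := fun {a b} ha hb => by
    refine ⟨by rw [map_add, ha.1, hb.1, add_zero], ?_⟩
    rw [S.quad_add, ha.2, hb.2, ha.apply_eq_zero hS hb.1]; simp
  smul_mem' := fun c a ha =>
    ⟨by rw [map_smul, ha.1, smul_zero], by rw [S.quad_smul, ha.2, mul_zero]⟩

/-- The pairing `G e e' = S e (J e'.1)` on lossless equilibria is Hermitian by `hreal` and positive
definite by `hpos`. Riesz representation in `G` then produces `σ`, a projection onto lossless
equilibria, and `Y` is its kernel within the range of `M`. -/
theorem LosslessSplitting.nonempty {M : X × U →ₗ[ℂ] X} {S : HermForm (X × U)}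
    (hS : ∀ g, M g = 0 → 0 ≤ (S g g).re) (hM : ∀ g, M g = 0 → ∃ f, M f = g.1)
    (hreal : ∀ e d, IsLossless M S e → M d = e.1 → (S e d).im = 0)
    (hpos : ∀ e d, IsLossless M S e → M d = e.1 → e ≠ 0 → 0 < (S e d).re) :
    Nonempty (LosslessSplitting M S) := by
  obtain ⟨J, hJ⟩ := exists_pseudoInverse M
  have hMJ : ∀ e : X × U, M e = 0 → M (J e.1) = e.1 := fun e he => by
    obtain ⟨f, hf⟩ := hM e he
    rw [← hf, hJ]
  let E₀ := losslessSpace hS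
  have hE₀ : ∀ e : E₀, IsLossless M S e := fun e => e.2
  let b₀ : SesqForm E₀ E₀ := S.toSesq E₀.subtype (J ∘ₗ LinearMap.fst ℂ X U ∘ₗ E₀.subtype)
  let G : HermForm E₀ :=
    { toFun := b₀
      add_right' := b₀.add_right
      smul_right' := b₀.smul_right
      conj_symm' := b₀.conj_symm_of_im fun e => hreal e _ (hE₀ e) (hMJ e (hE₀ e).1) }
  have hG : ∀ e e' : E₀, G e e' = S e (J (e' : X × U).1) := fun e e' => rfl
  have hGpos : G.PosDef := fun e he =>
    hpos e _ (hE₀ e) (hMJ e (hE₀ e).1) (by simpa using he)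
  obtain ⟨T, hT⟩ := hGpos.exists_linear_rep (S.toSesq J E₀.subtype)
  let σ : X →ₗ[ℂ] X × U := E₀.subtype ∘ₗ T
  have hσ : ∀ x, IsLossless M S (σ x) := fun x => hE₀ (T x)
  have hσS : ∀ e f, IsLossless M S e → S e f = S e (J (σ (M f)).1) := fun e f he => by
    have h1 : S e (J (M f) - f) = 0 := he.apply_eq_zero hS (by rw [map_sub, hJ, sub_self])
    rw [S.sub_right, sub_eq_zero] at h1
    have h2 := hT (M f) ⟨e, he⟩
    have h3 : S e (J (M f)) = G ⟨e, he⟩ (T (M f)) := by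
      rw [← G.conj_symm, h2, ← S.conj_symm]; rfl
    rw [← h1, h3]; rfl
  have hσe : ∀ e, IsLossless M S e → σ e.1 = e := fun e he => by
    have h1 : T e.1 - ⟨e, he⟩ = 0 := by
      by_contra hne
      have h2 := hGpos _ hne
      have h3 : ∀ x, G (T e.1) x = G ⟨e, he⟩ x := fun x => by
        rw [hT, ← G.conj_symm, hG, S.conj_symm]; rfl
      rw [G.sub_left, h3, sub_self] at h2
      simp at h2
    exact congrArg Subtype.val (sub_eq_zero.1 h1)
  let Y : Submodule ℂ X := LinearMap.range M ⊓ LinearMap.ker σ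
  obtain ⟨C, hC⟩ := (LinearMap.range M).exists_isCompl
  let π : X →ₗ[ℂ] X := (LinearMap.range M).projection C hC
  have hπ : ∀ x, ∃ f, M f = π x := fun x => Submodule.projection_apply_mem hC x
  let p₀ : X →ₗ[ℂ] X := π - LinearMap.fst ℂ X U ∘ₗ σ ∘ₗ π
  have hp₀ : ∀ x, p₀ x = π x - (σ (π x)).1 := fun x => rfl
  have hp₀Y : ∀ x, p₀ x ∈ Y := fun x => by
    constructor
    · obtain ⟨f, hf⟩ := hπ x
      obtain ⟨g, hg⟩ := hM _ (hσ (π x)).1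
      exact ⟨f - g, by rw [map_sub, hf, hg, hp₀]⟩
    · change σ (p₀ x) = 0
      rw [hp₀, map_sub, hσe _ (hσ _), sub_self]
  exact ⟨
    { J := J, σ := σ, Y := Y, p := p₀.codRestrict Y hp₀Y, nonneg := hS, mem_range := hM, hJ := hJ
      hσ := hσ, hσS := hσS, hσe := hσe
      real := fun e he => hreal e _ he (hMJ e he.1)
      pos := fun e he h0 => hpos e _ he (hMJ e he.1) h0
      hY := fun y hy => ⟨hy.1, hy.2⟩
      hp := fun f => by
        have : π (M f) = M f := Submodule.projection_apply_of_mem_left hC ⟨f, rfl⟩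
        rw [LinearMap.codRestrict_apply, hp₀, this] }⟩

lemma LosslessSplitting.finrank_lt {M : X × U →ₗ[ℂ] X} {S : HermForm (X × U)}
    (D : LosslessSplitting M S) {e : X × U} (he : IsLossless M S e) (h0 : e ≠ 0) :
    Module.finrank ℂ D.Y < Module.finrank ℂ X := by
  apply Submodule.finrank_lt
  intro h
  have h1 : e.1 ∈ D.Y := by rw [h]; trivial
  have := (D.hY _ h1).2
  rw [D.hσe e he] at this
  exact h0 this

/-- The system in a frame rotating with frequency `ω`. -/
noncomputable def detune (M : X × U →ₗ[ℂ] X) (ω : ℝ) : X × U →ₗ[ℂ] X :=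
  M - ((ω : ℂ) * Complex.I) • LinearMap.fst ℂ X U

lemma detune_apply (M : X × U →ₗ[ℂ] X) (ω : ℝ) (f : X × U) :
    detune M ω f = M f - ((ω : ℂ) * Complex.I) • f.1 := rfl

lemma detune_detune (M : X × U →ₗ[ℂ] X) (ω ω' : ℝ) :
    detune (detune M ω) ω' = detune M (ω + ω') := by
  ext f <;> simp [detune_apply, add_mul, add_smul, sub_sub]

/-- Multiplication by `iω` is skew for every Hermitian form, so its two contributions cancel. A
rotating frame therefore has the same quadratic storages. -/
lemma dissipation_detune (M : X × U →ₗ[ℂ] X) (S : HermForm (X × U)) (P : HermForm X) (ω : ℝ)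
    (f g : X × U) : dissipation (detune M ω) S P f g = dissipation M S P f g := by
  rw [dissipation_apply, dissipation_apply, detune_apply, detune_apply, P.sub_right, P.sub_left,
    P.smul_right, P.smul_left]
  simp

/-- Strict positivity of the supply on input directions. -/
def RegularSupply (S : HermForm (X × U)) : Prop := ∀ u : U, u ≠ 0 → 0 < (S (0, u) (0, u)).re

/-- Almost stationary oscillations have almost nonnegative supply. -/
def FrequencyBound (M : X × U →ₗ[ℂ] X) (S : HermForm (X × U)) : Prop :=
  ∀ R : ℝ, ∃ C : ℝ, 0 ≤ C ∧ ∀ ω : ℝ, |ω| ≤ R → ∀ f,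
    -(C * ‖f‖ * ‖detune M ω f‖) ≤ (S f f).re

lemma FrequencyBound.detuned {M : X × U →ₗ[ℂ] X} {S : HermForm (X × U)}
    (h : FrequencyBound M S) (ω : ℝ) : FrequencyBound (detune M ω) S := fun R => by
  obtain ⟨C, hC, h⟩ := h (|ω| + R)
  refine ⟨C, hC, fun ω' hω' f => ?_⟩
  rw [detune_detune]
  exact h _ ((abs_add_le _ _).trans (by linarith)) f

lemma FrequencyBound.nonneg {M : X × U →ₗ[ℂ] X} {S : HermForm (X × U)}
    (h : FrequencyBound M S) {ω : ℝ} {f : X × U} (hf : detune M ω f = 0) : 0 ≤ (S f f).re := by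
  obtain ⟨C, -, h⟩ := h |ω|
  have := h ω le_rfl f
  rw [hf] at this
  simpa using this

lemma detune_zero (M : X × U →ₗ[ℂ] X) : detune M 0 = M := by
  ext f <;> simp [detune_apply]

lemma FrequencyBound.nonneg_ker {M : X × U →ₗ[ℂ] X} {S : HermForm (X × U)}
    (h : FrequencyBound M S) (f : X × U) (hf : M f = 0) : 0 ≤ (S f f).re :=
  h.nonneg (ω := 0) (by rw [detune_zero, hf])

/-- Perturb `e` to `e + iν d`. In the frame rotating with frequency `ν` the residual is `ν² d.1`, so
the supply is at least of order `-ν²`, whereas its first-order term is `-2 ν Im (S e d)`. Both signs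
of `ν` are allowed. -/
lemma FrequencyBound.real {M : X × U →ₗ[ℂ] X} {S : HermForm (X × U)}
    (h : FrequencyBound M S) {e d : X × U} (he : IsLossless M S e) (hd : M d = e.1) :
    (S e d).im = 0 := by
  obtain ⟨C, hC, h⟩ := h 1
  have key : ∀ ν : ℝ, |ν| ≤ 1 →
      2 * ν * (S e d).im ≤ ν ^ 2 * ((S d d).re + C * (‖e‖ + ‖d‖) * ‖d.1‖) := fun ν hν => by
    have h1 := h ν hν (e + ((ν : ℂ) * Complex.I) • d)
    have h2 : detune M ν (e + ((ν : ℂ) * Complex.I) • d) = ((ν : ℂ) ^ 2) • d.1 := by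
      rw [detune_apply, map_add, map_smul, he.1, hd]
      simp only [Prod.fst_add, Prod.smul_fst, zero_add, smul_add, smul_smul]
      have : (ν : ℂ) * Complex.I * (ν * Complex.I) = -(ν : ℂ) ^ 2 := by
        linear_combination (ν : ℂ) ^ 2 * Complex.I_sq
      rw [this, neg_smul]; abel
    rw [h2, S.quad_add, he.2, S.quad_smul, S.smul_right, norm_smul] at h1
    simp only [norm_mul, Complex.norm_real, Complex.norm_I, mul_one, norm_pow, Real.norm_eq_abs,
      sq_abs, Complex.mul_re, Complex.mul_im, Complex.ofReal_re, Complex.ofReal_im,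
      Complex.I_re, Complex.I_im] at h1
    have h3 : ‖e + ((ν : ℂ) * Complex.I) • d‖ ≤ ‖e‖ + ‖d‖ := by
      refine (norm_add_le _ _).trans ?_
      rw [norm_smul]
      simp only [norm_mul, Complex.norm_real, Complex.norm_I, mul_one, Real.norm_eq_abs]
      nlinarith [norm_nonneg d]
    have h4 : C * ‖e + ((ν : ℂ) * Complex.I) • d‖ * (ν ^ 2 * ‖d.1‖)
        ≤ C * (‖e‖ + ‖d‖) * (ν ^ 2 * ‖d.1‖) := by gcongr
    nlinarith
  set B := (S d d).re + C * (‖e‖ + ‖d‖) * ‖d.1‖ with hB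
  by_contra hne
  set a := (S e d).im with ha
  have hpos : 0 < |a| := abs_pos.2 hne
  -- Small enough that the quadratic term `t ^ 2 * B` is at most `t * |a|`, which is less than `2 *
  -- t * |a|`.
  set t : ℝ := min 1 (|a| / (|B| + 1)) with ht
  have hB1 : 0 < |B| + 1 := by positivity
  have ht0 : 0 < t := lt_min one_pos (by positivity)
  have ht1 : t ≤ 1 := min_le_left _ _
  have ht2 : t * (|B| + 1) ≤ |a| := by
    rw [← le_div_iff₀ hB1]; exact min_le_right _ _
  have h5 : 2 * t * |a| ≤ t ^ 2 * B := by
    rcases abs_cases a with ⟨h, -⟩ | ⟨h, -⟩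
    · rw [h]; exact key t (by rwa [abs_of_pos ht0])
    · have := key (-t) (by rwa [abs_neg, abs_of_pos ht0])
      rw [h]; nlinarith
  have h6 : t * B ≤ t * (|B| + 1) := by
    apply mul_le_mul_of_nonneg_left _ ht0.le
    linarith [le_abs_self B]
  nlinarith

/-- The frequency bound passes to the compressed system. -/
theorem FrequencyBound.red {M : X × U →ₗ[ℂ] X} {S : HermForm (X × U)}
    (h : FrequencyBound M S) (D : LosslessSplitting M S) : FrequencyBound D.red D.redS := fun R₀ => by
  -- Positivity of `R` keeps a punctured neighbourhood of frequency `0` available for the limit at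
  -- the end.
  set R := max R₀ 0 + 1 with hRdef
  have hR : 0 < R := by positivity
  have hR₀ : R₀ ≤ R := by linarith [le_max_left R₀ 0]
  obtain ⟨C, hC, h⟩ := h R
  obtain ⟨CS, hCS, hS⟩ := S.exists_bound
  let J' := LinearMap.toContinuousLinearMap D.J
  let T' := LinearMap.toContinuousLinearMap (D.σ ∘ₗ M)
  let M' := LinearMap.toContinuousLinearMap D.red
  have hJ : ∀ x, ‖D.J x‖ ≤ ‖J'‖ * ‖x‖ := J'.le_opNorm
  have hT : ∀ f, ‖D.σ (M f)‖ ≤ ‖T'‖ * ‖f‖ := T'.le_opNorm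
  have hM' : ∀ f, ‖D.red f‖ ≤ ‖M'‖ * ‖f‖ := M'.le_opNorm
  have hJ0 : 0 ≤ ‖J'‖ := J'.opNorm_nonneg
  have hT0 : 0 ≤ ‖T'‖ := T'.opNorm_nonneg
  have hM0 : 0 ≤ ‖M'‖ := M'.opNorm_nonneg
  set R' := max R 0
  have hR' : 0 ≤ R' := le_max_right _ _
  set c₁ := ‖M'‖ + R'
  have hc₁ : 0 ≤ c₁ := by positivity
  set c₂ := 1 + ‖T'‖ + ‖J'‖ * c₁
  set C' := C * (c₂ * (R' + 1)) * ‖J'‖ + 2 * CS * ‖J'‖ + CS * ‖J'‖ * (‖J'‖ * c₁)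
  have hC' : 0 ≤ C' := by positivity
  have key : ∀ ν : ℝ, |ν| ≤ R → ν ≠ 0 → ∀ f,
      -(C' * ‖f‖ * ‖detune D.red ν f‖) ≤ (D.redS f f).re := by
    intro ν hν hν0 f
    have hνR : |ν| ≤ R' := hν.trans (le_max_left _ _)
    set m := detune D.red ν f with hm
    have hmf : ‖m‖ ≤ c₁ * ‖f‖ := by
      rw [hm, detune_apply]
      refine (norm_sub_le _ _).trans ?_
      rw [norm_smul]
      simp only [norm_mul, Complex.norm_real, Complex.norm_I, mul_one, Real.norm_eq_abs]
      have h1 : ‖f.1‖ ≤ ‖f‖ := norm_fst_le f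
      have h2 : |ν| * ‖f.1‖ ≤ R' * ‖f‖ := by gcongr
      have := hM' f
      simp only [c₁]
      nlinarith
    set F : X × U := inclTraj U D.Y f with hF
    have hFn : ‖F‖ = ‖f‖ := rfl
    set s : X × U := D.σ (M F) with hs
    have hsl : IsLossless M S s := D.hσ _
    have hiν : ((ν : ℂ) * Complex.I) ≠ 0 := by
      simp [hν0]
    have hmX : (m : X) = M F - s.1 - ((ν : ℂ) * Complex.I) • F.1 := by
      rw [hm, detune_apply, Submodule.coe_sub, Submodule.coe_smul]
      have : (D.red f : X) = M F - s.1 := D.hp F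
      rw [this]; rfl
    obtain ⟨⟨fm, hfm⟩, hσm⟩ := D.hY m m.2
    have hMJm : M (D.J m) = m := by rw [← hfm, D.hJ]
    set g : X × U := -D.J m with hg
    have hgn : ‖g‖ ≤ ‖J'‖ * ‖m‖ := by rw [hg, norm_neg]; exact hJ m
    -- The compression removes `s.1` from `M F`; adding `s / (iν)` to the trajectory compensates for
    -- that, and `g` cancels the residual `m` up to `iν (J m).1`. The norm of `G` grows like `1 /
    -- |ν|`, but the residual carries a factor `|ν|`, so their product stays bounded. The singular
    -- part does not enter the real supply: `s` is lossless, `S s g = 0`, and `S s F` is real while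
    -- its coefficient is imaginary.
    set G : X × U := ((ν : ℂ) * Complex.I)⁻¹ • s + (F + g) with hGdef
    have hrot : detune M ν G = ((ν : ℂ) * Complex.I) • (D.J m).1 := by
      rw [detune_apply, hGdef, map_add, map_smul, hsl.1, smul_zero, zero_add, map_add, hg, map_neg,
        hMJm, hmX]
      simp only [Prod.fst_add, Prod.smul_fst, smul_add, smul_smul, mul_inv_cancel₀ hiν, one_smul,
        Prod.fst_neg, smul_neg]
      abel
    have hrotn : ‖detune M ν G‖ ≤ |ν| * (‖J'‖ * ‖m‖) := by
      rw [hrot, norm_smul]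
      simp only [norm_mul, Complex.norm_real, Complex.norm_I, mul_one, Real.norm_eq_abs]
      gcongr
      exact (norm_fst_le _).trans (hJ m)
    have hGn : |ν| * ‖G‖ ≤ c₂ * (R' + 1) * ‖f‖ := by
      have h1 : ‖G‖ ≤ |ν|⁻¹ * (‖T'‖ * ‖f‖) + (‖f‖ + ‖J'‖ * (c₁ * ‖f‖)) := by
        refine (norm_add_le _ _).trans (add_le_add ?_ ((norm_add_le _ _).trans (add_le_add ?_ ?_)))
        · rw [norm_smul, norm_inv]
          simp only [norm_mul, Complex.norm_real, Complex.norm_I, mul_one, Real.norm_eq_abs]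
          gcongr
          exact hT F
        · exact hFn.le
        · exact hgn.trans (by gcongr)
      have hν' : 0 < |ν| := abs_pos.2 hν0
      calc |ν| * ‖G‖ ≤ |ν| * (|ν|⁻¹ * (‖T'‖ * ‖f‖) + (‖f‖ + ‖J'‖ * (c₁ * ‖f‖))) := by gcongr
        _ = ‖T'‖ * ‖f‖ + |ν| * ((1 + ‖J'‖ * c₁) * ‖f‖) := by field_simp
        _ ≤ ‖T'‖ * ‖f‖ + R' * ((1 + ‖J'‖ * c₁) * ‖f‖) := by gcongr
        _ ≤ c₂ * (R' + 1) * ‖f‖ := by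
          have e1 : 0 ≤ ‖T'‖ * R' * ‖f‖ := by positivity
          have e2 : 0 ≤ (1 + ‖J'‖ * c₁) * ‖f‖ := by positivity
          simp only [c₂]
          nlinarith
    have h1 := h ν hν G
    have hSs : S s F = S s (D.J s.1) := D.hσS s F hsl
    have hSg : S s g = 0 := by
      rw [D.hσS s g hsl, hg, map_neg, hMJm, map_neg, hσm]
      simp
    have h2 : (S G G).re = (S F F).re + (2 * (S F g).re + (S g g).re) := by
      rw [hGdef, S.quad_add, S.quad_smul, hsl.2, S.smul_left, S.add_right, hSg, add_zero, hSs,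
        S.quad_add]
      have e1 : (star (((ν : ℂ) * Complex.I)⁻¹) * S s (D.J s.1)).re = 0 := by
        have h3 := D.real s hsl
        have h4 : S s (D.J s.1) = ((S s (D.J s.1)).re : ℂ) := by
          apply Complex.ext <;> simp [h3]
        rw [h4, mul_comm, Complex.re_ofReal_mul]
        simp
      rw [e1]; ring
    have h3 : (S F g).re ≤ CS * ‖f‖ * (‖J'‖ * ‖m‖) := by
      refine (Complex.re_le_norm _).trans ((hS F g).trans ?_)
      rw [hFn]
      gcongr
    have h4 : (S g g).re ≤ CS * (‖J'‖ * ‖m‖) * (‖J'‖ * (c₁ * ‖f‖)) := by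
      refine (Complex.re_le_norm _).trans ((hS g g).trans ?_)
      gcongr
      exact hgn.trans (by gcongr)
    have h5 : C * ‖G‖ * ‖detune M ν G‖ ≤ C * (c₂ * (R' + 1) * ‖f‖) * (‖J'‖ * ‖m‖) := by
      calc C * ‖G‖ * ‖detune M ν G‖ ≤ C * ‖G‖ * (|ν| * (‖J'‖ * ‖m‖)) := by gcongr
        _ = C * (|ν| * ‖G‖) * (‖J'‖ * ‖m‖) := by ring
        _ ≤ _ := by gcongr
    have h6 : (D.redS f f).re = (S F F).re := rfl
    rw [h6]
    have h7 : C' * ‖f‖ * ‖m‖ = C * (c₂ * (R' + 1) * ‖f‖) * (‖J'‖ * ‖m‖)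
        + 2 * (CS * ‖f‖ * (‖J'‖ * ‖m‖)) + CS * (‖J'‖ * ‖m‖) * (‖J'‖ * (c₁ * ‖f‖)) := by
      simp only [C']; ring
    rw [h7]
    linarith
  refine ⟨C', hC', fun ν hν f => ?_⟩
  by_cases hν0 : ν = 0
  · subst hν0
    -- The construction divides by `ν`, but its constant does not depend on `ν`; frequency `0`
    -- follows by continuity.
    have hcont : Continuous fun ν : ℝ => -(C' * ‖f‖ * ‖detune D.red ν f‖) := by
      simp only [detune_apply]
      fun_prop
    have hlim := (hcont.tendsto 0).mono_left (nhdsWithin_le_nhds (s := {0}ᶜ))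
    refine le_of_tendsto hlim ?_
    have hsmall : ∀ᶠ ν : ℝ in nhds 0, |ν| ≤ R := by
      have : Filter.Tendsto (fun ν : ℝ => |ν|) (nhds 0) (nhds 0) := by
        simpa using (continuous_abs.tendsto (0 : ℝ))
      exact this.eventually_le_const hR
    filter_upwards [hsmall.filter_mono nhdsWithin_le_nhds, self_mem_nhdsWithin] with ν h1 h2
    exact key ν h1 h2 f
  · exact key ν (hν.trans hR₀) hν0 f

end Reduction

/-! ### Separation: a strict storage or a family of trajectories. -/

/-- The convex hull of a compact set in a finite-dimensional space is compact. -/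
theorem IsCompact.convexHull_of_finiteDimensional {E : Type*} [NormedAddCommGroup E]
    [NormedSpace ℝ E] [FiniteDimensional ℝ E] {K : Set E} (hK : IsCompact K) :
    IsCompact (convexHull ℝ K) := by
  set N := Module.finrank ℝ E + 1 with hN
  let Ψ : (Fin N → ℝ) × (Fin N → E) → E := fun a => ∑ i, a.1 i • a.2 i
  have hΨ : Continuous Ψ := by fun_prop
  have hc : IsCompact (stdSimplex ℝ (Fin N) ×ˢ Set.pi Set.univ fun _ : Fin N => K) :=
    (isCompact_stdSimplex ℝ (Fin N)).prod (isCompact_univ_pi fun _ => hK)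
  have himage : ∀ g : Fin N → E,
      convexHull ℝ (Set.range g) = (fun a : Fin N → ℝ => ∑ i, a i • g i) '' stdSimplex ℝ (Fin N) := by
    intro g
    let L : (Fin N → ℝ) →ₗ[ℝ] E := Fintype.linearCombination ℝ g
    have h1 := L.image_convexHull (Set.range fun i j : Fin N => if i = j then (1 : ℝ) else 0)
    rw [convexHull_basis_eq_stdSimplex] at h1
    have h2 : L '' (Set.range fun i j : Fin N => if i = j then (1 : ℝ) else 0) = Set.range g := by
      rw [← Set.range_comp]
      congr 1
      ext i
      simp [L, Fintype.linearCombination_apply]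
    rw [h2] at h1
    exact h1.symm
  convert hc.image hΨ
  apply Set.Subset.antisymm
  · intro x hx
    -- Carathéodory: at most `N` affinely independent points are needed, and the list is padded with
    -- `x₀` to length exactly `N`.
    rw [convexHull_eq_union] at hx
    simp only [Set.mem_iUnion] at hx
    obtain ⟨t, htK, hai, hx⟩ := hx
    have hcard : t.card ≤ N := by
      have := hai.card_le_finrank_succ
      rw [Fintype.card_coe] at this
      refine this.trans ?_
      rw [hN]
      gcongr
      exact Submodule.finrank_le _
    have hne : t.Nonempty := by
      by_contra h
      rw [Finset.not_nonempty_iff_eq_empty] at h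
      simp [h] at hx
    obtain ⟨x₀, hx₀⟩ := hne
    let e := t.equivFin
    let g : Fin N → E := fun i => if h : (i : ℕ) < t.card then (e.symm ⟨i, h⟩ : E) else x₀
    have hg : ∀ i, g i ∈ (t : Set E) := fun i => by
      simp only [g]
      split_ifs with h
      · exact (e.symm ⟨i, h⟩).2
      · exact hx₀
    have hsub : (t : Set E) ⊆ Set.range g := fun y hy => by
      refine ⟨⟨e ⟨y, hy⟩, (e ⟨y, hy⟩).2.trans_le hcard⟩, ?_⟩
      simp [g]
    have hx' := convexHull_mono hsub hx
    rw [himage] at hx'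
    obtain ⟨a, ha, hax⟩ := hx'
    exact ⟨(a, g), ⟨ha, fun i _ => htK (hg i)⟩, hax⟩
  · rintro _ ⟨⟨a, g⟩, ⟨ha, hg⟩, rfl⟩
    have h1 : Ψ (a, g) ∈ convexHull ℝ (Set.range g) := by
      rw [himage]; exact ⟨a, ha, rfl⟩
    refine convexHull_mono ?_ h1
    rintro _ ⟨i, rfl⟩
    exact hg i trivial

/-- A finite-dimensional alternative of Gordan type for compact sets. -/
theorem IsCompact.exists_pos_functional_or_zero_mem {E : Type*} [NormedAddCommGroup E]
    [NormedSpace ℝ E] [FiniteDimensional ℝ E] {K : Set E} (hK : IsCompact K) :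
    (∃ φ : E →L[ℝ] ℝ, ∀ k ∈ K, 0 < φ k) ∨ (0 : E) ∈ convexHull ℝ K := by
  by_cases h0 : (0 : E) ∈ convexHull ℝ K
  · exact Or.inr h0
  · obtain ⟨φ, u, h1, h2⟩ := geometric_hahn_banach_point_closed (convex_convexHull ℝ K)
      hK.convexHull_of_finiteDimensional.isClosed h0
    refine Or.inl ⟨φ, fun k hk => ?_⟩
    have := h2 k (subset_convexHull ℝ K hk)
    rw [map_zero] at h1
    linarith

/-- A real symmetric bilinear form that is invariant under multiplication by `i` is the real part
of a Hermitian form. -/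
def HermForm.ofReal {V : Type*} [AddCommGroup V] [Module ℂ V] (β : V → V → ℝ)
    (hadd : ∀ x y z, β x (y + z) = β x y + β x z)
    (hsmul : ∀ x (r : ℝ) y, β x ((r : ℂ) • y) = r * β x y) (hsymm : ∀ x y, β y x = β x y)
    (hI : ∀ x y, β (Complex.I • x) (Complex.I • y) = β x y) : HermForm V where
  toFun x y := ⟨β x y, -β x (Complex.I • y)⟩
  add_right' x y z := by
    apply Complex.ext
    · simp [hadd]
    · simp [hadd]; ring
  smul_right' x c y := by
    have h1 : c • y = (c.re : ℂ) • y + (c.im : ℂ) • (Complex.I • y) := by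
      rw [smul_smul, ← add_smul, Complex.re_add_im]
    have h2 : Complex.I • c • y = (c.re : ℂ) • (Complex.I • y) + ((-c.im : ℝ) : ℂ) • y := by
      rw [h1, smul_add, smul_smul, smul_smul, smul_smul, smul_smul, ← add_smul, ← add_smul]
      congr 1
      push_cast
      linear_combination (c.im : ℂ) * Complex.I_sq
    apply Complex.ext
    · simp only [Complex.mul_re]
      rw [h1, hadd, hsmul, hsmul]; ring
    · simp only [Complex.mul_im]
      rw [h2, hadd, hsmul, hsmul]; ring
  conj_symm' x y := by
    apply Complex.ext
    · simpa using hsymm x y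
    · simp only [RCLike.star_def, Complex.conj_im, neg_neg]
      rw [← hI, smul_smul, Complex.I_mul_I]
      have := hsmul (Complex.I • y) (-1) x
      simp only [Complex.ofReal_neg, Complex.ofReal_one, neg_mul, one_mul] at this
      rw [this, hsymm]

section Gordan

variable {X U : Type*} [NormedAddCommGroup X] [InnerProductSpace ℂ X] [FiniteDimensional ℂ X]
  [NormedAddCommGroup U] [InnerProductSpace ℂ U] [FiniteDimensional ℂ U]

/-- The Hermitian operator `y ⟨x, ·⟩ + x ⟨y, ·⟩`. -/
noncomputable def symRankOne (x y : X) : X →L[ℂ] X :=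
  InnerProductSpace.rankOne ℂ y x + InnerProductSpace.rankOne ℂ x y

lemma symRankOne_apply (x y z : X) : symRankOne x y z = inner ℂ x z • y + inner ℂ y z • x := by
  simp [symRankOne]

lemma symRankOne_comm (x y : X) : symRankOne y x = symRankOne x y := add_comm _ _

lemma symRankOne_add (x y z : X) : symRankOne x (y + z) = symRankOne x y + symRankOne x z := by
  ext v; simp only [symRankOne_apply, inner_add_left, _root_.add_apply, smul_add, add_smul]; abel

lemma symRankOne_smul (x y : X) (r : ℝ) :
    symRankOne x ((r : ℂ) • y) = r • symRankOne x y := by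
  ext v
  simp only [symRankOne_apply, inner_smul_left, _root_.smul_apply, smul_add, Complex.conj_ofReal,
    ← Complex.coe_smul, smul_smul, mul_comm]

lemma symRankOne_I (x y : X) :
    symRankOne (Complex.I • x) (Complex.I • y) = symRankOne x y := by
  ext v
  simp only [symRankOne_apply, inner_smul_left, smul_smul, Complex.conj_I]
  congr 2 <;> linear_combination (-(1 : ℂ)) * inner ℂ _ v * Complex.I_sq

lemma continuous_symRankOne : Continuous fun a : X × X => symRankOne a.1 a.2 := by
  have h : Continuous fun a : X × X => InnerProductSpace.rankOne ℂ a.1 a.2 := by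
    have h := (ContinuousLinearMap.smulRightL ℂ X X).continuous₂
    exact h.comp (((innerSL ℂ).continuous.comp continuous_snd).prodMk continuous_fst)
  exact (h.comp continuous_swap).add h

lemma inner_symRankOne (x y z : X) :
    (inner ℂ z (symRankOne x y z)).re = 2 * (inner ℂ z y * inner ℂ x z).re := by
  rw [symRankOne_apply, inner_add_right, inner_smul_right, inner_smul_right, Complex.add_re,
    mul_comm (inner ℂ x z), ← inner_conj_symm y z, ← inner_conj_symm z x]
  simp only [Complex.mul_re, Complex.conj_re, Complex.conj_im]
  ring

/-- Either there is a strictly dissipative quadratic storage that is positive on `G`, or there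
is a finite family of trajectories with nonpositive total supply whose second moment does not
decrease. -/
theorem exists_strict_storage_or_family (M : X × U →ₗ[ℂ] X) (S : HermForm (X × U))
    (G : Submodule ℂ X) :
    (∃ P : HermForm X, (dissipation M S P).PosDef ∧ ∀ x ∈ G, x ≠ 0 → 0 < (P x x).re) ∨
    ∃ (N : ℕ) (f : Fin N → X × U), (∃ i, f i ≠ 0) ∧ ∑ i, (S (f i) (f i)).re ≤ 0 ∧
      (∀ z, 0 ≤ ∑ i, (inner ℂ z (M (f i)) * inner ℂ (f i).1 z).re) ∧
      (G = ⊥ → ∀ z, ∑ i, (inner ℂ z (M (f i)) * inner ℂ (f i).1 z).re = 0) := by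
  have : FiniteDimensional ℝ (X →L[ℂ] X) := FiniteDimensional.complexToReal _
  have : ProperSpace ((X × U) × G × ℂ) := FiniteDimensional.proper ℂ _
  -- A functional positive on the image of the sphere is a pair of a weight on the supply and a dual
  -- operator, which becomes `P`. The `ℂ` slot forces the weight to be positive, and the `G` slot
  -- forces `P` to be positive on `G`.
  let Ξ : (X × U) × G × ℂ → ℝ × (X →L[ℂ] X) := fun a =>
    ((S a.1 a.1).re + ‖a.2.2‖ ^ 2,
      symRankOne a.1.1 (M a.1) - (2⁻¹ : ℝ) • symRankOne (a.2.1 : X) (a.2.1 : X))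
  have hΞ : Continuous Ξ := by
    have hM : Continuous M := M.continuous_of_finiteDimensional
    have h1 := S.continuous_quad
    have h2 := continuous_symRankOne (X := X)
    refine ((h1.comp continuous_fst).add (by fun_prop)).prodMk
      ((h2.comp (f := fun a : (X × U) × G × ℂ => (a.1.1, M a.1)) (by fun_prop)).sub
      ((h2.comp (f := fun a : (X × U) × G × ℂ => ((a.2.1 : X), (a.2.1 : X)))
        (by fun_prop)).const_smul (2⁻¹ : ℝ)))
  have hhom : ∀ (r : ℝ) a, Ξ ((r : ℂ) • a) = r ^ 2 • Ξ a := fun r a => by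
    ext1
    · simp only [Ξ, Prod.smul_fst, Prod.smul_snd, S.quad_smul, norm_mul, Prod.smul_mk,
        Complex.norm_real, smul_eq_mul, Real.norm_eq_abs, mul_pow, sq_abs]
      ring
    · simp only [Ξ, Prod.smul_fst, Prod.smul_snd, Prod.smul_mk, map_smul, Submodule.coe_smul]
      have h1 : ∀ x y : X, symRankOne ((r : ℂ) • x) ((r : ℂ) • y) = r ^ 2 • symRankOne x y :=
        fun x y => by
          rw [symRankOne_smul, symRankOne_comm, symRankOne_smul, symRankOne_comm, smul_smul, sq]
      rw [h1, h1, smul_sub]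
      simp only [smul_smul]
      congr 2; ring
  have hK := (isCompact_sphere (0 : (X × U) × G × ℂ) 1).image hΞ
  rcases hK.exists_pos_functional_or_zero_mem with ⟨φ, hφ⟩ | h0
  · left
    have hpos : ∀ a, a ≠ 0 → 0 < φ (Ξ a) := fun a ha => by
      have hn : 0 < ‖a‖ := norm_pos_iff.2 ha
      have h1 := hφ _ ⟨((‖a‖⁻¹ : ℝ) : ℂ) • a, by simp [norm_smul, hn.ne'], rfl⟩
      rw [hhom, map_smul, smul_eq_mul] at h1
      exact pos_of_mul_pos_right h1 (by positivity)
    set α := φ (1, 0) with hα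
    have hα0 : 0 < α := by
      have := hpos (0, 0, 1) (by simp)
      simpa [Ξ, symRankOne] using this
    have hsplit : ∀ r T, φ (r, T) = α * r + φ (0, T) := fun r T => by
      have : ((r, T) : ℝ × (X →L[ℂ] X)) = r • (1, 0) + (0, T) := by simp
      rw [this, map_add, map_smul, smul_eq_mul, mul_comm]
    let φ₂ : (X →L[ℂ] X) →ₗ[ℝ] ℝ := φ.toLinearMap ∘ₗ LinearMap.inr ℝ ℝ (X →L[ℂ] X)
    have hφ₂ : ∀ T, φ (0, T) = φ₂ T := fun T => rfl
    -- The normalization makes `φ (Ξ (f, 0, 0))` equal to `α` times the dissipation of `P` at `f`.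
    let β : X → X → ℝ := fun x y => -(2 * α)⁻¹ * φ₂ (symRankOne x y)
    let P := HermForm.ofReal β (fun x y z => by simp only [β, symRankOne_add, map_add]; ring)
      (fun x r y => by simp only [β, symRankOne_smul, map_smul, smul_eq_mul]; ring)
      (fun x y => by simp only [β, symRankOne_comm])
      (fun x y => by simp only [β, symRankOne_I])
    have hP : ∀ x y, (P x y).re = -(2 * α)⁻¹ * φ₂ (symRankOne x y) := fun x y => rfl
    refine ⟨P, fun f hf => ?_, fun x hx hx0 => ?_⟩
    · have h1 := hpos (f, 0, 0) (by simpa using hf)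
      simp only [Ξ] at h1
      rw [hsplit, hφ₂] at h1
      simp only [symRankOne, norm_zero, ZeroMemClass.coe_zero, map_zero, add_zero, smul_zero,
        sub_zero, ne_eq, OfNat.ofNat_ne_zero, not_false_eq_true, zero_pow] at h1
      rw [dissipation_quad, hP]
      have h2 : 0 < α * ((S f f).re - 2 * (-(2 * α)⁻¹ * φ₂ (symRankOne f.1 (M f)))) := by
        have : α * ((S f f).re - 2 * (-(2 * α)⁻¹ * φ₂ (symRankOne f.1 (M f))))
          = α * (S f f).re + φ₂ (symRankOne f.1 (M f)) := by field_simp; ring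
        rw [this]; exact h1
      exact pos_of_mul_pos_right h2 hα0.le
    · have h1 := hpos (0, ⟨x, hx⟩, 0) (by simpa using hx0)
      simp only [Ξ] at h1
      rw [hsplit, hφ₂] at h1
      simp only [HermForm.zero_right, Complex.zero_re, norm_zero, ne_eq, OfNat.ofNat_ne_zero,
        not_false_eq_true, zero_pow, add_zero, mul_zero, Prod.fst_zero, map_zero, map_sub,
        map_smul, zero_add] at h1
      have h3 : symRankOne (0 : X) 0 = 0 := by simp [symRankOne]
      rw [h3, map_zero, smul_eq_mul] at h1
      rw [hP]
      have h2 : 0 < (2 * α)⁻¹ := by positivity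
      nlinarith
  · right
    rw [mem_convexHull_iff_exists_fintype] at h0
    obtain ⟨ι, _, w, k, hw0, hw1, hk, hsum⟩ := h0
    choose a ha hak using hk
    -- Quadratic homogeneity of `Ξ` absorbs the convex weights into the points.
    let b : ι → (X × U) × G × ℂ := fun i => ((√(w i) : ℝ) : ℂ) • a i
    have hb : ∑ i, Ξ (b i) = 0 := by
      rw [← hsum]
      refine Finset.sum_congr rfl fun i _ => ?_
      rw [hhom, Real.sq_sqrt (hw0 i), hak]
    have hb0 : ∃ i, b i ≠ 0 := by
      by_contra! h
      have : ∀ i, w i = 0 := fun i => by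
        have h1 := h i
        simp only [b, smul_eq_zero, Complex.ofReal_eq_zero] at h1
        rcases h1 with h1 | h1
        · exact (Real.sqrt_eq_zero (hw0 i)).1 h1
        · have h2 := ha i
          simp [h1] at h2
      simp [this] at hw1
    have hS : ∑ i, ((S (b i).1 (b i).1).re + ‖(b i).2.2‖ ^ 2) = 0 := by
      have := congrArg Prod.fst hb
      rwa [Prod.fst_sum] at this
    have hR : ∑ i, symRankOne (b i).1.1 (M (b i).1)
        = ∑ i, (2⁻¹ : ℝ) • symRankOne ((b i).2.1 : X) ((b i).2.1 : X) := by
      have := congrArg Prod.snd hb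
      rw [Prod.snd_sum] at this
      simp only [Ξ, Finset.sum_sub_distrib] at this
      exact sub_eq_zero.1 this
    have hquad : ∀ z : X, ∑ i, (inner ℂ z (M (b i).1) * inner ℂ (b i).1.1 z).re
        = 2⁻¹ * ∑ i, ‖inner ℂ z ((b i).2.1 : X)‖ ^ 2 := fun z => by
      have h1 := congrArg (fun T : X →L[ℂ] X => (inner ℂ z (T z)).re) hR
      simp only [_root_.sum_apply, inner_sum, Complex.re_sum, inner_symRankOne,
        _root_.smul_apply] at h1
      rw [← Finset.mul_sum] at h1
      have h2 : ∀ i, (inner ℂ z ((2⁻¹ : ℝ) • symRankOne ((b i).2.1 : X) ((b i).2.1 : X) z)).re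
          = ‖inner ℂ z ((b i).2.1 : X)‖ ^ 2 := fun i => by
        rw [← Complex.coe_smul, inner_smul_right, Complex.re_ofReal_mul, inner_symRankOne,
          ← inner_conj_symm ((b i).2.1 : X) z, Complex.mul_conj, Complex.ofReal_re,
          Complex.normSq_eq_norm_sq]
        ring
      rw [Finset.sum_congr rfl fun i _ => h2 i] at h1
      linarith
    have hsumS : ∑ i, (S (b i).1 (b i).1).re = - ∑ i, ‖(b i).2.2‖ ^ 2 := by
      rw [Finset.sum_add_distrib] at hS; linarith
    have hnn : 0 ≤ ∑ i, ‖(b i).2.2‖ ^ 2 := Finset.sum_nonneg fun i _ => by positivity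
    let e := (Fintype.equivFin ι).symm
    refine ⟨Fintype.card ι, fun i => (b (e i)).1, ?_, ?_, fun z => ?_, fun hG z => ?_⟩
    -- If all trajectories vanished, the supply balance would kill the scalar slots and the moment
    -- balance the `G` slots, so every `b i` would vanish.
    · by_contra! h
      have h1 : ∀ i, (b i).1 = 0 := fun i => by simpa using h (e.symm i)
      have h2 : ∑ i, ‖(b i).2.2‖ ^ 2 = 0 := by
        rw [Finset.sum_congr rfl (fun i _ => by rw [h1 i])] at hsumS
        simp at hsumS
        linarith
      obtain ⟨i, hi⟩ := hb0
      apply hi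
      have h3 : (b i).2.2 = 0 := by
        have := (Finset.sum_eq_zero_iff_of_nonneg fun i _ => by positivity).1 h2 i
          (Finset.mem_univ i)
        simpa using this
      have h4 : ((b i).2.1 : X) = 0 := by
        have h5 := hquad (b i).2.1
        rw [Finset.sum_congr rfl (fun i _ => by rw [h1 i])] at h5
        simp only [map_zero, inner_zero_right, Prod.fst_zero, zero_mul, Complex.zero_re,
          Finset.sum_const_zero, zero_eq_mul, inv_eq_zero, OfNat.ofNat_ne_zero, false_or] at h5
        have := (Finset.sum_eq_zero_iff_of_nonneg fun i _ => by positivity).1 h5 i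
          (Finset.mem_univ i)
        simpa using this
      ext1
      · exact h1 i
      ext1
      · simpa using h4
      · exact h3
    · rw [e.sum_comp (fun i => (S (b i).1 (b i).1).re), hsumS]
      linarith
    · rw [e.sum_comp (fun i => (inner ℂ z (M (b i).1) * inner ℂ (b i).1.1 z).re), hquad]
      positivity
    · rw [e.sum_comp (fun i => (inner ℂ z (M (b i).1) * inner ℂ (b i).1.1 z).re), hquad]
      have : ∀ i, ((b i).2.1 : X) = 0 := fun i => by
        have := (b i).2.1.2
        exact (Submodule.mem_bot ℂ).1 (hG.le this)
      simp [this]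

end Gordan

/-! ### Traces and the Lyapunov equation for accretive operators. -/

section Trace

variable {D : Type*} [NormedAddCommGroup D] [InnerProductSpace ℂ D] [FiniteDimensional ℂ D]

lemma HermForm.ofInner_posDef (V : Type*) [NormedAddCommGroup V] [InnerProductSpace ℂ V] :
    (HermForm.ofInner V).PosDef := fun x hx => by
  rw [HermForm.ofInner_quad]
  have := norm_pos_iff.2 hx
  positivity

/-- A Hermitian form is represented by an operator. -/
lemma HermForm.exists_operator (Q : HermForm D) :
    ∃ T : D →ₗ[ℂ] D, ∀ x y, inner ℂ x (T y) = Q x y := by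
  obtain ⟨T, hT⟩ := (ofInner_posDef D).exists_linear_rep (Q.toSesq LinearMap.id LinearMap.id)
  refine ⟨T, fun x y => ?_⟩
  have := hT y x
  rw [ofInner_apply, toSesq_apply] at this
  rw [← inner_conj_symm, this]
  exact Q.conj_symm x y

/-- The trace of a Hermitian form relative to the inner product. -/
noncomputable def HermForm.tr (Q : HermForm D) : ℝ :=
  ∑ i, (Q (stdOrthonormalBasis ℂ D i) (stdOrthonormalBasis ℂ D i)).re

lemma HermForm.tr_eq_trace (Q : HermForm D) {T : D →ₗ[ℂ] D}
    (hT : ∀ x y, inner ℂ x (T y) = Q x y) : Q.tr = (LinearMap.trace ℂ D T).re := by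
  rw [LinearMap.trace_eq_sum_inner T (stdOrthonormalBasis ℂ D), Complex.re_sum]
  simp [HermForm.tr, hT]

lemma HermForm.tr_eq_sum (Q : HermForm D) {ι : Type*} [Fintype ι] (b : OrthonormalBasis ι ℂ D) :
    Q.tr = ∑ i, (Q (b i) (b i)).re := by
  obtain ⟨T, hT⟩ := Q.exists_operator
  rw [Q.tr_eq_trace hT, LinearMap.trace_eq_sum_inner T b, Complex.re_sum]
  simp [hT]

/-- The identity is the sum of the projections onto `aᗮ` and onto the line of `a`; cyclicity of the
trace turns the first summand into the trace of the compressed operator. -/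
lemma HermForm.tr_split (Q : HermForm D) {a : D} (ha : ‖a‖ = 1) :
    Q.tr = (Q a a).re + (Q.comp (ℂ ∙ a)ᗮ.subtype).tr := by
  obtain ⟨T, hT⟩ := Q.exists_operator
  let π : D →ₗ[ℂ] (ℂ ∙ a)ᗮ := (ℂ ∙ a)ᗮ.orthogonalProjectionOnto.toLinearMap
  let ρ : D →ₗ[ℂ] D := (innerₛₗ ℂ a).smulRight a
  have hid : ∀ x, x = (π x : D) + ρ x := fun x => by
    have h1 := (ℂ ∙ a).starProjection_add_starProjection_orthogonal x
    rw [Submodule.starProjection_unit_singleton ℂ ha] at h1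
    conv_lhs => rw [← h1]
    rw [add_comm]; rfl
  have hsum : T = (T ∘ₗ (ℂ ∙ a)ᗮ.subtype) ∘ₗ π + T ∘ₗ ρ := by
    ext x
    conv_lhs => rw [hid x]
    simp
  have h1 : LinearMap.trace ℂ D (T ∘ₗ ρ) = Q a a := by
    have : T ∘ₗ ρ = (innerₛₗ ℂ a).smulRight (T a) := by ext x; simp [ρ]
    rw [this, LinearMap.trace_smulRight, ← hT]; rfl
  have h2 : (Q.comp (ℂ ∙ a)ᗮ.subtype).tr
      = (LinearMap.trace ℂ (ℂ ∙ a)ᗮ (π ∘ₗ T ∘ₗ (ℂ ∙ a)ᗮ.subtype)).re := by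
    refine HermForm.tr_eq_trace _ fun x y => ?_
    rw [comp_apply, ← hT]
    exact Submodule.inner_orthogonalProjectionOnto_eq_of_mem_left x _
  rw [Q.tr_eq_trace hT, hsum, map_add, Complex.add_re, h1, LinearMap.trace_comp_comm', h2]
  ring

end Trace

section Accretive

/-- All eigenvalues lie in the open right half plane. -/
def Antistable {D : Type*} [AddCommGroup D] [Module ℂ D] (F : D →ₗ[ℂ] D) : Prop :=
  ∀ (μ : ℂ) (v : D), v ≠ 0 → F v = μ • v → 0 < μ.re

variable {D : Type*} [NormedAddCommGroup D] [InnerProductSpace ℂ D] [FiniteDimensional ℂ D]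

/-- The Lyapunov equation for an accretive operator with spectrum in the open right half plane. -/
lemma exists_lyapunov_solution (F : D →ₗ[ℂ] D) (hF : ∀ v, 0 ≤ (inner ℂ v (F v)).re)
    (hev : Antistable F) (Q : HermForm D) :
    ∃ K : HermForm D, ∀ x y, K (F x) y + K x (F y) = Q x y := by
  let L : (D →ₗ[ℂ] D) →ₗ[ℂ] (D →ₗ[ℂ] D) :=
    { toFun := fun T => F.adjoint ∘ₗ T + T ∘ₗ F
      map_add' := fun T T' => by ext x; simp; abel
      map_smul' := fun c T => by ext x; simp }
  have hL : ∀ T x, L T x = F.adjoint (T x) + T (F x) := fun T x => rfl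
  -- In finite dimension, uniqueness gives existence. If `L T = 0`, then `T` intertwines `F` with
  -- `-F.adjoint`. An eigenvalue of `F` has positive real part, so its negative is not an eigenvalue
  -- of the accretive `F.adjoint`; hence `T` kills every generalized eigenspace.
  have hinj : Function.Injective L := by
    rw [← LinearMap.ker_eq_bot, LinearMap.ker_eq_bot']
    intro T hT
    have hT' : ∀ x, F.adjoint (T x) + T (F x) = 0 := fun x => by rw [← hL, hT]; rfl
    have hadj : ∀ μ : ℂ, 0 < μ.re → ∀ v, F.adjoint v + μ • v = 0 → v = 0 := fun μ hμ v hv => by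
      by_contra hne
      have h1 : inner ℂ v (F.adjoint v) + μ * inner ℂ v v = 0 := by
        rw [← inner_smul_right, ← inner_add_right, hv, inner_zero_right]
      rw [LinearMap.adjoint_inner_right] at h1
      have h2 := hF v
      rw [← inner_conj_symm, Complex.conj_re] at h2
      have h3 := congrArg Complex.re h1
      have h4 : inner ℂ v v = ((‖v‖ ^ 2 : ℝ) : ℂ) := by
        rw [inner_self_eq_norm_sq_to_K]; norm_cast
      rw [h4, Complex.add_re, Complex.re_mul_ofReal, Complex.zero_re] at h3
      have := norm_pos_iff.2 hne
      have : 0 < μ.re * ‖v‖ ^ 2 := by positivity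
      linarith
    have hker : ∀ μ : ℂ, Module.End.maxGenEigenspace F μ ≤ LinearMap.ker T := by
      intro μ
      by_cases hμ : 0 < μ.re
      · have key : ∀ k : ℕ, ∀ x, ((F - algebraMap ℂ (Module.End ℂ D) μ) ^ k) x = 0 → T x = 0 := by
          intro k
          induction k with
          | zero => intro x hx; simp at hx; simp [hx]
          | succ k ih =>
            intro x hx
            rw [pow_succ, Module.End.mul_apply] at hx
            have h1 := ih _ hx
            rw [LinearMap.sub_apply, Module.algebraMap_end_apply, map_sub, map_smul] at h1
            apply hadj μ hμ
            rw [← sub_eq_zero.1 h1, hT']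
        intro x hx
        obtain ⟨k, hk⟩ := Module.End.mem_maxGenEigenspace F μ x |>.1 hx
        refine key k x ?_
        rw [Algebra.algebraMap_eq_smul_one]; exact hk
      · intro x hx
        obtain ⟨k, hk⟩ := Module.End.mem_maxGenEigenspace F μ x |>.1 hx
        have hinj : Function.Injective (F - μ • (1 : Module.End ℂ D)) := by
          rw [← LinearMap.ker_eq_bot, LinearMap.ker_eq_bot']
          intro v hv
          by_contra hne
          exact hμ (hev μ v hne (by simpa [sub_eq_zero] using hv))
        have h0 : x = 0 := by
          apply hinj.iterate k
          rw [← Module.End.coe_pow, hk, map_zero]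
        rw [h0]; exact Submodule.zero_mem _
    have h1 : ⊤ ≤ LinearMap.ker T := by
      rw [← Module.End.iSup_maxGenEigenspace_eq_top F]
      exact iSup_le hker
    exact LinearMap.ker_eq_top.1 (top_le_iff.1 h1)
  obtain ⟨T₀, hT₀⟩ := Q.exists_operator
  obtain ⟨T, hT⟩ := LinearMap.injective_iff_surjective.1 hinj T₀
  have key : ∀ x y, inner ℂ (F x) (T y) + inner ℂ x (T (F y)) = Q x y := fun x y => by
    rw [← hT₀, ← hT, hL, inner_add_right, LinearMap.adjoint_inner_right]
  -- `T` need not be self-adjoint; its Hermitian part solves the same equation because `Q` is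
  -- Hermitian.
  let b : SesqForm D D := (HermForm.ofInner D).toSesq LinearMap.id T
  refine ⟨(2⁻¹ : ℝ) • b.herm, fun x y => ?_⟩
  have h2 := key y x
  have h3 : star (Q y x) = Q x y := Q.conj_symm x y
  rw [← h2, star_add] at h3
  have h1 := key x y
  simp only [HermForm.smul_apply, SesqForm.herm_apply, b, HermForm.toSesq_apply,
    HermForm.ofInner_apply, LinearMap.id_apply]
  push_cast
  linear_combination (2⁻¹ : ℂ) * h1 + (2⁻¹ : ℂ) * h3

/-- The trace of a Lyapunov derivative is positive. -/
lemma tr_pos_of_lyapunov [Nontrivial D] (F : D →ₗ[ℂ] D) (hF : ∀ v, 0 ≤ (inner ℂ v (F v)).re)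
    (hev : Antistable F) {Q K : HermForm D}
    (hK : ∀ x y, K (F x) y + K x (F y) = Q x y) (hKpos : K.PosDef) : 0 < Q.tr := by
  obtain ⟨T, hT⟩ := K.exists_operator
  have hsymm : T.IsSymmetric := fun x y => by
    rw [hT, ← inner_conj_symm, hT]; exact K.conj_symm x y
  let b := hsymm.eigenvectorBasis rfl
  let κ := hsymm.eigenvalues rfl
  have hb : ∀ i, T (b i) = (κ i : ℂ) • b i := hsymm.apply_eigenvectorBasis rfl
  have hKb : ∀ i y, K (b i) y = (κ i : ℂ) * inner ℂ (b i) y := fun i y => by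
    rw [← hT, ← hsymm, hb, inner_smul_left, Complex.conj_ofReal]
  have hκ : ∀ i, 0 < κ i := fun i => by
    have h1 := hKpos (b i) (b.orthonormal.ne_zero i)
    rw [hKb, Complex.re_ofReal_mul, inner_self_eq_norm_sq_to_K, b.orthonormal.1 i] at h1
    simpa using h1
  have hQ : ∀ i, (Q (b i) (b i)).re = 2 * κ i * (inner ℂ (b i) (F (b i))).re := fun i => by
    rw [← hK, Complex.add_re, K.re_symm, hKb, Complex.re_ofReal_mul]; ring
  rw [Q.tr_eq_sum b]
  have hnn : ∀ i, 0 ≤ (Q (b i) (b i)).re := fun i => by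
    rw [hQ]; exact mul_nonneg (by linarith [hκ i]) (hF _)
  refine lt_of_le_of_ne (Finset.sum_nonneg fun i _ => hnn i) fun h0 => ?_
  have hz : ∀ i, (inner ℂ (b i) (F (b i))).re = 0 := fun i => by
    have := (Finset.sum_eq_zero_iff_of_nonneg fun i _ => hnn i).1 h0.symm i (Finset.mem_univ i)
    rw [hQ] at this
    have h1 := hκ i
    rcases mul_eq_zero.1 this with h2 | h2
    · linarith
    · exact h2
  let H : HermForm D := ((HermForm.ofInner D).toSesq LinearMap.id F).herm
  have hH : ∀ x, (H x x).re = 2 * (inner ℂ x (F x)).re := fun x => by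
    simp only [H, SesqForm.herm_apply, HermForm.toSesq_apply, LinearMap.id_apply,
      HermForm.ofInner_apply, Complex.add_re, RCLike.star_def, Complex.conj_re]
    ring
  have hpsd : H.PosSemidef := fun x => by rw [hH]; linarith [hF x]
  -- The null vectors of a semidefinite form are a subspace, so vanishing on an eigenbasis of `K`
  -- propagates to all of `D`, against an eigenvector of `F`.
  have htop : hpsd.null = ⊤ := by
    rw [eq_top_iff, ← b.toBasis.span_eq, Submodule.span_le]
    rintro _ ⟨i, rfl⟩
    change (H _ _).re = 0
    rw [hH, b.coe_toBasis, hz, mul_zero]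
  obtain ⟨μ, hμ⟩ := Module.End.exists_eigenvalue F
  obtain ⟨v, hv⟩ := hμ.exists_hasEigenvector
  have h1 : (H v v).re = 0 := by
    have : v ∈ hpsd.null := by rw [htop]; trivial
    exact this
  rw [hH, hv.apply_eq_smul, inner_smul_right, inner_self_eq_norm_sq_to_K] at h1
  have h2 := hev μ v hv.2 hv.apply_eq_smul
  have h3 := norm_pos_iff.2 hv.2
  have h4 : (μ * ((‖v‖ : ℂ)) ^ 2).re = μ.re * ‖v‖ ^ 2 := by
    rw [← Complex.ofReal_pow, Complex.re_mul_ofReal]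
  have h5 : 0 < μ.re * ‖v‖ ^ 2 := by positivity
  rw [← h4] at h5
  have h6 : 2 * (μ * ((‖v‖ : ℂ)) ^ 2).re = 0 := h1
  linarith

end Accretive

/-! ### Second moments and the exclusion of families with nonpositive supply. -/

section Moments

variable {X U : Type} [NormedAddCommGroup X] [InnerProductSpace ℂ X] [FiniteDimensional ℂ X]
  [NormedAddCommGroup U] [InnerProductSpace ℂ U] [FiniteDimensional ℂ U]

/-- The derivative of the second moment of a family of trajectories in direction `z`. -/
noncomputable def momentForm {D : Type*} [NormedAddCommGroup D] [InnerProductSpace ℂ D]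
    (M : X × U →ₗ[ℂ] X) (Φ : D →ₗ[ℂ] X × U) (z : X) : HermForm D :=
  (SesqForm.ofDual (innerₛₗ ℂ z ∘ₗ LinearMap.fst ℂ X U ∘ₗ Φ) (innerₛₗ ℂ z ∘ₗ M ∘ₗ Φ)).herm

lemma momentForm_quad {D : Type*} [NormedAddCommGroup D] [InnerProductSpace ℂ D]
    (M : X × U →ₗ[ℂ] X) (Φ : D →ₗ[ℂ] X × U) (z : X) (a : D) :
    (momentForm M Φ z a a).re = 2 * (inner ℂ z (M (Φ a)) * inner ℂ (Φ a).1 z).re := by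
  have h : momentForm M Φ z a a = star (inner ℂ z (Φ a).1) * inner ℂ z (M (Φ a))
      + star (star (inner ℂ z (Φ a).1) * inner ℂ z (M (Φ a))) := rfl
  have h2 : star (inner ℂ z (Φ a).1) = inner ℂ (Φ a).1 z := inner_conj_symm _ _
  rw [h, h2, Complex.add_re, mul_comm (inner ℂ z _)]
  simp only [RCLike.star_def, Complex.conj_re]
  ring

/-- Antistable families of trajectories have positive definite stored supply. -/
def AntistablePositive (M : X × U →ₗ[ℂ] X) (S : HermForm (X × U)) : Prop :=
  ∀ (D : Type) [NormedAddCommGroup D] [InnerProductSpace ℂ D] [FiniteDimensional ℂ D]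
    (F : D →ₗ[ℂ] D) (Φ : D →ₗ[ℂ] X × U) (K : HermForm D), Antistable F →
    (∀ a, M (Φ a) = (Φ (F a)).1) → (∀ a b, K (F a) b + K a (F b) = S (Φ a) (Φ b)) →
    (∀ a, (Φ a).1 = 0 → a = 0) → K.PosDef

/-- The operator driving a family without stationary directions. -/
lemma exists_generator {D : Type*} [NormedAddCommGroup D] [InnerProductSpace ℂ D]
    [FiniteDimensional ℂ D] (M : X × U →ₗ[ℂ] X) (Φ : D →ₗ[ℂ] X × U)
    (hinj : ∀ a, (Φ a).1 = 0 → a = 0) (hW : ∀ z, 0 ≤ (momentForm M Φ z).tr) :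
    ∃ F : D →ₗ[ℂ] D, (∀ a, M (Φ a) = (Φ (F a)).1) ∧ (∀ v, 0 ≤ (inner ℂ v (F v)).re) ∧
      ((∀ z, (momentForm M Φ z).tr = 0) → ∀ v, (inner ℂ v (F v)).re = 0) := by
  let Xm : D →ₗ[ℂ] X := LinearMap.fst ℂ X U ∘ₗ Φ
  let Ym : D →ₗ[ℂ] X := M ∘ₗ Φ
  have htr : ∀ z, (momentForm M Φ z).tr = 2 * (inner ℂ (Ym.adjoint z) (Xm.adjoint z)).re := by
    intro z
    let b := stdOrthonormalBasis ℂ D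
    rw [HermForm.tr_eq_sum _ b, ← b.sum_inner_mul_inner, Complex.re_sum, Finset.mul_sum]
    refine Finset.sum_congr rfl fun i _ => ?_
    rw [momentForm_quad, LinearMap.adjoint_inner_left, LinearMap.adjoint_inner_right]
    rfl
  let N : D →ₗ[ℂ] D := Xm.adjoint ∘ₗ Xm
  have hN : Function.Injective N := by
    rw [← LinearMap.ker_eq_bot, LinearMap.ker_eq_bot']
    intro a ha
    apply hinj
    have h1 : inner ℂ (Xm a) (Xm a) = 0 := by
      rw [← LinearMap.adjoint_inner_right]
      change inner ℂ a (N a) = 0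
      rw [ha, inner_zero_right]
    exact inner_self_eq_zero.1 h1
  have hsurj : ∀ v, ∃ z, Xm.adjoint z = v := fun v => by
    obtain ⟨a, ha⟩ := LinearMap.injective_iff_surjective.1 hN v
    exact ⟨Xm a, ha⟩
  -- If `Xm.adjoint z = 0`, the moment derivative at `z' + t z` is affine in `t`; being nonnegative,
  -- it has slope zero. This kernel inclusion says that the range of `Ym` lies in that of `Xm`,
  -- which gives the factorization `Ym = Xm ∘ F`.
  have hker : ∀ z, Xm.adjoint z = 0 → Ym.adjoint z = 0 := fun z hz => by
    obtain ⟨z', hz'⟩ := hsurj (Ym.adjoint z)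
    have h1 : ∀ t : ℝ, 0 ≤ (inner ℂ (Ym.adjoint z') (Ym.adjoint z)).re + t * ‖Ym.adjoint z‖ ^ 2 :=
      fun t => by
        have h2 := hW (z' + (t : ℂ) • z)
        rw [htr, map_add, map_add, map_smul, map_smul, hz, smul_zero, add_zero, hz',
          inner_add_left, inner_smul_left, Complex.add_re, inner_self_eq_norm_sq_to_K] at h2
        have h3 : ((starRingEnd ℂ) (t : ℂ) * ((‖Ym.adjoint z‖ : ℂ)) ^ 2).re
            = t * ‖Ym.adjoint z‖ ^ 2 := by
          rw [Complex.conj_ofReal, ← Complex.ofReal_pow, ← Complex.ofReal_mul, Complex.ofReal_re]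
        have h4 : 0 ≤ 2 * ((inner ℂ (Ym.adjoint z') (Ym.adjoint z)).re
            + ((starRingEnd ℂ) (t : ℂ) * ((‖Ym.adjoint z‖ : ℂ)) ^ 2).re) := h2
        rw [h3] at h4
        linarith
    by_contra hne
    have hpos := norm_pos_iff.2 hne
    set c := (inner ℂ (Ym.adjoint z') (Ym.adjoint z)).re
    have h5 := h1 (-(c + 1) / ‖Ym.adjoint z‖ ^ 2)
    rw [div_mul_cancel₀ _ (by positivity)] at h5
    linarith
  let F : D →ₗ[ℂ] D := (LinearEquiv.ofInjectiveEndo N hN).symm.toLinearMap ∘ₗ Xm.adjoint ∘ₗ Ym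
  have hNF : ∀ a, Xm.adjoint (Xm (F a)) = Xm.adjoint (Ym a) := fun a =>
    (LinearEquiv.ofInjectiveEndo N hN).apply_symm_apply _
  have hXF : ∀ a, Ym a = Xm (F a) := fun a => by
    have h1 : Xm.adjoint (Ym a - Xm (F a)) = 0 := by rw [map_sub, hNF, sub_self]
    have h2 := hker _ h1
    rw [← sub_eq_zero, ← inner_self_eq_zero (𝕜 := ℂ)]
    nth_rewrite 2 [sub_eq_add_neg]
    rw [inner_add_right, inner_neg_right, ← LinearMap.adjoint_inner_left,
      ← LinearMap.adjoint_inner_left, h1, h2]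
    simp
  have hquad : ∀ z, (momentForm M Φ z).tr
      = 2 * (inner ℂ (Xm.adjoint z) (F (Xm.adjoint z))).re := fun z => by
    have h1 : inner ℂ (Ym.adjoint z) (Xm.adjoint z)
        = inner ℂ (Xm.adjoint z) (F (Xm.adjoint z)) := by
      rw [LinearMap.adjoint_inner_left, hXF, ← LinearMap.adjoint_inner_left]
    rw [htr, h1]
  refine ⟨F, hXF, fun v => ?_, fun h v => ?_⟩
  · obtain ⟨z, rfl⟩ := hsurj v
    have := hW z
    rw [hquad] at this
    linarith
  · obtain ⟨z, rfl⟩ := hsurj v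
    have := h z
    rw [hquad] at this
    linarith

/-- Total supply of a nontrivial family whose second moment does not decrease. -/
theorem tr_supply_pos {M : X × U →ₗ[ℂ] X} {S : HermForm (X × U)} (hreg : RegularSupply S)
    (hω : ∀ (ω : ℝ) f, detune M ω f = 0 → f ≠ 0 → 0 < (S f f).re) (n : ℕ) :
    ∀ (D : Type) [NormedAddCommGroup D] [InnerProductSpace ℂ D] [FiniteDimensional ℂ D]
      (Φ : D →ₗ[ℂ] X × U), Module.finrank ℂ D = n →
      (∀ z, 0 ≤ (momentForm M Φ z).tr) →
      ((∀ z, (momentForm M Φ z).tr = 0) ∨ AntistablePositive M S) → Φ ≠ 0 →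
      0 < (S.comp Φ).tr := by
  induction n with
  | zero =>
    intro D _ _ _ Φ hn _ _ hΦ
    have := Module.finrank_zero_iff.1 hn
    exact absurd (by ext x <;> simp [Subsingleton.elim x 0]) hΦ
  | succ n ih =>
    intro D _ _ _ Φ hn hW hor hΦ
    -- A pure input or a pure oscillation contributes nothing to the moment derivative and has
    -- positive supply unless `Φ a = 0`; such a direction is split off orthogonally. When none is
    -- left, the family has a generator.
    by_cases hex : ∃ a : D, a ≠ 0 ∧ ((Φ a).1 = 0 ∨ ∃ ω : ℝ, detune M ω (Φ a) = 0)
    · obtain ⟨a', ha', hor'⟩ := hex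
      obtain ⟨a, ha, hora⟩ : ∃ a : D, ‖a‖ = 1 ∧ ((Φ a).1 = 0 ∨ ∃ ω : ℝ, detune M ω (Φ a) = 0) := by
        refine ⟨((‖a'‖⁻¹ : ℝ) : ℂ) • a', by simp [norm_smul, norm_ne_zero_iff.2 ha'], ?_⟩
        rcases hor' with h | ⟨ω, h⟩
        · left; rw [map_smul, Prod.smul_fst, h, smul_zero]
        · right; exact ⟨ω, by rw [map_smul, map_smul, h, smul_zero]⟩
      have ha0 : a ≠ 0 := fun h => by simp [h] at ha
      have hzero : ∀ z, (momentForm M Φ z a a).re = 0 := fun z => by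
        rw [momentForm_quad]
        rcases hora with h | ⟨ω, h⟩
        · simp [h]
        · rw [detune_apply, sub_eq_zero] at h
          rw [h, inner_smul_right, mul_assoc, ← inner_conj_symm (Φ a).1 z, Complex.mul_conj]
          simp
      have hSa : 0 ≤ (S (Φ a) (Φ a)).re ∧ (Φ a ≠ 0 → 0 < (S (Φ a) (Φ a)).re) := by
        by_cases h0 : Φ a = 0
        · simp [h0]
        have : 0 < (S (Φ a) (Φ a)).re := by
          rcases hora with h | ⟨ω, h⟩
          · have h1 : Φ a = (0, (Φ a).2) := Prod.ext h rfl
            have := hreg (Φ a).2 (fun h2 => h0 (by rw [h1, h2]; rfl))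
            rwa [← h1] at this
          · exact hω ω _ h h0
        exact ⟨this.le, fun _ => this⟩
      let D' := (ℂ ∙ a)ᗮ
      let Φ' : D' →ₗ[ℂ] X × U := Φ ∘ₗ D'.subtype
      have hmom : ∀ z, (momentForm M Φ z).tr = (momentForm M Φ' z).tr := fun z => by
        rw [HermForm.tr_split _ ha, hzero, zero_add]; rfl
      have hdim : Module.finrank ℂ D' = n := by
        have := Submodule.finrank_add_finrank_orthogonal (ℂ ∙ a)
        rw [finrank_span_singleton ha0, hn] at this
        exact Nat.add_left_cancel (this.trans (add_comm _ _))
      rw [HermForm.tr_split _ ha]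
      have hrest : Φ' ≠ 0 → 0 < ((S.comp Φ).comp (ℂ ∙ a)ᗮ.subtype).tr := fun h =>
        ih D' Φ' hdim (fun z => by rw [← hmom]; exact hW z)
          (hor.imp_left fun h z => by rw [← hmom]; exact h z) h
      by_cases hΦ' : Φ' = 0
      · have h1 : ((S.comp Φ).comp (ℂ ∙ a)ᗮ.subtype).tr = 0 := by
          have : ∀ x : D', Φ (x : D) = 0 := fun x => LinearMap.congr_fun hΦ' x
          unfold HermForm.tr
          exact Finset.sum_eq_zero fun i _ => by simp [this]
        have h2 : Φ a ≠ 0 := fun h0 => hΦ (by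
          ext1 x
          have h3 := (ℂ ∙ a).starProjection_add_starProjection_orthogonal x
          rw [← h3, map_add, Submodule.starProjection_unit_singleton ℂ ha, map_smul, h0, smul_zero,
            zero_add]
          exact LinearMap.congr_fun hΦ' _)
        rw [h1, add_zero]
        exact hSa.2 h2
      · have := hrest hΦ'
        have := hSa.1
        rw [HermForm.comp_apply]
        linarith
    · push Not at hex
      have hinj : ∀ a, (Φ a).1 = 0 → a = 0 := fun a ha => by
        by_contra hne
        exact (hex a hne).1 ha
      obtain ⟨F, hMF, hacc, hskew⟩ := exists_generator M Φ hinj hW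
      have hre : ∀ (μ : ℂ) (v : D), F v = μ • v → (inner ℂ v (F v)).re = μ.re * ‖v‖ ^ 2 := by
        intro μ v hv
        have h4 : inner ℂ v v = ((‖v‖ ^ 2 : ℝ) : ℂ) := by
          rw [inner_self_eq_norm_sq_to_K]; norm_cast
        rw [hv, inner_smul_right, h4, Complex.re_mul_ofReal]
      -- Accretivity gives `0 ≤ μ.re`; an imaginary eigenvalue would yield a pure oscillation, which
      -- is excluded by `hex`.
      have hanti : Antistable F := fun μ v hv hμ => by
        have h1 := hacc v
        rw [hre μ v hμ] at h1
        have h2 : 0 < ‖v‖ ^ 2 := by have := norm_pos_iff.2 hv; positivity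
        have h3 : 0 ≤ μ.re := by
          by_contra h
          push Not at h
          nlinarith
        refine lt_of_le_of_ne h3 fun h0 => ?_
        refine (hex v hv).2 μ.im ?_
        rw [detune_apply, hMF, hμ, map_smul, Prod.smul_fst, ← sub_smul]
        have : μ - (μ.im : ℂ) * Complex.I = 0 := by
          apply Complex.ext <;> simp [← h0]
        rw [this, zero_smul]
      have : Nontrivial D := by
        rw [← Module.finrank_pos_iff (R := ℂ), hn]; omega
      -- With constant second moment the generator is skew and cannot be antistable. Otherwise the
      -- stored supply `K` is positive definite, and its Lyapunov derivative, the supply, has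
      -- positive trace.
      rcases hor with h0 | hpos
      · exfalso
        obtain ⟨μ, hμ⟩ := Module.End.exists_eigenvalue F
        obtain ⟨v, hv⟩ := hμ.exists_hasEigenvector
        have h1 := hskew h0 v
        rw [hre μ v hv.apply_eq_smul] at h1
        have h2 := hanti μ v hv.2 hv.apply_eq_smul
        have h3 := norm_pos_iff.2 hv.2
        have : 0 < μ.re * ‖v‖ ^ 2 := by positivity
        linarith
      · obtain ⟨K, hK⟩ := exists_lyapunov_solution F hacc hanti (S.comp Φ)
        exact tr_pos_of_lyapunov F hacc hanti hK (hpos D F Φ K hanti hMF hK hinj)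

/-- The terminal step: a strictly dissipative storage. -/
theorem exists_strict_storage {M : X × U →ₗ[ℂ] X} {S : HermForm (X × U)} (hreg : RegularSupply S)
    (hω : ∀ (ω : ℝ) f, detune M ω f = 0 → f ≠ 0 → 0 < (S f f).re) (G : Submodule ℂ X)
    (hG : G = ⊥ ∨ AntistablePositive M S) :
    ∃ P : HermForm X, (dissipation M S P).PosDef ∧ ∀ x ∈ G, x ≠ 0 → 0 < (P x x).re := by
  rcases exists_strict_storage_or_family M S G with h | ⟨N, f, hne, hS, hW, hW0⟩
  · exact h
  · exfalso
    let Φ : EuclideanSpace ℂ (Fin N) →ₗ[ℂ] X × U :=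
      Fintype.linearCombination ℂ f ∘ₗ (WithLp.linearEquiv 2 ℂ (Fin N → ℂ)).toLinearMap
    let b := EuclideanSpace.basisFun (Fin N) ℂ
    have hΦ : ∀ i, Φ (b i) = f i := fun i => by
      simp [Φ, b, Fintype.linearCombination_apply]
    have hmom : ∀ z, (momentForm M Φ z).tr
        = 2 * ∑ i, (inner ℂ z (M (f i)) * inner ℂ (f i).1 z).re := fun z => by
      rw [HermForm.tr_eq_sum _ b, Finset.mul_sum]
      simp only [momentForm_quad, hΦ]
    have h1 := tr_supply_pos hreg hω _ _ Φ rfl (fun z => by rw [hmom]; linarith [hW z])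
      (hG.imp_left fun h z => by rw [hmom, hW0 h z, mul_zero]) (by
        obtain ⟨i, hi⟩ := hne
        intro h0
        apply hi
        rw [← hΦ, h0]; rfl)
    rw [HermForm.tr_eq_sum _ b] at h1
    simp only [HermForm.comp_apply, hΦ] at h1
    linarith

end Moments

/-! ### A quadratic storage without sign, from the frequency bound. -/

section Storage

variable {X U : Type} [NormedAddCommGroup X] [InnerProductSpace ℂ X] [FiniteDimensional ℂ X]
  [NormedAddCommGroup U] [InnerProductSpace ℂ U] [FiniteDimensional ℂ U]

lemma dissipation_dissipation (M : X × U →ₗ[ℂ] X) (S : HermForm (X × U)) (P₀ P : HermForm X)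
    (f g : X × U) :
    dissipation M (dissipation M S P₀) P f g = dissipation M S (P₀ + P) f g := by
  simp only [dissipation_apply, HermForm.add_apply]; ring

lemma RegularSupply.dissipation {S : HermForm (X × U)} (h : RegularSupply S)
    (M : X × U →ₗ[ℂ] X) (P : HermForm X) : RegularSupply (dissipation M S P) := fun u hu => by
  rw [dissipation_quad]
  simpa using h u hu

/-- `P f.1 f.1` is real, so `M f` may be replaced by the detuned residual inside `Re (P f.1 (M f))`.
The change of supply is then of the order allowed by the bound. -/
lemma FrequencyBound.dissipation {M : X × U →ₗ[ℂ] X} {S : HermForm (X × U)}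
    (h : FrequencyBound M S) (P : HermForm X) : FrequencyBound M (dissipation M S P) := fun R => by
  obtain ⟨C, hC, h⟩ := h R
  obtain ⟨c, hc, hP⟩ := P.exists_bound
  refine ⟨C + 2 * c, by positivity, fun ω hω f => ?_⟩
  have h1 := h ω hω f
  have h2 : (P f.1 (M f)).re = (P f.1 (detune M ω f)).re := by
    rw [detune_apply, P.sub_right, P.smul_right, P.self_eq f.1]
    simp
  have h3 : (P f.1 (detune M ω f)).re ≤ c * ‖f‖ * ‖detune M ω f‖ :=
    (Complex.re_le_norm _).trans ((hP _ _).trans (by gcongr; exact norm_fst_le f))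
  rw [dissipation_quad, h2]
  nlinarith

/-- Splitting off an uncontrollable equilibrium direction. -/
lemma exists_split_data {M : X × U →ₗ[ℂ] X} {S : HermForm (X × U)}
    (hS : ∀ g, M g = 0 → 0 ≤ (S g g).re) {f : X × U} (hf : M f = 0)
    (hfr : f.1 ∉ LinearMap.range M) :
    ∃ (η : X →ₗ[ℂ] ℂ) (e : X × U) (p : X →ₗ[ℂ] LinearMap.ker η),
      (∀ f, η (M f) = 0) ∧ M e = 0 ∧ η e.1 = 1 ∧ (∀ g, M g = 0 → η g.1 = 0 → S e g = 0) ∧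
      (∀ x, (p x : X) = x - η x • e.1) ∧
      (∀ f, ((compress M _ p f : LinearMap.ker η) : X) = M (inclTraj U _ f)) ∧
      Module.finrank ℂ (LinearMap.ker η) < Module.finrank ℂ X := by
  obtain ⟨η₀, hη₀, hle⟩ := Submodule.exists_le_ker_of_notMem hfr
  set η : X →ₗ[ℂ] ℂ := (η₀ f.1)⁻¹ • η₀ with hη
  have hηM : ∀ f, η (M f) = 0 := fun f => by
    have : η₀ (M f) = 0 := hle ⟨f, rfl⟩
    simp [hη, this]
  have hηf : η f.1 = 1 := by simp [hη, hη₀]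
  obtain ⟨e, he, hηe, heS⟩ := exists_normalized_equilibrium M S η hf hηf hS
  let p₀ : X →ₗ[ℂ] X := LinearMap.id - (LinearMap.toSpanSingleton ℂ X e.1) ∘ₗ η
  have hp₀ : ∀ x, p₀ x = x - η x • e.1 := fun x => rfl
  let p : X →ₗ[ℂ] LinearMap.ker η := p₀.codRestrict _ fun x => by
    rw [LinearMap.mem_ker, hp₀, map_sub, map_smul, hηe, smul_eq_mul, mul_one, sub_self]
  refine ⟨η, e, p, hηM, he, hηe, heS, fun x => rfl, fun f => ?_, ?_⟩
  · change p₀ (M _) = _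
    rw [hp₀, hηM, zero_smul, sub_zero]
  · apply Submodule.finrank_lt
    intro h
    have h1 : e.1 ∈ LinearMap.ker η := by rw [h]; trivial
    rw [LinearMap.mem_ker, hηe] at h1
    exact one_ne_zero h1

lemma detune_compress {M : X × U →ₗ[ℂ] X} {Y : Submodule ℂ X} {p : X →ₗ[ℂ] Y}
    (h : ∀ f, ((compress M Y p f : Y) : X) = M (inclTraj U Y f)) (ω : ℝ) (f : Y × U) :
    ((detune (compress M Y p) ω f : Y) : X) = detune M ω (inclTraj U Y f) := by
  rw [detune_apply, detune_apply, Submodule.coe_sub, h]; rfl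

lemma FrequencyBound.compress {M : X × U →ₗ[ℂ] X} {S : HermForm (X × U)}
    (hM : FrequencyBound M S) {Y : Submodule ℂ X} {p : X →ₗ[ℂ] Y}
    (h : ∀ f, ((compress M Y p f : Y) : X) = M (inclTraj U Y f)) :
    FrequencyBound (_root_.compress M Y p) (S.comp (inclTraj U Y)) := fun R => by
  obtain ⟨C, hC, hb⟩ := hM R
  refine ⟨C, hC, fun ω hω f => ?_⟩
  have h1 := hb ω hω (inclTraj U Y f)
  rw [← detune_compress h] at h1
  exact h1

lemma RegularSupply.comp_inclTraj {S : HermForm (X × U)} (h : RegularSupply S)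
    (Y : Submodule ℂ X) : RegularSupply (S.comp (inclTraj U Y)) := fun u hu => h u hu

/-- After a shift of the supply the lossless equilibria store positive energy. -/
lemma exists_shift_pos {M : X × U →ₗ[ℂ] X} {S : HermForm (X × U)} (hreg : RegularSupply S)
    (hS : ∀ g, M g = 0 → 0 ≤ (S g g).re) :
    ∃ P₀ : HermForm X, ∀ e d, IsLossless M S e → M d = e.1 → e ≠ 0 →
      0 < (dissipation M S P₀ e d).re := by
  obtain ⟨J, hJ⟩ := exists_pseudoInverse M
  let E₀ := losslessSpace hS
  let ι : E₀ →ₗ[ℂ] X × U := E₀.subtype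
  let N : HermForm E₀ := (HermForm.ofInner X).comp (LinearMap.fst ℂ X U ∘ₗ ι)
  have hN : N.PosDef := fun e he => by
    apply HermForm.ofInner_posDef
    intro h0
    apply he
    have h1 : ι e = (0, (ι e).2) := Prod.ext h0 rfl
    have h2 : (S (ι e) (ι e)).re = 0 := e.2.2
    have h3 : (ι e).2 = 0 := by
      by_contra hne
      have := hreg _ hne
      rw [← h1, h2] at this
      exact lt_irrefl _ this
    have h4 : ι e = 0 := by rw [h1, h3]; rfl
    exact Subtype.ext h4
  obtain ⟨c, hc, hlow⟩ := hN.exists_lower_bound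
  obtain ⟨C, hC, hbd⟩ := S.exists_bound
  let T := LinearMap.toContinuousLinearMap (J ∘ₗ LinearMap.fst ℂ X U)
  have hT : ∀ f : X × U, ‖J f.1‖ ≤ ‖T‖ * ‖f‖ := T.le_opNorm
  have hT0 : 0 ≤ ‖T‖ := T.opNorm_nonneg
  -- On lossless equilibria regularity gives `c * ‖e‖ ^ 2 ≤ ‖e.1‖ ^ 2`, so a sufficiently negative
  -- multiple of the squared state norm outweighs the possibly negative `S e d`.
  refine ⟨(-(C * ‖T‖ / c + 1)) • HermForm.ofInner X, fun e d he hd hne => ?_⟩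
  have h1 : S e d = S e (J e.1) := by
    have := he.apply_eq_zero hS (g := J e.1 - d) (by rw [map_sub, ← hd, hJ, sub_self])
    rw [S.sub_right, sub_eq_zero] at this
    exact this.symm
  have h2 : -(C * ‖e‖ * (‖T‖ * ‖e‖)) ≤ (S e (J e.1)).re := by
    have h3 := (abs_le.1 (Complex.abs_re_le_norm (S e (J e.1)))).1
    have h4 := hbd e (J e.1)
    have h5 : C * ‖e‖ * ‖J e.1‖ ≤ C * ‖e‖ * (‖T‖ * ‖e‖) := by gcongr; exact hT e
    linarith
  have h3 : c * ‖e‖ ^ 2 ≤ ‖e.1‖ ^ 2 := by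
    have := hlow ⟨e, he⟩
    rw [HermForm.comp_apply, HermForm.ofInner_quad] at this
    exact this
  have he0 : 0 < ‖e‖ := norm_pos_iff.2 hne
  rw [dissipation_apply, he.1, hd, HermForm.zero_left, add_zero, HermForm.smul_apply,
    Complex.sub_re, Complex.re_ofReal_mul, HermForm.ofInner_quad, h1]
  have h4 : (C * ‖T‖ / c + 1) * (c * ‖e‖ ^ 2) ≤ (C * ‖T‖ / c + 1) * ‖e.1‖ ^ 2 := by gcongr
  have h5 : (C * ‖T‖ / c + 1) * (c * ‖e‖ ^ 2) = C * ‖T‖ * ‖e‖ ^ 2 + c * ‖e‖ ^ 2 := by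
    field_simp
  have h6 : 0 < c * ‖e‖ ^ 2 := by positivity
  nlinarith

lemma IsLossless.dissipation_iff {M : X × U →ₗ[ℂ] X} {S : HermForm (X × U)} (P : HermForm X)
    {e : X × U} : IsLossless M (dissipation M S P) e ↔ IsLossless M S e := by
  unfold IsLossless
  refine and_congr_right fun h => ?_
  rw [dissipation_quad, h, HermForm.zero_right]
  simp

end Storage

/-- The frequency condition yields a quadratic storage function without sign condition. -/
theorem exists_storage_of_frequencyBound {U : Type} [NormedAddCommGroup U] [InnerProductSpace ℂ U]
    [FiniteDimensional ℂ U] (n : ℕ) :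
    ∀ (X : Type) [NormedAddCommGroup X] [InnerProductSpace ℂ X] [FiniteDimensional ℂ X]
      (M : X × U →ₗ[ℂ] X) (S : HermForm (X × U)), Module.finrank ℂ X = n → RegularSupply S →
      FrequencyBound M S → ∃ P : HermForm X, (dissipation M S P).PosSemidef := by
  induction n using Nat.strong_induction_on with
  | _ n ih =>
  intro X _ _ _ M₀ S hn hreg hfreq₀
  by_cases hterm : ∀ (ω : ℝ) f, detune M₀ ω f = 0 → f ≠ 0 → 0 < (S f f).re
  · obtain ⟨P, hP, -⟩ := exists_strict_storage hreg hterm ⊥ (Or.inl rfl)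
    exact ⟨P, hP.posSemidef⟩
  push Not at hterm
  obtain ⟨ω, e, he, he0, hSe⟩ := hterm
  have hfreq := hfreq₀.detuned ω
  have hloss : IsLossless (detune M₀ ω) S e := ⟨he, le_antisymm hSe (hfreq₀.nonneg he)⟩
  -- In the rotating frame the lossless oscillation is an equilibrium, and the dissipation form does
  -- not change.
  suffices h : ∃ P : HermForm X, (dissipation (detune M₀ ω) S P).PosSemidef by
    obtain ⟨P, hP⟩ := h
    exact ⟨P, fun f => by rw [← dissipation_detune M₀ S P ω]; exact hP f⟩
  generalize detune M₀ ω = M at hfreq hloss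
  have hS := hfreq.nonneg_ker
  by_cases hcase : ∃ f, M f = 0 ∧ f.1 ∉ LinearMap.range M
  · obtain ⟨f, hf, hfr⟩ := hcase
    obtain ⟨η, e, p, hη, he, hηe, heS, hp, hcomp, hlt⟩ := exists_split_data hS hf hfr
    obtain ⟨P', hP'⟩ := ih _ (hlt.trans_eq hn) _ (compress M _ p) (S.comp (inclTraj U _)) rfl
      (hreg.comp_inclTraj _) (hfreq.compress hcomp)
    obtain ⟨P, hP, -⟩ := exists_extension_of_split M S η hη he hηe hS heS p hp P' hP'
    exact ⟨P, hP⟩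
  · push Not at hcase
    -- No sign is asked of the storage, so subtracting a quadratic storage from the problem is
    -- harmless; it makes the form forced on lossless states positive, as the splitting requires.
    obtain ⟨P₀, hP₀⟩ := exists_shift_pos hreg hS
    have hfreq' := hfreq.dissipation P₀
    obtain ⟨D⟩ := LosslessSplitting.nonempty hfreq'.nonneg_ker (fun g hg => hcase g hg)
      (fun e d he hd => hfreq'.real he hd)
      (fun e d he hd h0 => hP₀ e d ((IsLossless.dissipation_iff P₀).1 he) hd h0)
    obtain ⟨Q, hQ⟩ := ih _ ((D.finrank_lt ((IsLossless.dissipation_iff P₀).2 hloss) he0).trans_eq hn)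
      _ D.red D.redS rfl ((hreg.dissipation M P₀).comp_inclTraj _) (hfreq'.red D)
    obtain ⟨P, hP, -⟩ := D.exists_extension Q hQ
    exact ⟨P₀ + P, fun f => by rw [← dissipation_dissipation]; exact hP f⟩

lemma HermForm.ext_apply {V : Type*} [AddCommGroup V] [Module ℂ V] {P Q : HermForm V}
    (h : ∀ x y, P x y = Q x y) : P = Q := by
  obtain ⟨p, _, _, _⟩ := P
  obtain ⟨q, _, _, _⟩ := Q
  obtain rfl : p = q := funext fun x => funext fun y => h x y
  rfl

/-! ### Drift states and positivity of a storage on reachable states. -/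

section Drift

variable {X U : Type} [NormedAddCommGroup X] [InnerProductSpace ℂ X] [FiniteDimensional ℂ X]
  [NormedAddCommGroup U] [InnerProductSpace ℂ U] [FiniteDimensional ℂ U]

/-- A Jordan chain of oscillations whose lower half is lossless. -/
structure IsDriftChain (M : X × U →ₗ[ℂ] X) (S : HermForm (X × U)) (ω : ℝ) (j : ℕ)
    (f : ℤ → X × U) : Prop where
  eq_zero : ∀ i ≤ -(j : ℤ), f i = 0
  chain : ∀ i ≤ (j : ℤ), detune M ω (f i) = (f (i - 1)).1
  null : ∀ i ≤ 0, (S (f i) (f i)).re = 0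

/-- The states that can be reached by slow drift along lossless oscillations. -/
def driftSpace (M : X × U →ₗ[ℂ] X) (S : HermForm (X × U)) : Submodule ℂ X :=
  Submodule.span ℂ {y | ∃ ω j f, IsDriftChain M S ω j f ∧ (f 0).1 = y}

lemma IsDriftChain.mem {M : X × U →ₗ[ℂ] X} {S : HermForm (X × U)} {ω : ℝ} {j : ℕ}
    {f : ℤ → X × U} (h : IsDriftChain M S ω j f) : (f 0).1 ∈ driftSpace M S :=
  Submodule.subset_span ⟨ω, j, f, h, rfl⟩

/-- Positivity of the storage `P` on the states that are reachable from the origin in infinite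
time. -/
def StoragePositive (M : X × U →ₗ[ℂ] X) (S : HermForm (X × U)) (P : HermForm X) : Prop :=
  ∀ (D : Type) [NormedAddCommGroup D] [InnerProductSpace ℂ D] [FiniteDimensional ℂ D]
    (F : D →ₗ[ℂ] D) (Φ : D →ₗ[ℂ] X × U) (K : HermForm D), Antistable F →
    (∀ a, M (Φ a) = (Φ (F a)).1) → (∀ a b, K (F a) b + K a (F b) = S (Φ a) (Φ b)) →
    ∀ a, ∀ y ∈ driftSpace M S, (Φ a).1 + y ≠ 0 →
      0 < (K a a).re + (P ((Φ a).1 + y) ((Φ a).1 + y)).re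

lemma StoragePositive.pos_of_mem {M : X × U →ₗ[ℂ] X} {S : HermForm (X × U)} {P : HermForm X}
    (h : StoragePositive M S P) {y : X} (hy : y ∈ driftSpace M S) (hy0 : y ≠ 0) :
    0 < (P y y).re := by
  have := h (EuclideanSpace ℂ (Fin 0)) 0 0 ((0 : ℝ) • HermForm.ofInner _)
    (fun μ v hv _ => absurd (Subsingleton.elim v 0) hv) (fun a => by simp) (fun a b => by simp)
    0 y hy (by simpa using hy0)
  simpa using this

/-- Passing from `S` to the dissipation form of `P` subtracts `P` along `Φ` from the stored supply.
The positivity of the sum, taken with `y = 0`, is then that of the original `K`. -/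
lemma StoragePositive.antistablePositive {M : X × U →ₗ[ℂ] X} {S : HermForm (X × U)}
    {P : HermForm X} (h : StoragePositive M (dissipation M S P) P) : AntistablePositive M S := by
  intro D _ _ _ F Φ K hF hΦ hK hinj a ha
  have := h D F Φ (K + (-1 : ℝ) • P.comp (LinearMap.fst ℂ X U ∘ₗ Φ)) hF hΦ (fun a b => by
    simp only [HermForm.add_apply, HermForm.smul_apply, HermForm.comp_apply, LinearMap.comp_apply,
      LinearMap.fst_apply, dissipation_apply, hΦ]
    push_cast
    linear_combination hK a b) a 0 (Submodule.zero_mem _) (by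
      rw [add_zero]; exact fun h0 => ha (hinj a h0))
  simpa using this

lemma driftSpace_detune_le (M : X × U →ₗ[ℂ] X) (S : HermForm (X × U)) (ω : ℝ) :
    driftSpace (detune M ω) S ≤ driftSpace M S := by
  refine Submodule.span_le.2 ?_
  rintro _ ⟨ω', j, f, hf, rfl⟩
  exact IsDriftChain.mem (ω := ω + ω') (j := j)
    ⟨hf.eq_zero, fun i hi => by rw [← detune_detune]; exact hf.chain i hi, hf.null⟩

/-- A trajectory family of the rotating frame has generator `F + iω` in the original one. The shift
neither moves real parts of eigenvalues nor changes the Lyapunov identity. -/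
lemma StoragePositive.detuned {M : X × U →ₗ[ℂ] X} {S : HermForm (X × U)} {P : HermForm X}
    (h : StoragePositive M S P) (ω : ℝ) : StoragePositive (detune M ω) S P := by
  intro D _ _ _ F Φ K hF hΦ hK a y hy hne
  refine h D (F + ((ω : ℂ) * Complex.I) • LinearMap.id) Φ K (fun μ v hv hμ => ?_) (fun a => ?_)
    (fun a b => ?_) a y (driftSpace_detune_le M S ω hy) hne
  · have := hF (μ - (ω : ℂ) * Complex.I) v hv (by
      rw [sub_smul, ← hμ]; simp)
    simpa using this
  · have := hΦ a
    rw [detune_apply, sub_eq_iff_eq_add] at this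
    rw [this]; simp
  · simp only [LinearMap.add_apply, LinearMap.smul_apply, LinearMap.id_apply, K.add_left,
      K.add_right, K.smul_left, K.smul_right]
    rw [← hK a b]
    simp
    ring

/-- A system embedded into a larger one inherits positivity. -/
lemma StoragePositive.compress {M : X × U →ₗ[ℂ] X} {S : HermForm (X × U)} {P : HermForm X}
    (hP : StoragePositive M S P) {Y : Submodule ℂ X} {p : X →ₗ[ℂ] Y}
    (h : ∀ f, ((compress M Y p f : Y) : X) = M (inclTraj U Y f)) :
    StoragePositive (_root_.compress M Y p) (S.comp (inclTraj U Y)) (P.comp Y.subtype) := by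
  have hdrift : ∀ y ∈ driftSpace (_root_.compress M Y p) (S.comp (inclTraj U Y)),
      (y : X) ∈ driftSpace M S := by
    intro y hy
    have : driftSpace (_root_.compress M Y p) (S.comp (inclTraj U Y))
        ≤ (driftSpace M S).comap Y.subtype := by
      refine Submodule.span_le.2 ?_
      rintro _ ⟨ω, j, f, hf, rfl⟩
      refine IsDriftChain.mem (ω := ω) (j := j) (f := fun i => inclTraj U Y (f i))
        ⟨fun i hi => by rw [hf.eq_zero i hi, map_zero], fun i hi => ?_, hf.null⟩
      rw [← detune_compress h, hf.chain i hi]; rfl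
    exact this hy
  intro D _ _ _ F Φ K hF hΦ hK a y hy hne
  refine hP D F (inclTraj U Y ∘ₗ Φ) K hF (fun a => ?_) hK a y (hdrift y hy) ?_
  · rw [LinearMap.comp_apply, ← h, hΦ]; rfl
  · intro h0
    exact hne (Subtype.ext h0)

/-- In a chain step a lossless equilibrium is itself a drift state. -/
lemma IsLossless.mem_driftSpace {M : X × U →ₗ[ℂ] X} {S : HermForm (X × U)} {e d : X × U}
    (he : IsLossless M S e) (hd : M d = e.1) : e.1 ∈ driftSpace M S := by
  have : IsDriftChain M S 0 1 (fun i => if i = 0 then e else if i = 1 then d else 0) := by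
    constructor
    · intro i hi
      have h1 : i ≠ 0 := by push_cast at hi; omega
      have h2 : i ≠ 1 := by push_cast at hi; omega
      simp [h1, h2]
    · intro i hi
      rw [detune_zero]
      by_cases h1 : i = 1
      · simp [h1, hd]
      · by_cases h0 : i = 0
        · simp [h0, he.1]
        · have h2 : i - 1 ≠ 0 := by omega
          have h3 : i - 1 ≠ 1 := by push_cast at hi; omega
          simp [h1, h0, h2, h3]
    · intro i hi
      by_cases h0 : i = 0
      · simp [h0, he.2]
      · have h2 : i ≠ 1 := by omega
        simp [h0, h2]
  simpa using this.mem

end Drift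

/-! ### Positivity passes to the compressed system. -/

section ReducedPositivity

variable {X U : Type} [NormedAddCommGroup X] [InnerProductSpace ℂ X] [FiniteDimensional ℂ X]
  [NormedAddCommGroup U] [InnerProductSpace ℂ U] [FiniteDimensional ℂ U]
  {M : X × U →ₗ[ℂ] X} {S : HermForm (X × U)} {P : HermForm X}

/-- The supply rate at a lossless equilibrium is determined by any storage. -/
lemma IsLossless.supply_eq (hS : (dissipation M S P).PosSemidef) {e : X × U}
    (he : IsLossless M S e) (g : X × U) : S e g = P e.1 (M g) := by
  have h := hS.apply_eq_zero ((IsLossless.dissipation_iff P).2 he).2 g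
  rw [dissipation_apply, he.1, P.zero_left, add_zero, sub_eq_zero] at h
  exact h

/-- `Y` is `P`-orthogonal to the states of lossless equilibria: for `y = M g` with `σ y = 0`, the
pairing is `S e g`, which `σ` computes to be zero. Hence the projection `p` is invisible to `P` when
paired with `Y`. -/
lemma LosslessSplitting.dissipation_red (hS : (dissipation M S P).PosSemidef)
    (D : LosslessSplitting M S) :
    dissipation D.red D.redS (P.comp D.Y.subtype)
      = (dissipation M S P).comp (inclTraj U D.Y) := by
  have key : ∀ (y : D.Y) (f : X × U), P y (D.p (M f) : X) = P y (M f) := fun y f => by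
    obtain ⟨⟨g, hg⟩, hσ⟩ := D.hY y y.2
    have h1 := (D.hσ (M f)).supply_eq hS g
    rw [hg, D.hσS _ g (D.hσ _), hg, hσ] at h1
    simp only [Prod.fst_zero, map_zero, HermForm.zero_right] at h1
    rw [D.hp, P.sub_right, ← P.conj_symm _ (D.σ (M f)).1, ← h1]
    simp
  refine HermForm.ext_apply fun f g => ?_
  rw [dissipation_apply]
  have h1 := key f.1 (inclTraj U D.Y g)
  have h2 := key g.1 (inclTraj U D.Y f)
  have h3 : P (D.red f : X) g.1 = P (M (inclTraj U D.Y f)) g.1 := by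
    rw [← P.conj_symm, ← P.conj_symm (M _)]
    exact congrArg star h2
  change S _ _ - (P f.1 (D.red g : X) + P (D.red f : X) g.1) = _
  rw [h3]
  change S _ _ - (P f.1 (D.p (M (inclTraj U D.Y g)) : X) + _) = _
  rw [h1]
  rfl

lemma LosslessSplitting.apply_inclTraj (D : LosslessSplitting M S) (f : D.Y × U) :
    M (inclTraj U D.Y f) = (D.red f : X) + (D.σ (M (inclTraj U D.Y f))).1 := by
  have : (D.red f : X) = M (inclTraj U D.Y f) - (D.σ (M (inclTraj U D.Y f))).1 := D.hp _
  rw [this]; abel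

lemma LosslessSplitting.lossless_mem_driftSpace (D : LosslessSplitting M S)
    {e : X × U} (he : IsLossless M S e) : e.1 ∈ driftSpace M (dissipation M S P) := by
  obtain ⟨d, hd⟩ := D.mem_range e he.1
  exact ((IsLossless.dissipation_iff P).2 he).mem_driftSpace hd

/-- Adding lossless equilibria does not change the supply. -/
lemma quad_add_lossless (hS : (dissipation M S P).PosSemidef) {e : X × U}
    (he : IsLossless M S e) (f g : X × U) {e' : X × U} (he' : IsLossless M S e') :
    dissipation M S P (f + e) (g + e') = dissipation M S P f g := by
  have h0 : ∀ {e}, IsLossless M S e → ∀ g, dissipation M S P e g = 0 := fun he g =>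
    hS.apply_eq_zero ((IsLossless.dissipation_iff P).2 he).2 g
  rw [HermForm.add_left, h0 he, HermForm.add_right, ← HermForm.conj_symm _ f e', h0 he']
  simp

lemma IsLossless.zero : IsLossless M S 0 := by constructor <;> simp

/-- A chain of the compressed system is a chain of the full one up to lossless errors `h i`. They
are removed by adding lossless equilibria `z i`, which does not alter the dissipation form; at index
`0` the correction is itself a drift state and can be subtracted. -/
lemma LosslessSplitting.driftSpace_red_le (hS : (dissipation M S P).PosSemidef)
    (D : LosslessSplitting M S) :
    driftSpace D.red ((dissipation M S P).comp (inclTraj U D.Y))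
      ≤ (driftSpace M (dissipation M S P)).comap D.Y.subtype := by
  refine Submodule.span_le.2 ?_
  rintro _ ⟨ω, j, f, hf, rfl⟩
  set S' := dissipation M S P with hS'
  have hsm : ∀ {e} (c : ℂ), IsLossless M S e → IsLossless M S (c • e) := fun c he =>
    (losslessSpace D.nonneg).smul_mem c he
  have hsub : ∀ {e e'}, IsLossless M S e → IsLossless M S e' → IsLossless M S (e - e') :=
    fun he he' => (losslessSpace D.nonneg).sub_mem he he'
  let F : ℤ → X × U := fun i => inclTraj U D.Y (f i)
  let h : ℤ → X × U := fun i => D.σ (M (F i))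
  have hh : ∀ i, IsLossless M S (h i) := fun i => D.hσ _
  have hF0 : ∀ i ≤ -(j : ℤ), F i = 0 := fun i hi => by
    simp only [F]; rw [hf.eq_zero i hi, map_zero]
  have hh0 : ∀ i ≤ -(j : ℤ), h i = 0 := fun i hi => by
    simp only [h]; rw [hF0 i hi, map_zero, map_zero]
  have hchain : ∀ i ≤ (j : ℤ), detune M ω (F i) = (F (i - 1)).1 + (h i).1 := fun i hi => by
    have h1 := congrArg Subtype.val (hf.chain i hi)
    rw [detune_apply, Submodule.coe_sub] at h1
    rw [detune_apply, D.apply_inclTraj]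
    have h2 : ((F (i - 1)).1 : X) = ((f (i - 1)).1 : X) := rfl
    rw [h2, ← h1]
    simp only [F, h, inclTraj_apply, Submodule.coe_smul]
    abel
  have hnull : ∀ i ≤ 0, ∀ e, IsLossless M S e → (S' (F i + e) (F i + e)).re = 0 := fun i hi e he => by
    rw [hS', quad_add_lossless hS he _ _ he]; exact hf.null i hi
  have hfin : ∀ e, IsLossless M S e → (F 0 + e).1 ∈ driftSpace M S' →
      (F 0).1 ∈ driftSpace M S' := fun e he hmem => by
    have := Submodule.sub_mem _ hmem (D.lossless_mem_driftSpace (P := P) he)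
    simpa using this
  change (F 0).1 ∈ driftSpace M S'
  by_cases hω : ω = 0
  · subst hω
    simp only [detune_zero] at hchain
    -- At frequency zero `M (z i) = 0`, so the error at `i` has to be matched by the state of `z (i
    -- - 1)`. This shifts the start by one, so a chain of parameter `j + 1` is used; its top is a
    -- preimage of the last state, which lies in the range of `M`.
    let z : ℤ → X × U := fun i => if i < j then h (i + 1) else 0
    have hz : ∀ i, IsLossless M S (z i) := fun i => by
      simp only [z]; split_ifs
      exacts [hh _, IsLossless.zero]
    refine hfin _ (hz 0) ?_
    let G : ℤ → X × U := fun i => if i ≤ j then F i + z i else D.J (F (i - 1)).1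
    have hG0 : G 0 = F 0 + z 0 := by simp [G]
    rw [← hG0]
    refine IsDriftChain.mem (ω := 0) (j := j + 1) ⟨fun i hi => ?_, fun i hi => ?_, fun i hi => ?_⟩
    · push_cast at hi
      have h1 : i ≤ j := by omega
      have h2 : i < j := by omega
      simp only [G, z, h1, h2, if_true]
      rw [hF0 i (by omega), hh0 (i + 1) (by omega), add_zero]
    · rw [detune_zero]
      push_cast at hi
      by_cases h1 : i ≤ j
      · have h2 : i - 1 ≤ j := by omega
        have h3 : i - 1 < j := by omega
        have h4 : G i = F i + z i := by simp only [G, h1, if_true]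
        have h5 : G (i - 1) = F (i - 1) + h i := by
          simp only [G, z, h2, h3, if_true, sub_add_cancel]
        rw [h4, h5, map_add, (hz i).1, add_zero, hchain i h1, Prod.fst_add]
      · obtain rfl : i = j + 1 := by omega
        have h4 : G (j + 1) = D.J (F j).1 := by simp [G]
        have h5 : G ((j : ℤ) + 1 - 1) = F j := by simp [G, z]
        obtain ⟨⟨g, hg⟩, -⟩ := D.hY ((f j).1 : X) (f j).1.2
        rw [h4, h5]
        change M (D.J ((f j).1 : X)) = ((f j).1 : X)
        rw [← hg, D.hJ]
    · have h1 : i ≤ j := by omega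
      have h4 : G i = F i + z i := by simp only [G, h1, if_true]
      rw [h4]
      exact hnull i hi _ (hz i)
  · have hiω : ((ω : ℂ) * Complex.I) ≠ 0 := by simp [hω]
    -- At nonzero frequency `iω z i = h i - z (i - 1)` is solved recursively from the start of the
    -- chain, without lengthening it.
    let g : ℕ → X × U := fun n => Nat.rec 0
      (fun n r => ((ω : ℂ) * Complex.I)⁻¹ • (h ((n : ℤ) + 1 - j) - r)) n
    have hg0 : g 0 = 0 := rfl
    have hg1 : ∀ n : ℕ, g (n + 1) = ((ω : ℂ) * Complex.I)⁻¹ • (h ((n : ℤ) + 1 - j) - g n) :=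
      fun n => rfl
    have hg : ∀ n, IsLossless M S (g n) := fun n => by
      induction n with
      | zero => exact IsLossless.zero
      | succ n ih => rw [hg1]; exact hsm _ (hsub (hh _) ih)
    let z : ℤ → X × U := fun i => g (i + j).toNat
    have hz : ∀ i, IsLossless M S (z i) := fun i => hg _
    have hz0 : ∀ i ≤ -(j : ℤ), z i = 0 := fun i hi => by
      have : (i + j).toNat = 0 := by omega
      simp only [z, this, hg0]
    have hz1 : ∀ i, ((ω : ℂ) * Complex.I) • z i = h i - z (i - 1) := fun i => by
      by_cases hi : i ≤ -(j : ℤ)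
      · rw [hz0 i hi, hz0 (i - 1) (by omega), hh0 i hi]; simp
      · have h1 : (i + j).toNat = (i - 1 + j).toNat + 1 := by omega
        have h2 : (((i - 1 + j).toNat : ℕ) : ℤ) + 1 - j = i := by omega
        simp only [z]
        rw [h1, hg1, h2, smul_smul, mul_inv_cancel₀ hiω, one_smul]
    refine hfin _ (hz 0) ?_
    refine IsDriftChain.mem (ω := ω) (j := j) (f := fun i => F i + z i)
      ⟨fun i hi => ?_, fun i hi => ?_, fun i hi => hnull i hi _ (hz i)⟩
    · rw [hF0 i hi, hz0 i hi, add_zero]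
    · have h1 := congrArg Prod.fst (hz1 i)
      rw [Prod.smul_fst, Prod.fst_sub] at h1
      rw [map_add, hchain i hi, detune_apply M ω (z i), (hz i).1, h1, Prod.fst_add]
      abel

lemma Antistable.injective {D : Type*} [AddCommGroup D] [Module ℂ D] {F : D →ₗ[ℂ] D}
    (hF : Antistable F) : Function.Injective F := by
  rw [← LinearMap.ker_eq_bot, LinearMap.ker_eq_bot']
  intro v hv
  by_contra hne
  have := hF 0 v hne (by simpa using hv)
  simp at this

/-- A compressed family becomes one of the full system after adding lossless equilibria `τ` with `τ
(F a) = σ (M (Φ a))`, which is solvable as an antistable `F` is invertible. The dissipation form is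
unchanged, and the displaced state `(τ a).1` is a drift state, so it is compensated by changing `y`.
-/
lemma StoragePositive.red (hS : (dissipation M S P).PosSemidef)
    (h : StoragePositive M (dissipation M S P) P) (D : LosslessSplitting M S) :
    StoragePositive D.red ((dissipation M S P).comp (inclTraj U D.Y)) (P.comp D.Y.subtype) := by
  intro E _ _ _ F Φ K hF hΦ hK a y hy hne
  let Fi := LinearEquiv.ofInjectiveEndo F hF.injective
  have hFi : ∀ a, Fi.symm (F a) = a := fun a => Fi.symm_apply_apply a
  have hFi' : ∀ a, F (Fi.symm a) = a := fun a => Fi.apply_symm_apply a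
  let τ : E →ₗ[ℂ] X × U := D.σ ∘ₗ M ∘ₗ inclTraj U D.Y ∘ₗ Φ ∘ₗ Fi.symm.toLinearMap
  have hτ : ∀ a, IsLossless M S (τ a) := fun a => D.hσ _
  have hτF : ∀ a, τ (F a) = D.σ (M (inclTraj U D.Y (Φ a))) := fun a => by
    simp only [τ, LinearMap.comp_apply, LinearEquiv.coe_coe, hFi]
  have hy' : (y : X) ∈ driftSpace M (dissipation M S P) := D.driftSpace_red_le hS hy
  have hmem := Submodule.sub_mem _ hy' (D.lossless_mem_driftSpace (P := P) (hτ a))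
  have hsum : ((inclTraj U D.Y ∘ₗ Φ + τ) a).1 + ((y : X) - (τ a).1) = (((Φ a).1 + y : D.Y) : X) := by
    simp only [LinearMap.add_apply, LinearMap.comp_apply, Prod.fst_add, inclTraj_apply,
      Submodule.coe_add]
    abel
  have := h E F (inclTraj U D.Y ∘ₗ Φ + τ) K hF (fun a => ?_) (fun a b => ?_) a _ hmem ?_
  · rw [hsum] at this
    exact this
  · rw [LinearMap.add_apply, map_add, (hτ a).1, add_zero, LinearMap.comp_apply, D.apply_inclTraj,
      hΦ, ← hτF]
    rfl
  · rw [LinearMap.add_apply, LinearMap.add_apply, quad_add_lossless hS (hτ a) _ _ (hτ b)]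
    exact hK a b
  · rw [hsum]
    intro h0
    exact hne (Subtype.ext h0)

end ReducedPositivity

/-! ### Existence of a positive definite quadratic storage. -/

/-- A storage that is positive on the reachable states can be improved to a positive definite
one. -/
theorem exists_posDef_storage {U : Type} [NormedAddCommGroup U] [InnerProductSpace ℂ U]
    [FiniteDimensional ℂ U] (n : ℕ) :
    ∀ (X : Type) [NormedAddCommGroup X] [InnerProductSpace ℂ X] [FiniteDimensional ℂ X]
      (M : X × U →ₗ[ℂ] X) (S : HermForm (X × U)) (P₀ : HermForm X), Module.finrank ℂ X = n →
      RegularSupply S → (dissipation M S P₀).PosSemidef →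
      StoragePositive M (dissipation M S P₀) P₀ →
      ∃ P : HermForm X, P.PosDef ∧ (dissipation M S P).PosSemidef := by
  induction n using Nat.strong_induction_on with
  | _ n ih =>
  intro X _ _ _ M₀ S P₀ hn hreg hpsd₀ hpos₀
  by_cases hterm : ∀ (ω : ℝ) f, detune M₀ ω f = 0 → f ≠ 0 → 0 < (S f f).re
  · obtain ⟨P, hP, hP'⟩ := exists_strict_storage hreg hterm ⊤ (Or.inr hpos₀.antistablePositive)
    exact ⟨P, fun x hx => hP' x trivial hx, hP.posSemidef⟩
  push Not at hterm
  obtain ⟨ω, e, he, he0, hSe⟩ := hterm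
  have heq : ∀ P, dissipation (detune M₀ ω) S P = dissipation M₀ S P := fun P =>
    HermForm.ext_apply fun f g => dissipation_detune M₀ S P ω f g
  have hpsd : (dissipation (detune M₀ ω) S P₀).PosSemidef := by rw [heq]; exact hpsd₀
  have hpos : StoragePositive (detune M₀ ω) (dissipation (detune M₀ ω) S P₀) P₀ := by
    rw [heq]; exact hpos₀.detuned ω
  have hloss : IsLossless (detune M₀ ω) S e := by
    refine ⟨he, le_antisymm hSe ?_⟩
    have := hpsd e
    rw [dissipation_quad, he, HermForm.zero_right] at this
    simpa using this
  suffices h : ∃ P : HermForm X, P.PosDef ∧ (dissipation (detune M₀ ω) S P).PosSemidef by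
    obtain ⟨P, hP, hP'⟩ := h
    exact ⟨P, hP, by rwa [heq] at hP'⟩
  generalize detune M₀ ω = M at hpsd hpos hloss
  have hS : ∀ g, M g = 0 → 0 ≤ (S g g).re := fun g hg => by
    have := hpsd g
    rw [dissipation_quad, hg, HermForm.zero_right] at this
    simpa using this
  by_cases hcase : ∃ f, M f = 0 ∧ f.1 ∉ LinearMap.range M
  · obtain ⟨f, hf, hfr⟩ := hcase
    obtain ⟨η, e, p, hη, he, hηe, heS, hp, hcomp, hlt⟩ := exists_split_data hS hf hfr
    have hd : dissipation (compress M _ p) (S.comp (inclTraj U _))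
        (P₀.comp (LinearMap.ker η).subtype)
        = (dissipation M S P₀).comp (inclTraj U (LinearMap.ker η)) := by
      refine HermForm.ext_apply fun f g => ?_
      rw [dissipation_apply]
      simp only [HermForm.comp_apply, Submodule.subtype_apply, dissipation_apply]
      rw [hcomp, hcomp]; rfl
    obtain ⟨P', hP', hP'd⟩ := ih _ (hlt.trans_eq hn) _ (compress M _ p) (S.comp (inclTraj U _))
      (P₀.comp (LinearMap.ker η).subtype) rfl (hreg.comp_inclTraj _)
      (by rw [hd]; exact fun f => hpsd _) (by rw [hd]; exact hpos.compress hcomp)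
    obtain ⟨P, hP, hPpos⟩ := exists_extension_of_split M S η hη he hηe hS heS p hp P' hP'd
    exact ⟨P, hPpos hP', hP⟩
  · push Not at hcase
    -- The form forced on lossless states agrees with `P₀`, which is positive on drift states by
    -- `hpos`; no shift of the supply is needed here.
    have hSd : ∀ e d, IsLossless M S e → M d = e.1 → S e d = P₀ e.1 e.1 := fun e d he hd => by
      rw [he.supply_eq hpsd, hd]
    obtain ⟨D⟩ := LosslessSplitting.nonempty hS (fun g hg => hcase g hg)
      (fun e d he hd => by rw [hSd e d he hd, HermForm.im_self])
      (fun e d he hd h0 => by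
        rw [hSd e d he hd]
        refine hpos.pos_of_mem (((IsLossless.dissipation_iff P₀).2 he).mem_driftSpace hd) ?_
        intro hz
        have h1 : e = (0, e.2) := Prod.ext hz rfl
        have h2 : e.2 ≠ 0 := fun h2 => h0 (by rw [h1, h2]; rfl)
        have := hreg _ h2
        rw [← h1, he.2] at this
        exact lt_irrefl _ this)
    have hd := D.dissipation_red hpsd
    obtain ⟨Q, hQ, hQd⟩ := ih _ ((D.finrank_lt hloss he0).trans_eq hn) _ D.red D.redS
      (P₀.comp D.Y.subtype) rfl (hreg.comp_inclTraj _) (by rw [hd]; exact fun f => hpsd _)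
      (by rw [hd]; exact hpos.red hpsd D)
    obtain ⟨P, hP, hPpos⟩ := D.exists_extension Q hQd
    exact ⟨P, hPpos hQ, hP⟩

/-! ### Derivatives of quadratic forms, and flows decaying in backward time. -/

section Calculus

variable {V : Type*} [NormedAddCommGroup V] [NormedSpace ℂ V] [FiniteDimensional ℂ V]

lemma HermForm.isBoundedBilinearMap (Q : HermForm V) :
    IsBoundedBilinearMap ℝ fun p : V × V => (Q p.1 p.2).re where
  add_left x y z := by rw [Q.add_left, Complex.add_re]
  smul_left r x y := by
    rw [← Complex.coe_smul, Q.smul_left]; simp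
  add_right x y z := by rw [Q.add_right, Complex.add_re]
  smul_right r x y := by
    rw [← Complex.coe_smul, Q.smul_right]; simp
  bound := by
    obtain ⟨C, hC, h⟩ := Q.exists_bound
    refine ⟨C + 1, by positivity, fun x y => ?_⟩
    refine (Complex.abs_re_le_norm _).trans ((h x y).trans ?_)
    gcongr
    linarith

lemma HermForm.hasDerivAt_quad (Q : HermForm V) {ξ : ℝ → V} {ξ' : V} {s : ℝ}
    (h : HasDerivAt ξ ξ' s) : HasDerivAt (fun t => (Q (ξ t) (ξ t)).re) (2 * (Q (ξ s) ξ').re) s := by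
  have h1 := Q.isBoundedBilinearMap.hasFDerivAt (ξ s, ξ s)
  have h2 := h1.comp_hasDerivAt s (h.prodMk h)
  refine h2.congr_deriv ?_
  have h3 : Q.isBoundedBilinearMap.deriv (ξ s, ξ s) (ξ', ξ')
      = (Q (ξ s) ξ').re + (Q ξ' (ξ s)).re := rfl
  rw [h3, Q.re_symm (ξ s) ξ']
  ring

/-- The parallelogram estimate for a semidefinite form. -/
lemma HermForm.PosSemidef.quad_add_le {V : Type*} [AddCommGroup V] [Module ℂ V] {Q : HermForm V}
    (h : Q.PosSemidef) {δ : ℝ} (hδ : 0 < δ) (x y : V) :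
    (Q (x + y) (x + y)).re ≤ (1 + δ) * (Q x x).re + (1 + δ⁻¹) * (Q y y).re := by
  have h1 := h ((δ : ℂ) • x + (-1 : ℂ) • y)
  rw [Q.quad_add, Q.quad_smul, Q.quad_smul, Q.smul_left, Q.smul_right] at h1
  rw [Q.quad_add]
  simp only [Complex.norm_real, Real.norm_eq_abs, sq_abs, norm_neg, norm_one, one_pow, one_mul,
    RCLike.star_def, Complex.conj_ofReal, neg_mul, mul_neg, Complex.neg_re,
    Complex.re_ofReal_mul] at h1
  have h2 : 0 ≤ δ⁻¹ * (δ ^ 2 * (Q x x).re + -(2 * (δ * (Q x y).re)) + (Q y y).re) :=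
    mul_nonneg (by positivity) h1
  have h3 : δ⁻¹ * (δ ^ 2 * (Q x x).re + -(2 * (δ * (Q x y).re)) + (Q y y).re)
      = δ * (Q x x).re - 2 * (Q x y).re + δ⁻¹ * (Q y y).re := by field_simp; ring
  linarith

end Calculus

section Backward

variable {D : Type*} [NormedAddCommGroup D] [NormedSpace ℂ D] [FiniteDimensional ℂ D]

lemma tendsto_pow_mul_exp_atBot (n : ℕ) {r : ℝ} (hr : 0 < r) :
    Filter.Tendsto (fun s : ℝ => s ^ n * Real.exp (r * s)) Filter.atBot (nhds 0) := by
  have h1 := (Real.tendsto_pow_mul_exp_neg_atTop_nhds_zero n).comp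
    ((Filter.tendsto_const_mul_atTop_of_pos hr).2 Filter.tendsto_neg_atBot_atTop)
  have h2 := h1.const_mul ((-r⁻¹) ^ n)
  rw [mul_zero] at h2
  refine h2.congr fun s => ?_
  simp only [Function.comp]
  rw [← mul_assoc, ← mul_pow]
  congr 2
  · field_simp
  · ring

/-- States of an antistable linear flow decay in backward time. -/
lemma Antistable.exists_decaying_solution {F : D →ₗ[ℂ] D} (hF : Antistable F) (a : D) :
    ∃ α : ℝ → D, α 0 = a ∧ (∀ s, HasDerivAt α (F (α s)) s) ∧
      Filter.Tendsto α Filter.atBot (nhds 0) := by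
  let W : Submodule ℂ D :=
    { carrier := {a | ∃ α : ℝ → D, α 0 = a ∧ (∀ s, HasDerivAt α (F (α s)) s) ∧
        Filter.Tendsto α Filter.atBot (nhds 0)}
      zero_mem' := ⟨fun _ => 0, rfl, fun s => by simpa using hasDerivAt_const s (0 : D),
        tendsto_const_nhds⟩
      add_mem' := by
        rintro a b ⟨α, h1, h2, h3⟩ ⟨β, h4, h5, h6⟩
        refine ⟨fun s => α s + β s, by simp only [h1, h4], fun s => ?_, by simpa using h3.add h6⟩
        rw [map_add]; exact (h2 s).add (h5 s)
      smul_mem' := by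
        rintro c a ⟨α, h1, h2, h3⟩
        refine ⟨fun s => c • α s, by simp only [h1], fun s => ?_, by simpa using h3.const_smul c⟩
        rw [map_smul]; exact (h2 s).const_smul c }
  suffices h : ∀ a, a ∈ W from h a
  have hgen : ∀ μ : ℂ, Module.End.maxGenEigenspace F μ ≤ W := by
    intro μ a ha
    obtain ⟨k, hk⟩ := Module.End.mem_maxGenEigenspace F μ a |>.1 ha
    set N : Module.End ℂ D := F - μ • (1 : Module.End ℂ D) with hN
    by_cases hμ : 0 < μ.re
    -- On a generalized eigenspace the solution is the finite sum of `s ^ i / i! * e^{μ s} N ^ i a`;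
    -- for `0 < μ.re` the exponential beats the polynomials as `s` tends to `-∞`.
    · let β : ℕ → ℝ → ℂ := fun i s => ((s ^ i / (i.factorial : ℝ) : ℝ) : ℂ) * Complex.exp (μ * s)
      have hβ0 : ∀ s, HasDerivAt (β 0) (μ * β 0 s) s := fun s => by
        have h1 : HasDerivAt (fun t : ℝ => Complex.exp (μ * t)) (Complex.exp (μ * s) * (μ * 1)) s :=
          ((Complex.ofRealCLM.hasDerivAt (x := s)).const_mul μ).cexp
        simpa [β, mul_comm] using h1
      have hβ : ∀ i s, HasDerivAt (β (i + 1)) (μ * β (i + 1) s + β i s) s := fun i s => by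
        have h1 : HasDerivAt (fun t : ℝ => Complex.exp (μ * t)) (Complex.exp (μ * s) * (μ * 1)) s :=
          ((Complex.ofRealCLM.hasDerivAt (x := s)).const_mul μ).cexp
        have h2 : HasDerivAt (fun t : ℝ => t ^ (i + 1) / ((i + 1).factorial : ℝ))
            (s ^ i / (i.factorial : ℝ)) s := by
          refine ((hasDerivAt_pow (i + 1) s).div_const ((i + 1).factorial : ℝ)).congr_deriv ?_
          rw [Nat.factorial_succ]
          have : (i.factorial : ℝ) ≠ 0 := by exact_mod_cast Nat.factorial_ne_zero i
          have : ((i : ℝ) + 1) ≠ 0 := by positivity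
          push_cast
          field_simp
        refine (h2.ofReal_comp.mul h1).congr_deriv ?_
        simp only [β]
        ring
      refine ⟨fun s => ∑ i ∈ Finset.range k, β i s • (N ^ i) a, ?_, fun s => ?_, ?_⟩
      · cases k with
        | zero => simp at hk; simp [hk]
        | succ k =>
          dsimp only
          rw [Finset.sum_range_succ']
          simp [β]
      · have hFN : ∀ v, F v = μ • v + N v := fun v => by simp [hN]
        rw [hFN, map_sum, Finset.smul_sum]
        have hd : ∀ i ∈ Finset.range k, HasDerivAt (fun s => β i s • (N ^ i) a)
            ((μ * β i s + if i = 0 then 0 else β (i - 1) s) • (N ^ i) a) s := by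
          intro i _
          cases i with
          | zero => rw [if_pos rfl, add_zero]; exact (hβ0 s).smul_const ((N ^ 0) a)
          | succ i => simpa using (hβ i s).smul_const ((N ^ (i + 1)) a)
        refine (HasDerivAt.fun_sum hd).congr_deriv ?_
        symm
        simp only [add_smul, Finset.sum_add_distrib, smul_smul]
        congr 1
        cases k with
        | zero => simp
        | succ k =>
          conv_lhs => rw [Finset.sum_range_succ]
          conv_rhs => rw [Finset.sum_range_succ']
          simp only [map_smul, Nat.succ_ne_zero, if_false, if_true, Nat.add_sub_cancel, zero_smul,
            add_zero]
          have : ∀ i, N ((N ^ i) a) = (N ^ (i + 1)) a := fun i => by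
            rw [pow_succ', Module.End.mul_apply]
          simp only [this, hk, smul_zero, add_zero]
      · have : (0 : D) = ∑ i ∈ Finset.range k, (0 : ℂ) • (N ^ i) a := by simp
        rw [this]
        refine tendsto_finsetSum _ fun i _ => Filter.Tendsto.smul_const ?_ _
        rw [tendsto_zero_iff_norm_tendsto_zero]
        have h1 := (tendsto_pow_mul_exp_atBot i hμ).norm.div_const ((i.factorial : ℝ))
        rw [norm_zero, zero_div] at h1
        refine h1.congr fun s => ?_
        simp only [β, norm_mul, Complex.norm_real, Complex.norm_exp]
        simp [mul_div_right_comm]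
    · have hinj : Function.Injective N := by
        rw [← LinearMap.ker_eq_bot, LinearMap.ker_eq_bot']
        intro v hv
        by_contra hne
        exact hμ (hF μ v hne (by simpa [hN, sub_eq_zero] using hv))
      have h0 : a = 0 := by
        apply hinj.iterate k
        rw [← Module.End.coe_pow, hk, map_zero]
      rw [h0]; exact W.zero_mem
  intro a
  have h1 : ⊤ ≤ W := by
    rw [← Module.End.iSup_maxGenEigenspace_eq_top F]
    exact iSup_le hgen
  exact h1 trivial

end Backward

/-! ### The frequency bound of a storage function, and slow drift trajectories. -/

section StorageFunction

variable {X U : Type} [NormedAddCommGroup X] [InnerProductSpace ℂ X] [FiniteDimensional ℂ X]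
  [NormedAddCommGroup U] [InnerProductSpace ℂ U] [FiniteDimensional ℂ U]

/-- A continuously differentiable positive definite storage function. -/
structure IsStorage (M : X × U →ₗ[ℂ] X) (S : HermForm (X × U)) (V : X → ℝ) : Prop where
  contDiff : ContDiff ℝ 1 V
  zero : V 0 = 0
  pos : ∀ x, x ≠ 0 → 0 < V x
  diss : ∀ f, fderiv ℝ V f.1 (M f) ≤ (S f f).re

variable {M : X × U →ₗ[ℂ] X} {S : HermForm (X × U)} {V : X → ℝ}

lemma IsStorage.differentiable (h : IsStorage M S V) : Differentiable ℝ V :=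
  h.contDiff.differentiable (by norm_num)

lemma hasDerivAt_cexp_mul_I (ω s : ℝ) :
    HasDerivAt (fun t : ℝ => Complex.exp ((ω : ℂ) * Complex.I * t))
      ((ω : ℂ) * Complex.I * Complex.exp ((ω : ℂ) * Complex.I * s)) s := by
  refine (((Complex.ofRealCLM.hasDerivAt (x := s)).const_mul
    ((ω : ℂ) * Complex.I)).cexp).congr_deriv ?_
  simp [mul_comm]

lemma norm_cexp_mul_I (ω s : ℝ) : ‖Complex.exp ((ω : ℂ) * Complex.I * s)‖ = 1 := by
  have : (ω : ℂ) * Complex.I * s = ((ω * s : ℝ) : ℂ) * Complex.I := by push_cast; ring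
  rw [this, Complex.norm_exp_ofReal_mul_I]

/-- The function `θ ↦ V (e^{iθ} x)` is periodic, so by Rolle its derivative vanishes for some `θ`.
At that point the gradient does not see the direction `i e^{iθ} x`, and the dissipation inequality
bounds the supply from below by the gradient applied to the detuned residual alone. Scaling `f` to
norm one keeps the state in the unit ball, where the gradient is bounded by `L`; the constant is
even uniform in the frequency. -/
theorem IsStorage.frequencyBound (h : IsStorage M S V) : FrequencyBound M S := by
  have : ProperSpace X := FiniteDimensional.proper ℂ X
  obtain ⟨L, hL⟩ := (isCompact_closedBall (0 : X) 1).exists_bound_of_continuousOn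
    (h.contDiff.continuous_fderiv (by norm_num)).continuousOn
  have hL0 : 0 ≤ L := (norm_nonneg _).trans (hL 0 (by simp))
  refine fun R => ⟨L, hL0, fun ω _ f => ?_⟩
  by_cases hf : f = 0
  · simp [hf]
  have hn : 0 < ‖f‖ := norm_pos_iff.2 hf
  obtain ⟨c, hc⟩ : ∃ c : ℝ, c = ‖f‖⁻¹ := ⟨_, rfl⟩
  have hc0 : 0 < c := by rw [hc]; positivity
  let x : X := (c : ℂ) • f.1
  have hx : ‖x‖ ≤ 1 := by
    rw [norm_smul, Complex.norm_real, Real.norm_eq_abs, abs_of_pos hc0, hc, inv_mul_le_one₀ hn]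
    exact norm_fst_le f
  let E : ℝ → ℂ := fun t => Complex.exp (((1 : ℝ) : ℂ) * Complex.I * t)
  have hE : ∀ s, HasDerivAt E (((1 : ℝ) : ℂ) * Complex.I * E s) s := hasDerivAt_cexp_mul_I 1
  have hEn : ∀ s, ‖E s‖ = 1 := norm_cexp_mul_I 1
  have hg : ∀ s, HasDerivAt (fun t => V (E t • x))
      (fderiv ℝ V (E s • x) ((((1 : ℝ) : ℂ) * Complex.I * E s) • x)) s := fun s =>
    (h.differentiable (E s • x)).hasFDerivAt.comp_hasDerivAt s ((hE s).smul_const x)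
  obtain ⟨θ, -, hθ⟩ := exists_hasDerivAt_eq_zero (f := fun t => V (E t • x))
    (a := 0) (b := 2 * Real.pi) (by positivity)
    (fun s _ => (hg s).continuousAt.continuousWithinAt) (by
      have h1 : E 0 = 1 := by simp [E]
      have h2 : E (2 * Real.pi) = 1 := by
        simp only [E]
        rw [show ((1 : ℝ) : ℂ) * Complex.I * ((2 * Real.pi : ℝ) : ℂ)
          = 2 * Real.pi * Complex.I by push_cast; ring]
        exact Complex.exp_two_pi_mul_I
      simp only [h1, h2]) (fun s _ => hg s)
  have h1 := h.diss ((E θ * c) • f)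
  have h2 : M ((E θ * c) • f) = (E θ * c) • detune M ω f
      + ω • ((((1 : ℝ) : ℂ) * Complex.I * E θ) • x) := by
    rw [map_smul, detune_apply, ← Complex.coe_smul]
    simp only [x, smul_sub, smul_smul]
    rw [show E θ * (c : ℂ) * ((ω : ℂ) * Complex.I) = (ω : ℂ) * (((1 : ℝ) : ℂ) * Complex.I * E θ * c) by
      push_cast; ring]
    abel
  have h3 : ((E θ * c) • f).1 = E θ • x := by
    simp only [x, smul_smul, Prod.smul_fst]
  rw [h2, h3, map_add, map_smul (fderiv ℝ V (E θ • x)) ω, hθ, smul_zero, add_zero, S.quad_smul, norm_mul, hEn, one_mul,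
    Complex.norm_real, Real.norm_eq_abs, abs_of_pos hc0] at h1
  have h4 : ‖fderiv ℝ V (E θ • x) ((E θ * c) • detune M ω f)‖ ≤ L * (c * ‖detune M ω f‖) := by
    refine (ContinuousLinearMap.le_opNorm _ _).trans ?_
    rw [norm_smul, norm_mul, hEn, one_mul, Complex.norm_real, Real.norm_eq_abs, abs_of_pos hc0]
    gcongr
    apply hL
    rw [mem_closedBall_zero_iff, norm_smul, hEn, one_mul]
    exact hx
  have h5 : -(L * (c * ‖detune M ω f‖)) ≤ c ^ 2 * (S f f).re :=
    ((abs_le.1 h4).1).trans h1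
  have h6 : ‖f‖ ^ 2 * -(L * (c * ‖detune M ω f‖)) ≤ ‖f‖ ^ 2 * (c ^ 2 * (S f f).re) := by gcongr
  have hcf : ‖f‖ * c = 1 := by rw [hc]; field_simp
  have e1 : ‖f‖ ^ 2 * -(L * (c * ‖detune M ω f‖)) = -(L * ‖f‖ * ‖detune M ω f‖) := by
    linear_combination (-(L * ‖f‖ * ‖detune M ω f‖)) * hcf
  have e2 : ‖f‖ ^ 2 * (c ^ 2 * (S f f).re) = (S f f).re := by
    linear_combination (‖f‖ * c + 1) * (S f f).re * hcf
  linarith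

/-- States that are reached from the neighbourhood of the origin by slow trajectories of
vanishing cost. -/
def driftable (M : X × U →ₗ[ℂ] X) {S : HermForm (X × U)} (hS : S.PosSemidef) : Submodule ℂ X where
  carrier := {y | ∃ c : ℝ, 0 ≤ c ∧ ∀ T : ℝ, 1 ≤ T → ∃ g : ℝ → X × U,
    (∀ s, HasDerivAt (fun t => (g t).1) (M (g s)) s) ∧ ‖(g 0).1 - y‖ ≤ c / T ∧
    ‖(g (-T)).1‖ ≤ c / T ∧ ∀ s ∈ Set.Icc (-T) 0, (S (g s) (g s)).re ≤ c / T ^ 2}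
  zero_mem' := ⟨0, le_rfl, fun T _ => ⟨fun _ => 0, fun s => by
    simpa using hasDerivAt_const s (0 : X), by simp, by simp, fun s _ => by simp⟩⟩
  add_mem' := by
    rintro y y' ⟨c, hc, h⟩ ⟨c', hc', h'⟩
    refine ⟨2 * c + 2 * c', by positivity, fun T hT => ?_⟩
    obtain ⟨g, h1, h2, h3, h4⟩ := h T hT
    obtain ⟨g', h1', h2', h3', h4'⟩ := h' T hT
    have hT0 : 0 < T := by linarith
    have e1 : 0 ≤ c / T := by positivity
    have e2 : 0 ≤ c' / T := by positivity
    have e3 : (2 * c + 2 * c') / T = 2 * (c / T) + 2 * (c' / T) := by ring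
    have e4 : (2 * c + 2 * c') / T ^ 2 = 2 * (c / T ^ 2) + 2 * (c' / T ^ 2) := by ring
    refine ⟨fun s => g s + g' s, fun s => ?_, ?_, ?_, fun s hs => ?_⟩
    · rw [map_add]; exact (h1 s).add (h1' s)
    · have : (g 0 + g' 0).1 - (y + y') = ((g 0).1 - y) + ((g' 0).1 - y') := by
        rw [Prod.fst_add]; abel
      rw [this, e3]
      exact (norm_add_le _ _).trans (by linarith)
    · rw [e3, Prod.fst_add]
      exact (norm_add_le _ _).trans (by linarith)
    · have := hS.quad_add_le one_pos (g s) (g' s)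
      have := h4 s hs
      have := h4' s hs
      rw [e4]
      norm_num at *
      linarith
  smul_mem' := by
    rintro l y ⟨c, hc, h⟩
    refine ⟨(‖l‖ + ‖l‖ ^ 2) * c, by positivity, fun T hT => ?_⟩
    obtain ⟨g, h1, h2, h3, h4⟩ := h T hT
    have hT0 : 0 < T := by linarith
    have e1 : ‖l‖ * (c / T) ≤ (‖l‖ + ‖l‖ ^ 2) * c / T := by
      have : 0 ≤ ‖l‖ ^ 2 * c / T := by positivity
      have e : (‖l‖ + ‖l‖ ^ 2) * c / T = ‖l‖ * (c / T) + ‖l‖ ^ 2 * c / T := by ring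
      linarith
    refine ⟨fun s => l • g s, fun s => ?_, ?_, ?_, fun s hs => ?_⟩
    · rw [map_smul]; exact (h1 s).const_smul l
    · rw [Prod.smul_fst, ← smul_sub, norm_smul]
      exact (mul_le_mul_of_nonneg_left h2 (norm_nonneg _)).trans e1
    · rw [Prod.smul_fst, norm_smul]
      exact (mul_le_mul_of_nonneg_left h3 (norm_nonneg _)).trans e1
    · rw [S.quad_smul]
      have e2 := mul_le_mul_of_nonneg_left (h4 s hs) (sq_nonneg ‖l‖)
      have : 0 ≤ ‖l‖ * c / T ^ 2 := by positivity
      have e : (‖l‖ + ‖l‖ ^ 2) * c / T ^ 2 = ‖l‖ ^ 2 * (c / T ^ 2) + ‖l‖ * c / T ^ 2 := by ring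
      linarith

open Polynomial in
/-- The profile of a slow drift along a chain of length `2 m + 2`. -/
lemma exists_drift_profile (m : ℕ) :
    ∃ P : ℕ → ℝ → ℝ, (∀ k t, HasDerivAt (P k) (P (k + 1) t) t) ∧ (∀ t, P (2 * m + 2) t = 0) ∧
      (∀ k < m, P k 0 = 0) ∧ P m 0 = 1 ∧ ∀ k ≤ m, P k (-1) = 0 := by
  -- Degree `2 m + 1`, a zero of order `m` at `0` with `m`-th derivative `1`, and a zero of order `m
  -- + 1` at `-1`.
  let p : ℝ[X] := X ^ m * (C ((m.factorial : ℝ)⁻¹) * (X + C 1) ^ (m + 1))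
  have hcoeff : ∀ k, (derivative^[k] p).eval 0 = k.factorial * p.coeff k := fun k => by
    rw [← coeff_zero_eq_eval_zero, coeff_iterate_derivative, zero_add, Nat.descFactorial_self,
      nsmul_eq_mul]
  refine ⟨fun k t => (derivative^[k] p).eval t, fun k t => ?_, fun t => ?_, fun k hk => ?_, ?_,
    fun k hk => ?_⟩
  · simp only [Function.iterate_succ_apply']
    exact (derivative^[k] p).hasDerivAt t
  · have hdeg : p.natDegree < 2 * m + 2 := by
      have h1 : p.natDegree ≤ m + (0 + (m + 1)) := by
        refine natDegree_mul_le_of_le (natDegree_X_pow_le m) (natDegree_mul_le_of_le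
          (natDegree_C _).le ?_)
        refine (natDegree_pow_le_of_le (m + 1) (natDegree_X_add_C (1 : ℝ)).le).trans (by simp)
      omega
    simp only [iterate_derivative_eq_zero hdeg, eval_zero]
  · simp only
    rw [hcoeff, coeff_X_pow_mul', if_neg (by omega), mul_zero]
  · simp only
    rw [hcoeff, coeff_X_pow_mul', if_pos le_rfl, Nat.sub_self, coeff_C_mul, coeff_zero_eq_eval_zero]
    have : (m.factorial : ℝ) ≠ 0 := by exact_mod_cast Nat.factorial_ne_zero m
    simp [this]
  · have h1 : (X + C (1 : ℝ)) ^ (m + 1) ∣ p := ⟨X ^ m * C ((m.factorial : ℝ)⁻¹), by simp only [p]; ring⟩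
    have h2 := pow_sub_dvd_iterate_derivative_of_pow_dvd k h1
    have h3 : (X + C (1 : ℝ)) ∣ derivative^[k] p :=
      (dvd_pow_self _ (by omega)).trans h2
    obtain ⟨q, hq⟩ := h3
    simp only
    rw [hq]; simp

/-- The combination `e^{iω s} ∑ Q k s • φ k` with `Q k' = Q (k + 1)` is a trajectory because of the
chain relation. With `Q k s = T ^ (m - k) * P k (s / T)` the terms `k ≤ m` may be large, but they
are null vectors of the cost, lead from `0` at time `-T` to `f 0` at time `0`, and leave only the
terms `k > m`, which are `O (1 / T)`. -/
lemma IsDriftChain.driftable (hS : S.PosSemidef) {ω : ℝ} {j : ℕ} {f : ℤ → X × U}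
    (hf : IsDriftChain M S ω j f) : (f 0).1 ∈ driftable M hS := by
  cases j with
  | zero =>
    rw [hf.eq_zero 0 (by simp)]
    exact (_root_.driftable M hS).zero_mem
  | succ m =>
    obtain ⟨P, hP, hPtop, hP0, hP1, hPm⟩ := exists_drift_profile m
    -- The index is shifted so that the first possibly nonzero member is `φ 0`, the last one used is
    -- `φ (2 * m + 1)`, and the drift state belongs to `φ m`.
    let φ : ℕ → X × U := fun k => f ((k : ℤ) - m)
    have hφm : φ m = f 0 := by simp [φ]
    have hφ0 : M (φ 0) = ((ω : ℂ) * Complex.I) • (φ 0).1 := by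
      have h1 := hf.chain (((0 : ℕ) : ℤ) - m) (by push_cast; omega)
      rw [hf.eq_zero (((0 : ℕ) : ℤ) - m - 1) (by push_cast; omega), detune_apply] at h1
      exact sub_eq_zero.1 h1
    have hφ : ∀ k < 2 * m + 1, M (φ (k + 1)) = ((ω : ℂ) * Complex.I) • (φ (k + 1)).1 + (φ k).1 := by
      intro k hk
      have h1 := hf.chain (((k + 1 : ℕ) : ℤ) - m) (by push_cast; omega)
      have h2 : (((k + 1 : ℕ) : ℤ) - m - 1) = (k : ℤ) - m := by push_cast; ring
      rw [h2, detune_apply, sub_eq_iff_eq_add'] at h1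
      exact h1
    have hbd : ∀ k, ∃ B, ∀ t ∈ Set.Icc (-1 : ℝ) 0, ‖P k t‖ ≤ B := fun k =>
      isCompact_Icc.exists_bound_of_continuousOn
        fun t _ => (hP k t).continuousAt.continuousWithinAt
    choose B hB using hbd
    have hB0 : ∀ k, 0 ≤ B k := fun k => (norm_nonneg _).trans (hB k 0 (by simp))
    obtain ⟨C, hC, hSbd⟩ := S.exists_bound
    set c₀ := ∑ k ∈ Finset.range (2 * m + 2), B k * ‖φ k‖ with hc₀
    have hc₀0 : 0 ≤ c₀ := Finset.sum_nonneg fun k _ => mul_nonneg (hB0 k) (norm_nonneg _)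
    refine ⟨c₀ + C * c₀ ^ 2, by positivity, fun T hT => ?_⟩
    have hT0 : 0 < T := by linarith
    let Q : ℕ → ℝ → ℝ := fun k s => T ^ m * (T⁻¹) ^ k * P k (s / T)
    have hQ : ∀ k s, HasDerivAt (Q k) (Q (k + 1) s) s := fun k s => by
      have h1 : HasDerivAt (fun s : ℝ => s / T) (1 / T) s := (hasDerivAt_id s).div_const T
      refine (((hP k (s / T)).comp s h1).const_mul (T ^ m * (T⁻¹) ^ k)).congr_deriv ?_
      simp only [Q, pow_succ]
      ring
    let E : ℝ → ℂ := fun t => Complex.exp ((ω : ℂ) * Complex.I * t)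
    have hE : ∀ s, HasDerivAt E ((ω : ℂ) * Complex.I * E s) s := hasDerivAt_cexp_mul_I ω
    have hEn : ∀ s, ‖E s‖ = 1 := norm_cexp_mul_I ω
    let lo : ℝ → X × U := fun s => ∑ k ∈ Finset.range (2 * m + 2) with k ≤ m, (Q k s : ℂ) • φ k
    let hi : ℝ → X × U := fun s => ∑ k ∈ Finset.range (2 * m + 2) with ¬ k ≤ m, (Q k s : ℂ) • φ k
    let G : ℝ → X × U := fun s => ∑ k ∈ Finset.range (2 * m + 2), (Q k s : ℂ) • φ k
    have hG : ∀ s, G s = lo s + hi s := fun s =>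
      (Finset.sum_filter_add_sum_filter_not _ _ _).symm
    have hhi : ∀ s ∈ Set.Icc (-T) 0, ‖hi s‖ ≤ c₀ / T := fun s hs => by
      refine (norm_sum_le _ _).trans ?_
      have h1 : ∀ k ∈ (Finset.range (2 * m + 2)).filter (fun k => ¬ k ≤ m),
          ‖(Q k s : ℂ) • φ k‖ ≤ B k * ‖φ k‖ / T := by
        intro k hk
        have hkm : m < k := not_le.1 (Finset.mem_filter.1 hk).2
        have ht : s / T ∈ Set.Icc (-1 : ℝ) 0 := by
          constructor
          · rw [le_div_iff₀ hT0]; linarith [hs.1]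
          · exact div_nonpos_of_nonpos_of_nonneg hs.2 hT0.le
        have h2 := hB k _ ht
        have h3 : T ^ m * (T⁻¹) ^ k ≤ T⁻¹ := by
          obtain ⟨n, rfl⟩ := Nat.exists_eq_add_of_lt hkm
          rw [pow_add, pow_add, ← mul_assoc, ← mul_assoc, ← mul_pow, mul_inv_cancel₀ hT0.ne',
            one_pow, one_mul, pow_one]
          have h4 : (T⁻¹) ^ n ≤ 1 := pow_le_one₀ (by positivity) (inv_le_one_of_one_le₀ hT)
          have h5 : 0 ≤ T⁻¹ := by positivity
          nlinarith
        rw [norm_smul, Complex.norm_real]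
        simp only [Q, norm_mul, norm_pow, norm_inv, Real.norm_eq_abs, abs_of_pos hT0]
        rw [Real.norm_eq_abs] at h2
        calc T ^ m * T⁻¹ ^ k * |P k (s / T)| * ‖φ k‖ ≤ T⁻¹ * B k * ‖φ k‖ := by gcongr
          _ = B k * ‖φ k‖ / T := by ring
      refine (Finset.sum_le_sum h1).trans ?_
      rw [← Finset.sum_div, hc₀]
      gcongr
      · exact fun k _ _ => mul_nonneg (hB0 k) (norm_nonneg _)
      · exact Finset.filter_subset _ _
    have hlo0 : lo 0 = f 0 := by
      simp only [lo]
      rw [Finset.sum_eq_single_of_mem m (by simp; omega)]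
      · simp [Q, hP1, hφm, hT0.ne']
      · intro k hk hne
        have hkm := (Finset.mem_filter.1 hk).2
        simp [Q, hP0 k (by omega)]
    have hloT : lo (-T) = 0 := by
      refine Finset.sum_eq_zero fun k hk => ?_
      have hkm := (Finset.mem_filter.1 hk).2
      have : -T / T = -1 := by field_simp
      simp [Q, this, hPm k hkm]
    have hnull : ∀ s, (S (lo s) (lo s)).re = 0 := fun s => by
      have : lo s ∈ hS.null := Submodule.sum_mem _ fun k hk => Submodule.smul_mem _ _ (by
        have hkm := (Finset.mem_filter.1 hk).2
        exact hf.null _ (by omega))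
      exact this
    have hmono : c₀ / T ≤ (c₀ + C * c₀ ^ 2) / T := by
      gcongr
      have : 0 ≤ C * c₀ ^ 2 := by positivity
      linarith
    refine ⟨fun s => E s • G s, fun s => ?_, ?_, ?_, fun s hs => ?_⟩
    · have hd : ∀ k ∈ Finset.range (2 * m + 2), HasDerivAt (fun s => (Q k s : ℂ) • (φ k).1)
          ((Q (k + 1) s : ℂ) • (φ k).1) s := fun k _ => (hQ k s).ofReal_comp.smul_const _
      have h1 := (hE s).smul (HasDerivAt.fun_sum hd)
      have h2 : ∀ t, (E t • G t).1 = E t • ∑ k ∈ Finset.range (2 * m + 2), (Q k t : ℂ) • (φ k).1 :=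
        fun t => by simp only [G, Prod.smul_fst, Prod.fst_sum]
      simp only [h2]
      refine h1.congr_deriv ?_
      have h3 : ∑ k ∈ Finset.range (2 * m + 2), (Q k s : ℂ) • M (φ k)
          = ((ω : ℂ) * Complex.I) • ∑ k ∈ Finset.range (2 * m + 2), (Q k s : ℂ) • (φ k).1
            + ∑ k ∈ Finset.range (2 * m + 2), (Q (k + 1) s : ℂ) • (φ k).1 := by
        have h4 : Q (2 * m + 1 + 1) s = 0 := by simp [Q, hPtop]
        conv_rhs => rw [Finset.sum_range_succ (fun k => (Q (k + 1) s : ℂ) • (φ k).1), h4]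
        rw [Finset.sum_range_succ', Finset.sum_range_succ' (fun k => (Q k s : ℂ) • (φ k).1), hφ0,
          Finset.sum_congr rfl fun k hk => by rw [hφ k (Finset.mem_range.1 hk), smul_add]]
        rw [Finset.sum_add_distrib, smul_add, Finset.smul_sum]
        simp only [smul_comm ((ω : ℂ) * Complex.I), Complex.ofReal_zero, zero_smul, add_zero]
        abel
      simp only [G, map_smul, map_sum]
      rw [h3, smul_add, smul_smul, mul_comm (E s), add_comm]
    · have h1 : E 0 = 1 := by simp [E]
      have h2 : (E 0 • G 0).1 - (f 0).1 = (hi 0).1 := by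
        rw [h1, one_smul, hG, hlo0, Prod.fst_add]; abel
      rw [h2]
      exact (norm_fst_le _).trans ((hhi 0 ⟨by linarith, le_rfl⟩).trans hmono)
    · have h2 : (E (-T) • G (-T)).1 = E (-T) • (hi (-T)).1 := by
        rw [hG, hloT, zero_add, Prod.smul_fst]
      rw [h2, norm_smul, hEn, one_mul]
      exact (norm_fst_le _).trans ((hhi (-T) ⟨le_rfl, by linarith⟩).trans hmono)
    · have h1 := (Complex.re_le_norm _).trans (hSbd (hi s) (hi s))
      have h2 := hhi s hs
      rw [S.quad_smul, hEn, hG, S.quad_add, hnull, hS.apply_eq_zero (hnull s)]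
      have h3 : C * ‖hi s‖ * ‖hi s‖ ≤ C * (c₀ / T) * (c₀ / T) := by gcongr
      have h4 : C * (c₀ / T) * (c₀ / T) = C * c₀ ^ 2 / T ^ 2 := by field_simp
      have h5 : (c₀ + C * c₀ ^ 2) / T ^ 2 = c₀ / T ^ 2 + C * c₀ ^ 2 / T ^ 2 := by ring
      have h6 : 0 ≤ c₀ / T ^ 2 := by positivity
      simp only [one_pow, one_mul, Complex.zero_re, mul_zero, zero_add]
      linarith

lemma driftSpace_le_driftable (hS : S.PosSemidef) : driftSpace M S ≤ driftable M hS := by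
  refine Submodule.span_le.2 ?_
  rintro _ ⟨ω, j, f, hf, rfl⟩
  exact hf.driftable hS

end StorageFunction

/-! ### Positivity of quadratic storages on reachable states. -/

section PositiveStorage

variable {X U : Type} [NormedAddCommGroup X] [InnerProductSpace ℂ X] [FiniteDimensional ℂ X]
  [NormedAddCommGroup U] [InnerProductSpace ℂ U] [FiniteDimensional ℂ U]
  {M : X × U →ₗ[ℂ] X} {S : HermForm (X × U)} {V : X → ℝ}

/-- The storage function decreases along the superposition of an antistable and a slow
trajectory, up to the supplied energy. -/
lemma IsStorage.le_along_trajectory (h : IsStorage M S V) {P : HermForm X}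
    (hS : (dissipation M S P).PosSemidef) {D : Type} [NormedAddCommGroup D]
    [InnerProductSpace ℂ D] [FiniteDimensional ℂ D] {F : D →ₗ[ℂ] D} {Φ : D →ₗ[ℂ] X × U}
    {K : HermForm D} (hΦ : ∀ a, M (Φ a) = (Φ (F a)).1)
    (hK : ∀ a b, K (F a) b + K a (F b) = dissipation M S P (Φ a) (Φ b)) {α : ℝ → D}
    (hα : ∀ s, HasDerivAt α (F (α s)) s) {g : ℝ → X × U}
    (hg : ∀ s, HasDerivAt (fun t => (g t).1) (M (g s)) s) {T c δ : ℝ} (hT : 0 < T)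
    (hc : ∀ s ∈ Set.Icc (-T) 0, (dissipation M S P (g s) (g s)).re ≤ c) (hδ : 0 < δ) :
    V ((Φ (α 0)).1 + (g 0).1)
        - (P ((Φ (α 0)).1 + (g 0).1) ((Φ (α 0)).1 + (g 0).1)).re - (1 + δ) * (K (α 0) (α 0)).re
      ≤ V ((Φ (α (-T))).1 + (g (-T)).1)
        - (P ((Φ (α (-T))).1 + (g (-T)).1) ((Φ (α (-T))).1 + (g (-T)).1)).re
        - (1 + δ) * (K (α (-T)) (α (-T))).re + (1 + δ⁻¹) * c * T := by
  let tr : ℝ → X × U := fun s => Φ (α s) + g s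
  let ξ : ℝ → X := fun s => (Φ (α s)).1 + (g s).1
  have hξ : ∀ s, HasDerivAt ξ (M (tr s)) s := fun s => by
    let L : D →ₗ[ℝ] X := (LinearMap.fst ℂ X U ∘ₗ Φ).restrictScalars ℝ
    have : FiniteDimensional ℝ D := FiniteDimensional.complexToReal D
    have h1 : HasDerivAt (fun t => L (α t)) (L (F (α s))) s :=
      (LinearMap.toContinuousLinearMap L).hasFDerivAt.comp_hasDerivAt s (hα s)
    have h2 : L (F (α s)) = M (Φ (α s)) := (hΦ _).symm
    rw [h2] at h1
    rw [map_add]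
    exact h1.add (hg s)
  -- Monotone because `V` gains at most the supply, and the dissipation of the superposition is at
  -- most `1 + δ` times that of the antistable part, which is the derivative of `K`, plus `1 + δ⁻¹`
  -- times that of the slow part.
  let H : ℝ → ℝ := fun s => V (ξ s) - (P (ξ s) (ξ s)).re - (1 + δ) * (K (α s) (α s)).re
    - (1 + δ⁻¹) * c * s
  have hH : ∀ s, HasDerivAt H (fderiv ℝ V (ξ s) (M (tr s)) - 2 * (P (ξ s) (M (tr s))).re
      - (1 + δ) * (2 * (K (α s) (F (α s))).re) - (1 + δ⁻¹) * c * 1) s := fun s =>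
    ((((h.differentiable (ξ s)).hasFDerivAt.comp_hasDerivAt s (hξ s)).sub
      (P.hasDerivAt_quad (hξ s))).sub ((K.hasDerivAt_quad (hα s)).const_mul (1 + δ))).sub
      ((hasDerivAt_id s).const_mul ((1 + δ⁻¹) * c))
  have hle : AntitoneOn H (Set.Icc (-T) 0) := by
    refine antitoneOn_of_deriv_nonpos (convex_Icc _ _)
      (fun s _ => (hH s).continuousAt.continuousWithinAt)
      (fun s _ => (hH s).differentiableAt.differentiableWithinAt) fun s hs => ?_
    rw [interior_Icc] at hs
    rw [(hH s).deriv]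
    have h1 := h.diss (tr s)
    have h2 := hS.quad_add_le hδ (Φ (α s)) (g s)
    have h3 : (dissipation M S P (Φ (α s)) (Φ (α s))).re = 2 * (K (α s) (F (α s))).re := by
      rw [← hK, Complex.add_re, K.re_symm (α s)]; ring
    have h4 := hc s ⟨hs.1.le, hs.2.le⟩
    have h5 : (dissipation M S P (tr s) (tr s)).re = (S (tr s) (tr s)).re
        - 2 * (P (ξ s) (M (tr s))).re := dissipation_quad M S P (tr s)
    have h6 : (dissipation M S P (tr s) (tr s)).re ≤ (1 + δ) *
      (dissipation M S P (Φ (α s)) (Φ (α s))).re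
        + (1 + δ⁻¹) * (dissipation M S P (g s) (g s)).re := h2
    have h7 : (1 + δ⁻¹) * (dissipation M S P (g s) (g s)).re ≤ (1 + δ⁻¹) * c :=
      mul_le_mul_of_nonneg_left h4 (by positivity)
    have h8 : fderiv ℝ V (ξ s) (M (tr s)) ≤ (S (tr s) (tr s)).re := h1
    rw [h3] at h6
    linarith
  have h1 := hle ⟨le_rfl, by linarith⟩ ⟨by linarith, le_rfl⟩ (by linarith : -T ≤ (0 : ℝ))
  simp only [H, ξ] at h1
  linarith

/-- A trajectory starting near the origin at time `-T` ends near `w = (Φ a).1 + y` at time `0`. The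
slow part costs at most `c / T ^ 2` per unit time, hence `c / T` in total. Letting `T → ∞` and then
`δ → 0` gives `V w ≤ P w w + K a a`, and the left side is positive. -/
theorem IsStorage.storagePositive (h : IsStorage M S V) {P : HermForm X}
    (hS : (dissipation M S P).PosSemidef) : StoragePositive M (dissipation M S P) P := by
  intro D _ _ _ F Φ K hF hΦ hK a y hy hne
  obtain ⟨c, hc, hdr⟩ := driftSpace_le_driftable hS hy
  obtain ⟨α, hα0, hα, hαlim⟩ := hF.exists_decaying_solution a
  choose! g hg1 hg2 hg3 hg4 using hdr
  set w := (Φ a).1 + y with hw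
  have hV : Continuous V := h.contDiff.continuous
  have hcT : Filter.Tendsto (fun T : ℝ => c / T) Filter.atTop (nhds 0) :=
    tendsto_const_nhds.div_atTop Filter.tendsto_id
  have hlim0 : Filter.Tendsto (fun T => (Φ (α 0)).1 + (g T 0).1) Filter.atTop (nhds w) := by
    rw [hα0]
    refine Filter.Tendsto.const_add _ ?_
    rw [tendsto_iff_norm_sub_tendsto_zero]
    refine squeeze_zero' (Filter.Eventually.of_forall fun _ => norm_nonneg _) ?_ hcT
    filter_upwards [Filter.eventually_ge_atTop 1] with T hT using hg2 T hT
  have hαT : Filter.Tendsto (fun T : ℝ => α (-T)) Filter.atTop (nhds 0) :=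
    hαlim.comp Filter.tendsto_neg_atTop_atBot
  have hlimT : Filter.Tendsto (fun T => (Φ (α (-T))).1 + (g T (-T)).1) Filter.atTop (nhds 0) := by
    have h1 : Continuous fun b : D => (Φ b).1 :=
      (LinearMap.fst ℂ X U ∘ₗ Φ).continuous_of_finiteDimensional
    have h2 := (h1.tendsto 0).comp hαT
    have h3 : Filter.Tendsto (fun T => (g T (-T)).1) Filter.atTop (nhds 0) := by
      rw [tendsto_zero_iff_norm_tendsto_zero]
      refine squeeze_zero' (Filter.Eventually.of_forall fun _ => norm_nonneg _) ?_ hcT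
      filter_upwards [Filter.eventually_ge_atTop 1] with T hT using hg3 T hT
    simpa using h2.add h3
  have key : ∀ δ : ℝ, 0 < δ → V w - (P w w).re - (1 + δ) * (K a a).re ≤ 0 := fun δ hδ => by
    have hleft : Filter.Tendsto (fun T => V ((Φ (α 0)).1 + (g T 0).1)
        - (P ((Φ (α 0)).1 + (g T 0).1) ((Φ (α 0)).1 + (g T 0).1)).re
        - (1 + δ) * (K (α 0) (α 0)).re) Filter.atTop
        (nhds (V w - (P w w).re - (1 + δ) * (K a a).re)) := by
      have h1 := (hV.tendsto w).comp hlim0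
      have h2 := (P.continuous_quad.tendsto w).comp hlim0
      rw [hα0]
      rw [hα0] at h1 h2
      exact (h1.sub h2).sub tendsto_const_nhds
    have hright : Filter.Tendsto (fun T => V ((Φ (α (-T))).1 + (g T (-T)).1)
        - (P ((Φ (α (-T))).1 + (g T (-T)).1) ((Φ (α (-T))).1 + (g T (-T)).1)).re
        - (1 + δ) * (K (α (-T)) (α (-T))).re + (1 + δ⁻¹) * (c / T)) Filter.atTop (nhds 0) := by
      have h1 := (hV.tendsto 0).comp hlimT
      have h2 := (P.continuous_quad.tendsto 0).comp hlimT
      have h3 := ((K.continuous_quad.tendsto 0).comp hαT).const_mul (1 + δ)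
      have h4 := ((h1.sub h2).sub h3).add (hcT.const_mul (1 + δ⁻¹))
      simpa [h.zero] using h4
    refine le_of_tendsto_of_tendsto hleft hright ?_
    filter_upwards [Filter.eventually_ge_atTop 1] with T hT
    have hT0 : 0 < T := by linarith
    have h1 := h.le_along_trajectory hS hΦ hK hα (hg1 T hT) hT0 (hg4 T hT) hδ
    have h2 : (1 + δ⁻¹) * (c / T ^ 2) * T = (1 + δ⁻¹) * (c / T) := by field_simp
    rw [h2] at h1
    exact h1
  have hpos := h.pos w hne
  have hle : V w - (P w w).re - (K a a).re ≤ 0 := by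
    refine le_of_forall_pos_le_add fun ε hε => ?_
    have h1 := key (ε / (|(K a a).re| + 1)) (by positivity)
    have h2 : ε / (|(K a a).re| + 1) * (K a a).re ≤ ε := by
      have h3 : (K a a).re ≤ |(K a a).re| + 1 := (le_abs_self _).trans (by linarith)
      calc ε / (|(K a a).re| + 1) * (K a a).re ≤ ε / (|(K a a).re| + 1) * (|(K a a).re| + 1) := by
            gcongr
        _ = ε := by field_simp
    linarith
  linarith

/-- A regular system with a storage function has a positive definite quadratic one. -/
theorem IsStorage.exists_quadratic_of_regular (h : IsStorage M S V) (hreg : RegularSupply S) :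
    ∃ P : HermForm X, P.PosDef ∧ (dissipation M S P).PosSemidef := by
  obtain ⟨P₀, hP₀⟩ := exists_storage_of_frequencyBound _ X M S rfl hreg h.frequencyBound
  exact exists_posDef_storage _ X M S P₀ rfl hreg hP₀ (h.storagePositive hP₀)

end PositiveStorage

/-! ### Elimination of inputs without supply. -/

section SingularInputs

variable {X U : Type} [NormedAddCommGroup X] [InnerProductSpace ℂ X] [FiniteDimensional ℂ X]
  [NormedAddCommGroup U] [InnerProductSpace ℂ U] [FiniteDimensional ℂ U]
  {M : X × U →ₗ[ℂ] X} {S : HermForm (X × U)} {V : X → ℝ}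

/-- The origin minimizes the storage function, so its gradient vanishes there. -/
lemma IsStorage.input_nonneg (h : IsStorage M S V) (f : X × U) (hf : f.1 = 0) :
    0 ≤ (S f f).re := by
  have h1 : fderiv ℝ V 0 = 0 := by
    apply IsLocalMin.fderiv_eq_zero
    refine Filter.Eventually.of_forall fun x => ?_
    rw [h.zero]
    by_cases hx : x = 0
    · rw [hx, h.zero]
    · exact (h.pos x hx).le
  have h2 := h.diss f
  rw [hf, h1] at h2
  simpa using h2

/-- The gradient of the storage function along a cheap input direction. -/
lemma IsStorage.fderiv_cheap (h : IsStorage M S V) {v : X × U} (hv : v.1 = 0)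
    (hv0 : (S v v).re = 0) (x : X) (l : ℂ) :
    fderiv ℝ V x (l • M v) = 2 * (star l * S v (x, 0)).re := by
  -- As `S v v = 0`, both sides of the dissipation inequality at `r l v + (x, 0)` are affine in `r`;
  -- validity for all real `r` forces equal slopes.
  have key : ∀ r : ℝ, r * (fderiv ℝ V x (l • M v) - 2 * (star l * S v (x, 0)).re)
      ≤ (S (x, 0) (x, 0)).re - fderiv ℝ V x (M (x, 0)) := fun r => by
    have h1 := h.diss ((((r : ℂ) * l) • v) + (x, 0))
    have h2 : ((((r : ℂ) * l) • v) + (x, 0)).1 = x := by simp [hv]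
    have h3 : ((r : ℂ) * l) • M v = r • (l • M v) := by rw [← Complex.coe_smul, smul_smul]
    rw [h2, map_add, map_smul, h3, map_add, map_smul (fderiv ℝ V x) r, S.quad_add, S.quad_smul, hv0,
      S.smul_left, star_mul'] at h1
    simp only [RCLike.star_def, Complex.conj_ofReal, smul_eq_mul, mul_assoc,
      Complex.re_ofReal_mul] at h1 ⊢
    linarith
  set A := fderiv ℝ V x (l • M v) - 2 * (star l * S v (x, 0)).re with hA
  by_contra hne
  have hA0 : A ≠ 0 := sub_ne_zero.2 hne
  have h1 := key (((S (x, 0) (x, 0)).re - fderiv ℝ V x (M (x, 0)) + 1) / A)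
  rw [div_mul_cancel₀ _ hA0] at h1
  linarith

/-- The storage function is quadratic along a cheap input direction. -/
lemma IsStorage.add_cheap (h : IsStorage M S V) {v : X × U} (hv : v.1 = 0)
    (hv0 : (S v v).re = 0) (x : X) (t : ℂ) :
    V (x + t • M v) = V x + 2 * (star t * S v (x, 0)).re + ‖t‖ ^ 2 * (S v (M v, 0)).re := by
  -- The storage along the segment minus the predicted quadratic polynomial; by `fderiv_cheap` its
  -- derivative is zero.
  let H : ℝ → ℝ := fun s => V (x + s • t • M v) - s * (2 * (star t * S v (x, 0)).re)
    - s ^ 2 * (‖t‖ ^ 2 * (S v (M v, 0)).re)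
  have hH : ∀ s, HasDerivAt H 0 s := fun s => by
    have h1 : HasDerivAt (fun s : ℝ => x + s • t • M v) ((1 : ℝ) • t • M v) s :=
      ((hasDerivAt_id s).smul_const _).const_add x
    have h2 := (h.differentiable (x + s • t • M v)).hasFDerivAt.comp_hasDerivAt s h1
    refine ((h2.sub ((hasDerivAt_id s).mul_const _)).sub
      ((hasDerivAt_pow 2 s).mul_const _)).congr_deriv ?_
    have h3 : ((x + s • t • M v, 0) : X × U) = (x, 0) + ((s : ℂ) * t) • (M v, 0) := by
      ext1
      · simp [mul_smul]
      · simp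
    rw [one_smul, h.fderiv_cheap hv hv0, h3, S.add_right, S.smul_right, mul_add, Complex.add_re]
    have h4 : star t * ((s : ℂ) * t * S v (M v, 0)) = ((s * ‖t‖ ^ 2 : ℝ) : ℂ) * S v (M v, 0) := by
      have : star t * t = ((‖t‖ ^ 2 : ℝ) : ℂ) := by
        rw [← Complex.normSq_eq_norm_sq, mul_comm]; exact Complex.mul_conj t
      push_cast at this ⊢
      linear_combination (s : ℂ) * S v (M v, 0) * this
    rw [h4, Complex.re_ofReal_mul]
    norm_num
    ring
  have h1 := is_const_of_deriv_eq_zero (f := H) (fun s => (hH s).differentiableAt)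
    (fun s => (hH s).deriv) 1 0
  simp only [H, one_smul, zero_smul, add_zero, one_mul, zero_mul, sub_zero, one_pow, ne_eq,
    OfNat.ofNat_ne_zero, not_false_eq_true, zero_pow] at h1
  linarith

/-- `S` is semidefinite on pure inputs, so its null vector `v` is orthogonal to all of them. -/
lemma IsStorage.cheap_apply (h : IsStorage M S V) {v : X × U} (hv : v.1 = 0)
    (hv0 : (S v v).re = 0) (f : X × U) : S v f = S v (f.1, 0) := by
  have h1 : S v (0, f.2) = 0 := HermForm.apply_eq_zero_of_quad (p := fun f => f.1 = 0)
    (fun x y hx hy => by rw [Prod.fst_add, hx, hy, add_zero])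
    (fun c x hx => by rw [Prod.smul_fst, hx, smul_zero]) h.input_nonneg hv hv0 rfl
  have h2 : f = (f.1, 0) + (0, f.2) := by simp
  conv_lhs => rw [h2, S.add_right, h1, add_zero]

/-- Moving by `(1 + i) M v` at once, or first by `M v` and then by `i M v`, must give the same value
of `V`; the two formulas differ by twice this imaginary part. -/
lemma IsStorage.cheap_im (h : IsStorage M S V) {v : X × U} (hv : v.1 = 0)
    (hv0 : (S v v).re = 0) : (S v (M v, 0)).im = 0 := by
  have h1 := h.add_cheap hv hv0 0 (1 + Complex.I)
  have h2 := h.add_cheap hv hv0 0 1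
  have h3 := h.add_cheap hv hv0 (M v) Complex.I
  have h0 : S v ((0 : X), (0 : U)) = 0 := S.zero_right v
  have h4 : ‖(1 + Complex.I : ℂ)‖ ^ 2 = 2 := by
    rw [← Complex.normSq_eq_norm_sq, Complex.normSq_apply]; norm_num
  rw [h0, h4] at h1
  rw [h0] at h2
  simp only [zero_add, one_smul, add_smul] at h1 h2
  rw [h3, h2] at h1
  simp at h1
  linarith

/-- An input without any effect can be dropped. -/
lemma exists_quadratic_of_drop_input {v : U} (hM : M (0, v) = 0)
    (hS : ∀ f, S (0, v) f = 0) {W : Submodule ℂ U} (hW : ∀ u, ∃ c : ℂ, u - c • v ∈ W)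
    {P : HermForm X}
    (hP : (dissipation (M ∘ₗ LinearMap.id.prodMap W.subtype)
      (S.comp (LinearMap.id.prodMap W.subtype)) P).PosSemidef) :
    (dissipation M S P).PosSemidef := fun f => by
  obtain ⟨c, hc⟩ := hW f.2
  have h1 := hP (f.1, ⟨f.2 - c • v, hc⟩)
  have h2 : f = c • (0, v) + (f.1, f.2 - c • v) := by
    ext1 <;> simp
  rw [dissipation_quad] at h1
  have h3 : dissipation M S P (0, v) = fun _ => 0 := by
    funext g
    rw [dissipation_apply, hM, hS]; simp
  conv_rhs => rw [h2]
  rw [HermForm.quad_add, HermForm.quad_smul, HermForm.smul_left, h3]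
  simp only [Complex.zero_re, mul_zero, zero_add]
  rw [dissipation_quad]
  exact h1

/-- A cheap input direction that moves the state is turned into a state-independent input. -/
lemma IsStorage.exists_quadratic_of_cheap (h : IsStorage M S V) {v : U}
    (hv0 : (S (0, v) (0, v)).re = 0) (hMv : M (0, v) ≠ 0)
    (ih : ∀ (Y : Submodule ℂ X), Module.finrank ℂ Y < Module.finrank ℂ X →
      ∀ (M' : Y × U →ₗ[ℂ] Y) (S' : HermForm (Y × U)) (V' : Y → ℝ), IsStorage M' S' V' →
      ∃ P : HermForm Y, P.PosDef ∧ (dissipation M' S' P).PosSemidef) :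
    ∃ P : HermForm X, P.PosDef ∧ (dissipation M S P).PosSemidef := by
  set x₀ := M (0, v) with hx₀
  have hv' : v ≠ 0 := fun h0 => hMv (by rw [hx₀, h0]; exact map_zero M)
  let γ : X →ₗ[ℂ] ℂ := S.toDual (0, v) ∘ₗ LinearMap.inl ℂ X U
  have hγ : ∀ x, γ x = S (0, v) (x, 0) := fun x => rfl
  have hSv : ∀ f, S (0, v) f = γ f.1 := fun f => h.cheap_apply rfl hv0 f
  set g₀ := (S (0, v) (x₀, 0)).re with hg₀
  have hγ0 : γ x₀ = (g₀ : ℂ) := by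
    apply Complex.ext
    · rw [hγ]; simp [hg₀]
    · rw [hγ, h.cheap_im rfl hv0]; simp
  have hVadd : ∀ x t, V (x + t • x₀) = V x + 2 * (star t * γ x).re + ‖t‖ ^ 2 * g₀ :=
    h.add_cheap rfl hv0
  have hg₀pos : 0 < g₀ := by
    have h1 := hVadd 0 1
    simp only [zero_add, one_smul, map_zero, mul_zero, h.zero] at h1
    have h2 := h.pos x₀ hMv
    simp at h1
    linarith
  have hg₀' : (g₀ : ℂ) ≠ 0 := by exact_mod_cast hg₀pos.ne'
  let τ : X →ₗ[ℂ] ℂ := (g₀ : ℂ)⁻¹ • γ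
  have hτ0 : τ x₀ = 1 := by simp [τ, hγ0, hg₀']
  have hγτ : ∀ x, γ x = g₀ * τ x := fun x => by simp [τ, hg₀']
  let Y : Submodule ℂ X := LinearMap.ker τ
  let p₀ : X →ₗ[ℂ] X := LinearMap.id - (LinearMap.toSpanSingleton ℂ X x₀) ∘ₗ τ
  have hp₀ : ∀ x, p₀ x = x - τ x • x₀ := fun x => rfl
  let p : X →ₗ[ℂ] Y := p₀.codRestrict Y fun x => by
    rw [LinearMap.mem_ker, hp₀, map_sub, map_smul, hτ0, smul_eq_mul, mul_one, sub_self]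
  have hp : ∀ x, (p x : X) = x - τ x • x₀ := fun x => rfl
  have hpx₀ : p x₀ = 0 := Subtype.ext (by rw [hp, hτ0, one_smul, sub_self]; rfl)
  have hpY : ∀ y : Y, p y = y := fun y => Subtype.ext (by
    have : τ y = 0 := y.2
    rw [hp, this, zero_smul, sub_zero])
  let Pτ : HermForm X := g₀ • (HermForm.ofInner ℂ).comp τ
  have hPτ : ∀ x y, Pτ x y = g₀ * (star (τ x) * τ y) := fun x y => by
    have : inner ℂ (τ x) (τ y) = star (τ x) * τ y := by
      rw [RCLike.inner_apply]; exact mul_comm _ _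
    rw [← this]; rfl
  have hPτq : ∀ x, (Pτ x x).re = ‖τ x‖ ^ 2 * g₀ := fun x => by
    have : (Pτ x x).re = g₀ * ((HermForm.ofInner ℂ) (τ x) (τ x)).re := by
      rw [← Complex.re_ofReal_mul]; rfl
    rw [this, HermForm.ofInner_quad, mul_comm]
  -- Completing the square in the cheap direction: `V` splits into its restriction to `ker τ` and
  -- the quadratic form `Pτ`.
  have hV : ∀ x, V x = V (p x) + (Pτ x x).re := fun x => by
    have h1 := hVadd (p x) (τ x)
    have h2 : γ (p x : X) = 0 := by
      have : τ (p x : X) = 0 := (p x).2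
      rw [hγτ, this, mul_zero]
    rw [h2, mul_zero, Complex.zero_re, mul_zero, add_zero, hp, sub_add_cancel] at h1
    rw [hPτq, h1, ← hp]
  let ρ : U →ₗ[ℂ] ℂ := ((‖v‖ ^ 2 : ℝ) : ℂ)⁻¹ • innerₛₗ ℂ v
  have hρ : ρ v = 1 := by
    have h1 : inner ℂ v v = ((‖v‖ ^ 2 : ℝ) : ℂ) := by
      rw [inner_self_eq_norm_sq_to_K]; norm_cast
    have h2 : ((‖v‖ ^ 2 : ℝ) : ℂ) ≠ 0 := by
      exact_mod_cast (pow_pos (norm_pos_iff.2 hv') 2).ne'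
    change ((‖v‖ ^ 2 : ℝ) : ℂ)⁻¹ * inner ℂ v v = 1
    rw [h1, inv_mul_cancel₀ h2]
  -- Since `v` moves the `x₀`-coordinate at no cost, this coordinate becomes free and takes the
  -- place of the component of the input along `v`.
  let ι : Y × U →ₗ[ℂ] X × U :=
    (Y.subtype ∘ₗ LinearMap.fst ℂ Y U
      + (LinearMap.toSpanSingleton ℂ X x₀) ∘ₗ ρ ∘ₗ LinearMap.snd ℂ Y U).prod
    (LinearMap.snd ℂ Y U - (LinearMap.toSpanSingleton ℂ U v) ∘ₗ ρ ∘ₗ LinearMap.snd ℂ Y U)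
  have hι : ∀ k, ι k = ((k.1 : X) + ρ k.2 • x₀, k.2 - ρ k.2 • v) := fun k => rfl
  let S₁ := dissipation M S Pτ
  have hS₁ : ∀ f, S₁ (0, v) f = 0 := fun f => by
    rw [dissipation_apply, hSv, hPτ, hPτ, ← hx₀, hτ0, hγτ]
    simp
  have hpι : ∀ k, p (ι k).1 = k.1 := fun k => by
    rw [hι, map_add, map_smul, hpx₀, smul_zero, add_zero, hpY]
  have hst : IsStorage (p ∘ₗ M ∘ₗ ι) (S₁.comp ι) (fun y : Y => V y) := by
    have : FiniteDimensional ℝ X := FiniteDimensional.complexToReal X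
    let Yi : Y →L[ℝ] X := (Y.subtypeL).restrictScalars ℝ
    let pL : X →L[ℝ] Y := LinearMap.toContinuousLinearMap (p.restrictScalars ℝ)
    have hVY : ContDiff ℝ 1 fun y : Y => V y := h.contDiff.comp Yi.contDiff
    refine ⟨hVY, h.zero, fun y hy => h.pos y (by simpa using hy), fun k => ?_⟩
    have h1 := h.diss (ι k)
    set x := (ι k).1 with hx
    set z := M (ι k) with hz
    have h2 : HasFDerivAt V ((fderiv ℝ (fun y : Y => V y) (p x)).comp pL
        + Pτ.isBoundedBilinearMap.deriv (x, x) ∘L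
          ((ContinuousLinearMap.id ℝ X).prod (ContinuousLinearMap.id ℝ X))) x := by
      have e1 : HasFDerivAt (fun x => V (p x)) ((fderiv ℝ (fun y : Y => V y) (p x)).comp pL) x :=
        ((hVY.differentiable (by norm_num)) (p x)).hasFDerivAt.comp x pL.hasFDerivAt
      have e2 : HasFDerivAt (fun x => (Pτ x x).re) (Pτ.isBoundedBilinearMap.deriv (x, x) ∘L
          ((ContinuousLinearMap.id ℝ X).prod (ContinuousLinearMap.id ℝ X))) x :=
        HasFDerivAt.comp (f := fun x => (x, x)) x
          (Pτ.isBoundedBilinearMap.hasFDerivAt (x, x)) ((hasFDerivAt_id x).prodMk (hasFDerivAt_id x))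
      exact (e1.add e2).congr_of_eventuallyEq (Filter.Eventually.of_forall hV)
    rw [h2.fderiv] at h1
    have h3 : ((fderiv ℝ (fun y : Y => V y) (p x)).comp pL
        + Pτ.isBoundedBilinearMap.deriv (x, x) ∘L
          ((ContinuousLinearMap.id ℝ X).prod (ContinuousLinearMap.id ℝ X))) z
        = fderiv ℝ (fun y : Y => V y) (p x) (p z) + ((Pτ x z).re + (Pτ z x).re) := rfl
    rw [h3, hpι, Pτ.re_symm x z] at h1
    have h4 : (S₁.comp ι k k).re = (S (ι k) (ι k)).re - 2 * (Pτ x z).re :=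
      dissipation_quad M S Pτ (ι k)
    rw [h4]
    change fderiv ℝ (fun y : Y => V y) k.1 (p z) ≤ _
    linarith
  have hlt : Module.finrank ℂ Y < Module.finrank ℂ X := by
    apply Submodule.finrank_lt
    intro htop
    have h1 : x₀ ∈ Y := by rw [htop]; trivial
    rw [LinearMap.mem_ker, hτ0] at h1
    exact one_ne_zero h1
  obtain ⟨P', hP', hP'd⟩ := ih Y hlt _ _ _ hst
  refine ⟨Pτ + P'.comp p, fun x hx => ?_, fun f => ?_⟩
  · rw [HermForm.add_apply, Complex.add_re, hPτq, HermForm.comp_apply]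
    by_cases hpx : p x = 0
    · have h1 : τ x ≠ 0 := fun h0 => hx (by
        have := hp x
        rw [hpx, h0, zero_smul, sub_zero] at this
        exact this.symm)
      have h2 : 0 < ‖τ x‖ := norm_pos_iff.2 h1
      rw [hpx, HermForm.zero_right, Complex.zero_re, add_zero]
      positivity
    · have := hP' _ hpx
      have h2 : 0 ≤ ‖τ x‖ ^ 2 * g₀ := by positivity
      linarith
  · rw [← dissipation_dissipation]
    -- The input of `k` has `v`-component `τ f.1`, so `ι k` has the state of `f`, and its input is
    -- that of `f` without the `v`-component, which the dissipation form ignores.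
    set k : Y × U := (p f.1, f.2 - ρ f.2 • v + τ f.1 • v) with hk
    have h1 := hP'd k
    have hρk : ρ k.2 = τ f.1 := by simp [hk, hρ]
    have h2 : f = ρ f.2 • (0, v) + ι k := by
      rw [hι, hρk]
      ext1
      · simp [hk, hp]
      · simp [hk]
    have h3 : dissipation M S₁ (P'.comp p) (0, v) = fun _ => 0 := by
      funext g
      rw [dissipation_apply, hS₁, HermForm.comp_apply, HermForm.comp_apply, ← hx₀, hpx₀]; simp
    change 0 ≤ (dissipation M S₁ (P'.comp p) f f).re
    conv_rhs => rw [h2]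
    rw [HermForm.quad_add, HermForm.quad_smul, HermForm.smul_left, h3]
    simp only [Complex.zero_re, mul_zero, zero_add]
    rw [dissipation_quad] at h1 ⊢
    rw [HermForm.comp_apply, hpι]
    exact h1

end SingularInputs

/-- A system with a storage function has a positive definite quadratic one. -/
theorem IsStorage.exists_quadratic (n : ℕ) :
    ∀ (X U : Type) [NormedAddCommGroup X] [InnerProductSpace ℂ X] [FiniteDimensional ℂ X]
      [NormedAddCommGroup U] [InnerProductSpace ℂ U] [FiniteDimensional ℂ U]
      (M : X × U →ₗ[ℂ] X) (S : HermForm (X × U)) (V : X → ℝ),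
      Module.finrank ℂ X + Module.finrank ℂ U = n → IsStorage M S V →
      ∃ P : HermForm X, P.PosDef ∧ (dissipation M S P).PosSemidef := by
  induction n using Nat.strong_induction_on with
  | _ n ih =>
  intro X U _ _ _ _ _ _ M S V hn h
  by_cases hreg : RegularSupply S
  · exact h.exists_quadratic_of_regular hreg
  unfold RegularSupply at hreg
  push Not at hreg
  obtain ⟨v, hv, hSv⟩ := hreg
  have hv0 : (S (0, v) (0, v)).re = 0 := le_antisymm hSv (h.input_nonneg _ rfl)
  by_cases hMv : M (0, v) = 0
  · have hS : ∀ f, S (0, v) f = 0 := fun f => by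
      rw [h.cheap_apply rfl hv0]
      -- With this multiplier the gradient formula reads `0 = 2 |S (0, v) (f.1, 0)|²`.
      have h1 := h.fderiv_cheap (v := (0, v)) rfl hv0 f.1 (S (0, v) (f.1, 0))
      rw [hMv, smul_zero, map_zero] at h1
      have h2 : star (S (0, v) (f.1, 0)) * S (0, v) (f.1, 0)
          = ((Complex.normSq (S (0, v) (f.1, 0)) : ℝ) : ℂ) := by
        rw [mul_comm]; exact Complex.mul_conj _
      rw [h2, Complex.ofReal_re] at h1
      exact Complex.normSq_eq_zero.1 (by linarith)
    let W : Submodule ℂ U := (ℂ ∙ v)ᗮ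
    have hW : ∀ u, ∃ c : ℂ, u - c • v ∈ W := fun u => by
      obtain ⟨c, hc⟩ := Submodule.mem_span_singleton.1
        ((ℂ ∙ v).starProjection_apply_mem u)
      exact ⟨c, by rw [hc]; exact (ℂ ∙ v).sub_starProjection_mem_orthogonal u⟩
    have hlt : Module.finrank ℂ X + Module.finrank ℂ W < n := by
      have := Submodule.finrank_add_finrank_orthogonal (ℂ ∙ v)
      rw [finrank_span_singleton hv] at this
      have hW' : Module.finrank ℂ W = Module.finrank ℂ (ℂ ∙ v)ᗮ := rfl
      omega
    obtain ⟨P, hP, hPd⟩ := ih _ hlt X W (M ∘ₗ LinearMap.id.prodMap W.subtype)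
      (S.comp (LinearMap.id.prodMap W.subtype)) V rfl
      ⟨h.contDiff, h.zero, h.pos, fun f => h.diss (f.1, (f.2 : U))⟩
    exact ⟨P, hP, exists_quadratic_of_drop_input hMv hS hW hPd⟩
  · exact h.exists_quadratic_of_cheap hv0 hMv fun Y hY M' S' V' hV' =>
      ih _ (by omega) Y U M' S' V' rfl hV'

/-! ### The LMI as a dissipation inequality, and sufficiency. -/

section Matrices

variable {n q m : ℕ} (A : Matrix (Fin n) (Fin n) ℝ) (B : Matrix (Fin n) (Fin q) ℝ)
  (C : Matrix (Fin m) (Fin n) ℝ) (D : Matrix (Fin m) (Fin q) ℝ)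
  (X : Matrix (Fin q ⊕ Fin m) (Fin q ⊕ Fin m) ℝ)

/-- The quadratic form of the LMI matrix is the dissipation surplus of the storage `xᵀ P x`. -/
lemma lmiMatrix_quadForm (hX : X.IsSymm)
    (P : Matrix (Fin n) (Fin n) ℝ) (hP : P.IsSymm) (x : Fin n → ℝ) (u : Fin q → ℝ) :
    Sum.elim x u ⬝ᵥ (lmiMatrix A B C D X P *ᵥ Sum.elim x u)
      = quadSupply X u (ltiMap C D x u) - 2 * (x ⬝ᵥ (P *ᵥ ltiMap A B x u)) := by
  obtain ⟨X11, X12, X21, X22, rfl⟩ : ∃ a b c d, X = fromBlocks a b c d :=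
    ⟨_, _, _, _, (fromBlocks_toBlocks X).symm⟩
  obtain ⟨-, h12, -, h22⟩ := (isSymm_fromBlocks_iff).1 hX
  subst h12
  have hsw : ∀ {a b : ℕ} (M : Matrix (Fin a) (Fin b) ℝ) (v : Fin b → ℝ) (w : Fin a → ℝ),
      v ⬝ᵥ (Mᵀ *ᵥ w) = (M *ᵥ v) ⬝ᵥ w := fun M v w => by
    rw [dotProduct_mulVec, vecMul_transpose]
  have e1 : (B *ᵥ u) ⬝ᵥ (P *ᵥ x) = x ⬝ᵥ (P *ᵥ (B *ᵥ u)) := by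
    rw [dotProduct_comm, ← hsw, hP.eq]
  have e2 : (A *ᵥ x) ⬝ᵥ (P *ᵥ x) = x ⬝ᵥ (P *ᵥ (A *ᵥ x)) := by
    rw [dotProduct_comm, ← hsw, hP.eq]
  have e3 : (D *ᵥ u) ⬝ᵥ (X22 *ᵥ (C *ᵥ x)) = (C *ᵥ x) ⬝ᵥ (X22 *ᵥ (D *ᵥ u)) := by
    rw [dotProduct_comm, ← hsw, h22.eq]
  have e4 : (X12 *ᵥ (C *ᵥ x)) ⬝ᵥ u = u ⬝ᵥ (X12 *ᵥ (C *ᵥ x)) := dotProduct_comm _ _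
  have e5 : (X12 *ᵥ (D *ᵥ u)) ⬝ᵥ u = u ⬝ᵥ (X12 *ᵥ (D *ᵥ u)) := dotProduct_comm _ _
  simp only [lmiMatrix, lmiOffDiag, quadSupply, ltiMap, symPart, fromBlocks_mulVec,
    toBlocks_fromBlocks₁₁, toBlocks_fromBlocks₁₂, toBlocks_fromBlocks₂₁, toBlocks_fromBlocks₂₂,
    sumElim_dotProduct_sumElim, Sum.elim_comp_inl, Sum.elim_comp_inr, add_mulVec, neg_mulVec,
    transpose_add, transpose_neg, transpose_mul, transpose_transpose, ← mulVec_mulVec, mulVec_add,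
    dotProduct_add, add_dotProduct, dotProduct_neg, hsw, h22.eq, hP.eq]
  linarith

lemma lmiMatrix_isHermitian (hX : X.IsSymm) (P : Matrix (Fin n) (Fin n) ℝ) :
    (lmiMatrix A B C D X P).IsHermitian := by
  obtain ⟨X11, X12, X21, X22, rfl⟩ : ∃ a b c d, X = fromBlocks a b c d :=
    ⟨_, _, _, _, (fromBlocks_toBlocks X).symm⟩
  obtain ⟨h11, h12, -, h22⟩ := (isSymm_fromBlocks_iff).1 hX
  subst h12
  rw [IsHermitian, conjTranspose_eq_transpose_of_trivial]
  simp only [lmiMatrix, symPart, fromBlocks_transpose, transpose_transpose, transpose_add,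
    transpose_neg, transpose_mul, toBlocks_fromBlocks₁₁, toBlocks_fromBlocks₁₂,
    toBlocks_fromBlocks₂₂, h11.eq, h22.eq]
  congr 1
  · rw [← Matrix.mul_assoc]; abel
  · rw [← Matrix.mul_assoc]; abel

lemma lmiMatrix_posSemidef_iff (hX : X.IsSymm) (P : Matrix (Fin n) (Fin n) ℝ) (hP : P.IsSymm) :
    (lmiMatrix A B C D X P).PosSemidef ↔ ∀ x u,
      2 * (x ⬝ᵥ (P *ᵥ ltiMap A B x u)) ≤ quadSupply X u (ltiMap C D x u) := by
  rw [posSemidef_iff_dotProduct_mulVec]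
  constructor
  · rintro ⟨-, h⟩ x u
    have := h (Sum.elim x u)
    rw [star_trivial, lmiMatrix_quadForm A B C D X hX P hP] at this
    linarith
  · refine fun h => ⟨lmiMatrix_isHermitian A B C D X hX P, fun w => ?_⟩
    have hw : w = Sum.elim (w ∘ Sum.inl) (w ∘ Sum.inr) := (Sum.elim_comp_inl_inr w).symm
    rw [star_trivial, hw, lmiMatrix_quadForm A B C D X hX P hP]
    linarith [h (w ∘ Sum.inl) (w ∘ Sum.inr)]

/-- The quadratic storage function of a solution of the LMI. -/
lemma isXEID_of_lmi (hX : X.IsSymm) (𝒳 : Set (Fin n → ℝ)) {P : Matrix (Fin n) (Fin n) ℝ}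
    (hP : P.PosDef) (hL : (lmiMatrix A B C D X P).PosSemidef) :
    IsXEID (ltiMap A B) (ltiMap C D) 𝒳 X := by
  have hPs : P.IsSymm := by
    have := hP.1
    rwa [IsHermitian, conjTranspose_eq_transpose_of_trivial] at this
  have hlin : ∀ {k : ℕ} (M : Matrix (Fin k) (Fin n) ℝ) (N : Matrix (Fin k) (Fin q) ℝ) x xs u us,
      ltiMap M N x u - ltiMap M N xs us = ltiMap M N (x - xs) (u - us) := fun M N x xs u us => by
    simp only [ltiMap, mulVec_sub]; abel
  let Q : (Fin n → ℝ) →L[ℝ] (Fin n → ℝ) := LinearMap.toContinuousLinearMap (mulVecLin P)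
  have hQ : ∀ v, Q v = P *ᵥ v := fun v => rfl
  have hd : ∀ xs x, HasFDerivAt (fun z => (z - xs) ⬝ᵥ (P *ᵥ (z - xs)))
      (∑ i, ((x - xs) i • (ContinuousLinearMap.proj i ∘L Q)
        + (P *ᵥ (x - xs)) i • (ContinuousLinearMap.proj i))) x := fun xs x => by
    have h0 : HasFDerivAt (fun z => z - xs) (ContinuousLinearMap.id ℝ (Fin n → ℝ)) x :=
      (hasFDerivAt_id x).sub_const xs
    have h1 : ∀ i, HasFDerivAt (fun z => (z - xs) i)
        (ContinuousLinearMap.proj (R := ℝ) (φ := fun _ : Fin n => ℝ) i) x := fun i =>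
      (ContinuousLinearMap.proj (R := ℝ) (φ := fun _ : Fin n => ℝ) i).hasFDerivAt.comp x h0
    have h2 : ∀ i, HasFDerivAt (fun z => (P *ᵥ (z - xs)) i)
        (ContinuousLinearMap.proj (R := ℝ) (φ := fun _ : Fin n => ℝ) i ∘L Q) x := fun i =>
      (ContinuousLinearMap.proj (R := ℝ) (φ := fun _ : Fin n => ℝ) i ∘L Q).hasFDerivAt.comp x h0
    exact HasFDerivAt.fun_sum fun i _ => (h1 i).mul (h2 i)
  refine ⟨fun x xs => (x - xs) ⬝ᵥ (P *ᵥ (x - xs)), ?_, fun xs _ => ⟨fun x hx => ?_, ?_, ?_⟩⟩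
  · apply ContDiff.contDiffOn
    have h0 : ContDiff ℝ 1 fun z : (Fin n → ℝ) × (Fin n → ℝ) => z.1 - z.2 :=
      contDiff_fst.sub contDiff_snd
    have h2 : ContDiff ℝ 1 fun z : (Fin n → ℝ) × (Fin n → ℝ) => Q (z.1 - z.2) :=
      Q.contDiff.comp h0
    change ContDiff ℝ 1 fun z : (Fin n → ℝ) × (Fin n → ℝ) =>
      ∑ i, (z.1 - z.2) i * Q (z.1 - z.2) i
    exact ContDiff.sum fun i _ => (contDiff_pi.1 h0 i).mul (contDiff_pi.1 h2 i)
  · have := hP.dotProduct_mulVec_pos (sub_ne_zero.2 hx)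
    rwa [star_trivial] at this
  · simp
  · intro us hus x u
    have h1 := (lmiMatrix_posSemidef_iff A B C D X hX P hPs).1 hL (x - xs) (u - us)
    have h2 : ltiMap A B x u = ltiMap A B (x - xs) (u - us) := by
      rw [← hlin, hus, sub_zero]
    rw [(hd xs x).fderiv, hlin, h2]
    refine le_trans (le_of_eq ?_) h1
    set v := ltiMap A B (x - xs) (u - us)
    have h4 : (x - xs) ⬝ᵥ (P *ᵥ v) = (P *ᵥ (x - xs)) ⬝ᵥ v := by
      rw [dotProduct_mulVec, ← mulVec_transpose, hPs.eq]
    have h5 : (∑ i, ((x - xs) i • (ContinuousLinearMap.proj i ∘L Q)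
        + (P *ᵥ (x - xs)) i • (ContinuousLinearMap.proj (R := ℝ) (φ := fun _ : Fin n => ℝ) i))) v
        = (x - xs) ⬝ᵥ (P *ᵥ v) + (P *ᵥ (x - xs)) ⬝ᵥ v := by
      simp only [_root_.sum_apply, _root_.add_apply, _root_.smul_apply,
        ContinuousLinearMap.comp_apply, ContinuousLinearMap.proj_apply, smul_eq_mul, hQ,
        dotProduct, Finset.sum_add_distrib]
    rw [h5, ← h4]
    ring

end Matrices

/-! ### Complexification and necessity. -/

section Complexification

/-- A real storage function, summed over real and imaginary parts, is one for the complexified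
system. -/
lemma IsStorage.of_re_im {X U : Type} {E F : Type*} [NormedAddCommGroup X] [InnerProductSpace ℂ X]
    [FiniteDimensional ℂ X] [NormedAddCommGroup U] [InnerProductSpace ℂ U] [FiniteDimensional ℂ U]
    [NormedAddCommGroup E] [NormedSpace ℝ E] {M : X × U →ₗ[ℂ] X} {S : HermForm (X × U)}
    {V : E → ℝ} {φ : E → F → E} {s : E → F → ℝ} (hV : ContDiff ℝ 1 V) (hV0 : V 0 = 0)
    (hVpos : ∀ x, x ≠ 0 → 0 < V x) (hVd : ∀ x u, fderiv ℝ V x (φ x u) ≤ s x u)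
    (re im : X →L[ℝ] E) (re' im' : U → F) (hre : ∀ f, re (M f) = φ (re f.1) (re' f.2))
    (him : ∀ f, im (M f) = φ (im f.1) (im' f.2))
    (hS : ∀ f, (S f f).re = s (re f.1) (re' f.2) + s (im f.1) (im' f.2))
    (hinj : ∀ x : X, re x = 0 → im x = 0 → x = 0) :
    IsStorage M S fun x => V (re x) + V (im x) where
  contDiff := (hV.comp re.contDiff).add (hV.comp im.contDiff)
  zero := by simp [hV0]
  pos x hx := by
    have h0 : ∀ y, 0 ≤ V y := fun y => by
      rcases eq_or_ne y 0 with rfl | h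
      exacts [hV0.ge, (hVpos y h).le]
    by_cases h1 : re x = 0
    · exact add_pos_of_nonneg_of_pos (h0 _) (hVpos _ fun h2 => hx (hinj x h1 h2))
    · exact add_pos_of_pos_of_nonneg (hVpos _ h1) (h0 _)
  diss f := by
    have hd : ∀ L : X →L[ℝ] E, HasFDerivAt (fun x => V (L x)) (fderiv ℝ V (L f.1) ∘L L) f.1 :=
      fun L => ((hV.differentiable one_ne_zero) (L f.1)).hasFDerivAt.comp f.1 L.hasFDerivAt
    rw [((hd re).fun_add (hd im)).fderiv, hS]
    simp only [_root_.add_apply, ContinuousLinearMap.comp_apply, hre, him]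
    exact add_le_add (hVd _ _) (hVd _ _)

/-- The real part of a complex vector. -/
noncomputable def euclideanRe (n : ℕ) : EuclideanSpace ℂ (Fin n) →L[ℝ] (Fin n → ℝ) :=
  ContinuousLinearMap.pi fun i =>
    Complex.reCLM.comp ((EuclideanSpace.proj i : EuclideanSpace ℂ (Fin n) →L[ℂ] ℂ).restrictScalars ℝ)

/-- The imaginary part of a complex vector. -/
noncomputable def euclideanIm (n : ℕ) : EuclideanSpace ℂ (Fin n) →L[ℝ] (Fin n → ℝ) :=
  ContinuousLinearMap.pi fun i =>
    Complex.imCLM.comp ((EuclideanSpace.proj i : EuclideanSpace ℂ (Fin n) →L[ℂ] ℂ).restrictScalars ℝ)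

@[simp] lemma euclideanRe_apply {n : ℕ} (x : EuclideanSpace ℂ (Fin n)) (i : Fin n) :
    euclideanRe n x i = (x i).re := rfl

@[simp] lemma euclideanIm_apply {n : ℕ} (x : EuclideanSpace ℂ (Fin n)) (i : Fin n) :
    euclideanIm n x i = (x i).im := rfl

/-- A real vector as a complex one. -/
noncomputable def euclideanOfReal {n : ℕ} (x : Fin n → ℝ) : EuclideanSpace ℂ (Fin n) :=
  WithLp.toLp 2 fun i => (x i : ℂ)

@[simp] lemma euclideanOfReal_apply {n : ℕ} (x : Fin n → ℝ) (i : Fin n) :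
    euclideanOfReal x i = (x i : ℂ) := rfl

@[simp] lemma euclideanRe_ofReal {n : ℕ} (x : Fin n → ℝ) :
    euclideanRe n (euclideanOfReal x) = x := by ext i; simp

@[simp] lemma euclideanIm_ofReal {n : ℕ} (x : Fin n → ℝ) :
    euclideanIm n (euclideanOfReal x) = 0 := by ext i; simp

/-- The complexification of `(x, u) ↦ M x + N u`. -/
noncomputable def complexLtiMap {n q k : ℕ} (M : Matrix (Fin k) (Fin n) ℝ)
    (N : Matrix (Fin k) (Fin q) ℝ) :
    EuclideanSpace ℂ (Fin n) × EuclideanSpace ℂ (Fin q) →ₗ[ℂ] EuclideanSpace ℂ (Fin k) where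
  toFun f := WithLp.toLp 2 fun i => ∑ j, (M i j : ℂ) * f.1 j + ∑ j, (N i j : ℂ) * f.2 j
  map_add' f g := by
    ext i
    simp only [Prod.fst_add, Prod.snd_add, PiLp.add_apply, mul_add, Finset.sum_add_distrib]
    ring
  map_smul' c f := by
    ext i
    simp only [Prod.smul_fst, Prod.smul_snd, PiLp.smul_apply, smul_eq_mul, RingHom.id_apply,
      mul_add, Finset.mul_sum]
    congr 1 <;> exact Finset.sum_congr rfl fun j _ => by ring

lemma complexLtiMap_apply {n q k : ℕ} (M : Matrix (Fin k) (Fin n) ℝ)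
    (N : Matrix (Fin k) (Fin q) ℝ) (f) (i : Fin k) : complexLtiMap M N f i
      = ∑ j, (M i j : ℂ) * f.1 j + ∑ j, (N i j : ℂ) * f.2 j := rfl

lemma euclideanRe_complexLtiMap {n q k : ℕ} (M : Matrix (Fin k) (Fin n) ℝ)
    (N : Matrix (Fin k) (Fin q) ℝ) (f) :
    euclideanRe k (complexLtiMap M N f) = ltiMap M N (euclideanRe n f.1) (euclideanRe q f.2) := by
  ext i
  simp [complexLtiMap_apply, ltiMap, mulVec, dotProduct]

lemma euclideanIm_complexLtiMap {n q k : ℕ} (M : Matrix (Fin k) (Fin n) ℝ)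
    (N : Matrix (Fin k) (Fin q) ℝ) (f) :
    euclideanIm k (complexLtiMap M N f) = ltiMap M N (euclideanIm n f.1) (euclideanIm q f.2) := by
  ext i
  simp [complexLtiMap_apply, ltiMap, mulVec, dotProduct]

lemma complexLtiMap_ofReal {n q k : ℕ} (M : Matrix (Fin k) (Fin n) ℝ)
    (N : Matrix (Fin k) (Fin q) ℝ) (x : Fin n → ℝ) (u : Fin q → ℝ) :
    complexLtiMap M N (euclideanOfReal x, euclideanOfReal u) = euclideanOfReal (ltiMap M N x u) := by
  ext i
  simp [complexLtiMap_apply, ltiMap, mulVec, dotProduct]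

/-- The Hermitian extension of the supply rate of `X` to complex inputs and outputs. -/
noncomputable def complexSupply {q m : ℕ} (X : Matrix (Fin q ⊕ Fin m) (Fin q ⊕ Fin m) ℝ)
    (hX : X.IsSymm) : HermForm (EuclideanSpace ℂ (Fin q) × EuclideanSpace ℂ (Fin m)) where
  toFun f g := ∑ i, ∑ j, star (Sum.elim (f.1 ·) (f.2 ·) i) * (X i j : ℂ) * Sum.elim (g.1 ·) (g.2 ·) j
  add_right' f g h := by
    simp only [← Finset.sum_add_distrib]
    refine Finset.sum_congr rfl fun i _ => Finset.sum_congr rfl fun j _ => ?_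
    rw [← mul_add]
    cases j <;> rfl
  smul_right' f c g := by
    simp only [Finset.mul_sum]
    refine Finset.sum_congr rfl fun i _ => Finset.sum_congr rfl fun j _ => ?_
    rw [mul_left_comm]
    cases j <;> rfl
  conj_symm' f g := by
    rw [star_sum, Finset.sum_congr rfl fun i _ => star_sum _ _, Finset.sum_comm]
    refine Finset.sum_congr rfl fun i _ => Finset.sum_congr rfl fun j _ => ?_
    have h : X j i = X i j := hX.apply i j
    simp only [star_mul', star_star, h]
    rw [show star (X i j : ℂ) = (X i j : ℂ) from Complex.conj_ofReal _]
    ring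

lemma complexSupply_quad {q m : ℕ} (X : Matrix (Fin q ⊕ Fin m) (Fin q ⊕ Fin m) ℝ)
    (hX : X.IsSymm) (f) : (complexSupply X hX f f).re
      = quadSupply X (euclideanRe q f.1) (euclideanRe m f.2)
        + quadSupply X (euclideanIm q f.1) (euclideanIm m f.2) := by
  have hr : ∀ i, Sum.elim (euclideanRe q f.1) (euclideanRe m f.2) i
      = (Sum.elim (f.1 ·) (f.2 ·) i : ℂ).re := by rintro (i | i) <;> rfl
  have hi : ∀ i, Sum.elim (euclideanIm q f.1) (euclideanIm m f.2) i
      = (Sum.elim (f.1 ·) (f.2 ·) i : ℂ).im := by rintro (i | i) <;> rfl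
  simp only [complexSupply, quadSupply, dotProduct, mulVec, Finset.mul_sum, Complex.re_sum,
    ← Finset.sum_add_distrib, hr, hi]
  refine Finset.sum_congr rfl fun i _ => Finset.sum_congr rfl fun j _ => ?_
  simp
  ring

/-- A Hermitian form on `ℂⁿ` restricts to a symmetric form on `ℝⁿ`. -/
lemma HermForm.exists_real_matrix {n : ℕ} (P : HermForm (EuclideanSpace ℂ (Fin n))) :
    ∃ Q : Matrix (Fin n) (Fin n) ℝ, Q.IsSymm ∧ ∀ x y : Fin n → ℝ,
      x ⬝ᵥ (Q *ᵥ y) = (P (euclideanOfReal x) (euclideanOfReal y)).re := by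
  have hadd : ∀ x y : Fin n → ℝ, euclideanOfReal (x + y) = euclideanOfReal x + euclideanOfReal y :=
    fun x y => by ext i; simp
  have hsmul : ∀ (c : ℝ) (x : Fin n → ℝ), euclideanOfReal (c • x) = (c : ℂ) • euclideanOfReal x :=
    fun c x => by ext i; simp
  let b : LinearMap.BilinForm ℝ (Fin n → ℝ) := LinearMap.mk₂ ℝ
    (fun x y => (P (euclideanOfReal x) (euclideanOfReal y)).re)
    (fun x y z => by rw [hadd, P.add_left, Complex.add_re])
    (fun c x y => by
      rw [hsmul, P.smul_left, show star (c : ℂ) = (c : ℂ) from Complex.conj_ofReal c]; simp)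
    (fun x y z => by rw [hadd, P.add_right, Complex.add_re])
    (fun c x y => by rw [hsmul, P.smul_right]; simp)
  refine ⟨LinearMap.toMatrix₂' ℝ b, ?_, fun x y => ?_⟩
  · ext i j
    simp only [transpose_apply, LinearMap.toMatrix₂'_apply]
    exact P.re_symm _ _
  · rw [← Matrix.toLinearMap₂'_apply', Matrix.toLinearMap₂'_toMatrix']
    rfl

end Complexification

/-- A storage function of an LTI system yields a quadratic one. -/
lemma exists_lmi_of_isXEID {n q m : ℕ} (A : Matrix (Fin n) (Fin n) ℝ)
    (B : Matrix (Fin n) (Fin q) ℝ) (C : Matrix (Fin m) (Fin n) ℝ) (D : Matrix (Fin m) (Fin q) ℝ)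
    (X : Matrix (Fin q ⊕ Fin m) (Fin q ⊕ Fin m) ℝ) (hX : X.IsSymm)
    (𝒳 : Set (Fin n → ℝ)) (h𝒳 : IsEquilibriumSet (ltiMap A B) 𝒳)
    (h : IsXEID (ltiMap A B) (ltiMap C D) 𝒳 X) :
    ∃ P : Matrix (Fin n) (Fin n) ℝ, P.PosDef ∧ (lmiMatrix A B C D X P).PosSemidef := by
  obtain ⟨V, hV, hVe⟩ := h
  -- One equilibrium suffices, since its shifted inequality already involves all states and inputs.
  obtain ⟨xs, hxs⟩ := h𝒳.1
  obtain ⟨us, hus⟩ := h𝒳.2 xs hxs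
  obtain ⟨hpos, hzero, hdiss⟩ := hVe xs hxs
  have hlin : ∀ {k : ℕ} (M : Matrix (Fin k) (Fin n) ℝ) (N : Matrix (Fin k) (Fin q) ℝ) x u,
      ltiMap M N (x + xs) (u + us) = ltiMap M N x u + ltiMap M N xs us := fun M N x u => by
    simp only [ltiMap, mulVec_add]; abel
  have hW : ContDiff ℝ 1 fun x => V (x + xs) xs := by
    rw [← contDiffOn_univ]
    exact hV.comp (f := fun x => (x + xs, xs))
      ((contDiff_id.add contDiff_const).prodMk contDiff_const).contDiffOn
      fun x _ => ⟨trivial, hxs⟩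
  have hWd : ∀ x u, fderiv ℝ (fun x => V (x + xs) xs) x (ltiMap A B x u)
      ≤ quadSupply X u (ltiMap C D x u) := fun x u => by
    have h1 := hdiss us hus (x + xs) (u + us)
    rw [hlin, hlin, hus, add_zero, add_sub_cancel_right, add_sub_cancel_right] at h1
    rwa [fderiv_comp_add_right (f := fun z => V z xs)]
  have hst : IsStorage (complexLtiMap A B)
      ((complexSupply X hX).comp (LinearMap.prod (LinearMap.snd ℂ _ _) (complexLtiMap C D)))
      fun x => V (euclideanRe n x + xs) xs + V (euclideanIm n x + xs) xs :=
    IsStorage.of_re_im (V := fun x => V (x + xs) xs) hW (by simpa using hzero)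
      (fun x hx => hpos _ (by simpa using hx)) hWd (euclideanRe n) (euclideanIm n) (euclideanRe q)
      (euclideanIm q) (euclideanRe_complexLtiMap A B) (euclideanIm_complexLtiMap A B)
      (fun f => by
        rw [HermForm.comp_apply, complexSupply_quad]
        simp only [LinearMap.prod_apply, Function.prod_apply, LinearMap.snd_apply, euclideanRe_complexLtiMap,
          euclideanIm_complexLtiMap])
      (fun x h1 h2 => by
        ext i
        exact Complex.ext (congrFun h1 i) (congrFun h2 i))
  obtain ⟨P, hP, hPd⟩ := IsStorage.exists_quadratic _ _ _ _ _ _ rfl hst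
  obtain ⟨Q, hQs, hQ⟩ := P.exists_real_matrix
  refine ⟨Q, ?_, (lmiMatrix_posSemidef_iff A B C D X hX Q hQs).2 fun x u => ?_⟩
  · refine Matrix.PosDef.of_dotProduct_mulVec_pos
      (by rw [IsHermitian, conjTranspose_eq_transpose_of_trivial, hQs.eq]) fun x hx => ?_
    rw [star_trivial, hQ]
    refine hP _ fun h0 => hx ?_
    rw [← euclideanRe_ofReal x, h0, map_zero]
  · have h1 := hPd (euclideanOfReal x, euclideanOfReal u)
    rw [dissipation_quad, HermForm.comp_apply, complexSupply_quad] at h1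
    simp only [LinearMap.prod_apply, Function.prod_apply, LinearMap.snd_apply, complexLtiMap_ofReal,
      euclideanRe_ofReal, euclideanIm_ofReal] at h1
    rw [← hQ] at h1
    have h0 : quadSupply X (0 : Fin q → ℝ) (0 : Fin m → ℝ) = 0 := by simp [quadSupply]
    linarith

theorem proposition1 {n q m : ℕ}
    (A : Matrix (Fin n) (Fin n) ℝ) (B : Matrix (Fin n) (Fin q) ℝ)
    (C : Matrix (Fin m) (Fin n) ℝ) (D : Matrix (Fin m) (Fin q) ℝ)
    (X : Matrix (Fin q ⊕ Fin m) (Fin q ⊕ Fin m) ℝ) (hX : X.IsSymm)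
    (𝒳 : Set (Fin n → ℝ)) (h𝒳 : IsEquilibriumSet (ltiMap A B) 𝒳) :
    IsXEID (ltiMap A B) (ltiMap C D) 𝒳 X ↔
      ∃ P : Matrix (Fin n) (Fin n) ℝ, P.PosDef ∧ (lmiMatrix A B C D X P).PosSemidef :=
  ⟨exists_lmi_of_isXEID A B C D X hX 𝒳 h𝒳,
    fun ⟨_, hP, hL⟩ => isXEID_of_lmi A B C D X hX 𝒳 hP hL⟩
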